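/- **Setting.** Let $T>0$, $I=(0,T)$, and let $f:[0,T]\times\mathbb R\times\mathbb R\to\mathbb R$ be of class $C^2$ (up to the boundary) with $|f(t,x_1,y_1)-f(t,x_2,y_2)|\le L(|x_1-x_2|+|y_1-y_2|)$ for all $t\in[0,T]$, $x_i,y_i\in\mathbb R$, where $L>0$. Let $u$ denote the solution of $u''=f(t,u,u')$ on $[0,T]$, $u(0)=u_0$, $u'(0)=u_1$. Let $0=t_0<t_1<\dots<t_N=T$ be a partition, $I_n=(t_{n-1},t_n)$, $k_n=t_n-t_{n-1}$, $k=\max_n k_n$, and let $r_n\ge 3$ be integers. A $C^1$-continuous Petrov–Galerkin solution is a function $U\in H^2(I)$ (identified with its $C^1([0,T])$ representative) such that $U|_{I_n}$ is a polynomial of degree at most $r_n$ for each $n$, $U(0)=u_0$, $U'(0)=u_1$, and $$\sum_{n=1}^N\int_{I_n}U''\varphi\,dt=\sum_{n=1}^N\int_{I_n}f(t,U,U')\varphi\,dt$$ for all $\varphi\in L^2(I)$ with $\varphi|_{I_n}$ a polynomial of degree at most $r_n-2$ for each $n$. For an interval $J$ and an integer $m\ge 0$, $H^m(J)$ is the usual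 Sobolev space with norm $\big(\sum_{i\le m}\|v^{(i)}\|_{L^2(J)}^2\big)^{1/2}$; for $0<\theta<1$, $H^{m+\theta}(J)$ is the interpolation space $(H^m(J),H^{m+1}(J))_{\theta,2}$ given by the $K$-method, with norm $\big(\int_0^\infty (t^{-\theta}K(t,v))^2\,\frac{dt}{t}\big)^{1/2}$. **Theorem.** There is $\delta>0$ (depending only on $T$, $f$, $L$) such that for all $u_0,u_1$ and the corresponding $u$ the following hold. (a) There is $C>0$, independent of the partition, of the degrees $r_n$ and of the numbers $s_{0,n},s_n$ below, such that for every partition with $k_n\le\delta$, all $r_n\ge3$, every $C^1$-continuous Petrov–Galerkin solution $U$, all real $s_{0,n}\ge1$ with $u|_{I_n}\in H^{s_{0,n}+1}(I_n)$, and all real $s_n$ with $1\le s_n\le\min\{r_n,s_{0,n}\}$, $$\|u-U\|_{L^2(I)}^2\le C\max_{1\le n\le N}\Big(\frac{k_n}{r_n}\Big)^4\,S+C\max_{1\le n\le N}\Big(\frac{k_n}{r_n}\Big)^3\,S^2,$$ where $$S=\sum_{n=1}^N\Big(\frac{k_n}{2}\Big)^{2s_n-2}\frac{\Gamma(r_n-s_n+1)}{\Gamma(r_n+s_n-1)}\|u\|_{H^{s_n+1}(I_n)}^2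 .$$ (b) Let $C_q\ge1$, let $s\ge\frac32$ be real, and suppose $u\in H^{s+1}(I)$. Then there is $C>0$, independent of the partition and of $r$, such that for every partition with $k_n\le\delta$ that is quasi-uniform in the sense $1\le k/k_n\le C_q$ for all $n$, every $r\ge3$, and every $C^1$-continuous Petrov–Galerkin solution $U$ with $r_n\equiv r$, $$\|u-U\|_{L^2(I)}\le C\,\frac{k^{\min\{s,r\}+1}}{r^{s+1}}\,\|u\|_{H^{s+1}(I)} .$$ -/

import Mathlib

open MeasureTheory Set
open scoped ENNReal ContDiff

noncomputable section

namespace CPG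

/-! ### Sobolev spaces on a bounded open interval `(a, b)` -/

/-- `v` is the weak derivative of order `i` of `u` on the open interval `(a, b)`. -/
def HasWeakDeriv (a b : ℝ) (i : ℕ) (u v : ℝ → ℝ) : Prop :=
  LocallyIntegrableOn u (Ioo a b) ∧ LocallyIntegrableOn v (Ioo a b) ∧
    ∀ φ : ℝ → ℝ, ContDiff ℝ ∞ φ → HasCompactSupport φ → tsupport φ ⊆ Ioo a b →
      ∫ x in Ioo a b, u x * iteratedDeriv i φ x = (-1) ^ i * ∫ x in Ioo a b, v x * φ x

/-- The `L²(a, b)`-norm of the weak derivative of order `i` of `u`. Weak derivatives are unique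
almost everywhere, so the infimum runs over one value; it is `⊤` if there is no weak derivative. -/
def weakSeminorm (a b : ℝ) (i : ℕ) (u : ℝ → ℝ) : ℝ≥0∞ :=
  ⨅ (v : ℝ → ℝ) (_ : HasWeakDeriv a b i u v), eLpNorm v 2 (volume.restrict (Ioo a b))

/-- The norm of `H^m(a, b)` for an integer `m ≥ 0`, with value `⊤` off `H^m(a, b)`. -/
def intSobolevENorm (a b : ℝ) (m : ℕ) (u : ℝ → ℝ) : ℝ≥0∞ :=
  (∑ i ∈ Finset.range (m + 1), weakSeminorm a b i u ^ 2) ^ (1 / 2 : ℝ)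

/-- Peetre's `K`-functional of the couple `(H^m(a, b), H^(m+1)(a, b))`: the infimum of
`‖v‖_{H^m} + t ‖w‖_{H^(m+1)}` over all decompositions `u = v + w`. -/
def kFunctional (a b : ℝ) (m : ℕ) (t : ℝ) (u : ℝ → ℝ) : ℝ≥0∞ :=
  ⨅ w : ℝ → ℝ, intSobolevENorm a b m (u - w) + ENNReal.ofReal t * intSobolevENorm a b (m + 1) w

/-- The norm of the real interpolation space `(H^m(a, b), H^(m+1)(a, b))_{θ, 2}`, that is,
the square root of `∫_0^∞ (t^(-θ) K(t, u))² dt / t`. -/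
def interpENorm (a b : ℝ) (m : ℕ) (θ : ℝ) (u : ℝ → ℝ) : ℝ≥0∞ :=
  (∫⁻ t in Ioi (0 : ℝ),
    (ENNReal.ofReal (t ^ (-θ)) * kFunctional a b m t u) ^ 2 * ENNReal.ofReal (1 / t)) ^ (1 / 2 : ℝ)

/-- The norm of `H^s(a, b)` for real `s ≥ 0` (with value `⊤` off the space): the usual norm for
integers `s`, and the `K`-method between the two neighbouring integer orders otherwise. -/
def sobolevENorm (a b s : ℝ) (u : ℝ → ℝ) : ℝ≥0∞ :=
  if s = (⌊s⌋₊ : ℝ) then intSobolevENorm a b ⌊s⌋₊ u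
  else interpENorm a b ⌊s⌋₊ (s - ⌊s⌋₊) u

/-- `u|_(a, b)` belongs to `H^s(a, b)`. -/
def MemSobolev (a b s : ℝ) (u : ℝ → ℝ) : Prop := sobolevENorm a b s u < ⊤

/-- The real-valued norm of `H^s(a, b)`, meaningful for members of the space. -/
def sobolevNorm (a b s : ℝ) (u : ℝ → ℝ) : ℝ := (sobolevENorm a b s u).toReal

/-- The `L²(a, b)`-norm. -/
def L2Norm (a b : ℝ) (u : ℝ → ℝ) : ℝ := (eLpNorm u 2 (volume.restrict (Ioo a b))).toReal

/-! ### The initial value problem -/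

/-- `f` satisfies the Lipschitz condition in `(u, u')` with constant `L`, uniformly in
`t ∈ [0, T]`. -/
def UniformLipschitz (T L : ℝ) (f : ℝ → ℝ → ℝ → ℝ) : Prop :=
  ∀ t ∈ Icc 0 T, ∀ x₁ y₁ x₂ y₂ : ℝ,
    |f t x₁ y₁ - f t x₂ y₂| ≤ L * (|x₁ - x₂| + |y₁ - y₂|)

/-- `u` solves `u'' = f(t, u, u')` on `[0, T]`, `u(0) = u₀`, `u'(0) = u₁`
(one-sided derivatives at the end points). -/
def IsExactSolution (T : ℝ) (f : ℝ → ℝ → ℝ → ℝ) (u₀ u₁ : ℝ) (u : ℝ → ℝ) : Prop :=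
  ∃ v : ℝ → ℝ,
    (∀ t ∈ Icc 0 T, HasDerivWithinAt u (v t) (Icc 0 T) t) ∧
    (∀ t ∈ Icc 0 T, HasDerivWithinAt v (f t (u t) (v t)) (Icc 0 T) t) ∧
    u 0 = u₀ ∧ v 0 = u₁

/-! ### Time partitions and the discrete problem -/

/-- A partition `0 = t_0 < t_1 < ⋯ < t_N = T`. -/
structure Mesh (T : ℝ) where
  /-- the number of subintervals -/
  N : ℕ
  /-- the nodal points -/
  node : Fin (N + 1) → ℝ
  strictMono : StrictMono node
  first : node 0 = 0
  last : node (Fin.last N) = T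

namespace Mesh

variable {T : ℝ} (P : Mesh T)

/-- Left end point of the subinterval with index `n`. -/
def left (n : Fin P.N) : ℝ := P.node n.castSucc

/-- Right end point of the subinterval with index `n`. -/
def right (n : Fin P.N) : ℝ := P.node n.succ

/-- The local time step. -/
def step (n : Fin P.N) : ℝ := P.right n - P.left n

/-- The length of the largest subinterval. -/
def maxStep : ℝ := ⨆ n : Fin P.N, P.step n

/-- Quasi-uniformity with constant `Cq`: `1 ≤ k / k_n ≤ Cq` (the lower bound always holds). -/
def QuasiUniform (Cq : ℝ) : Prop := ∀ n : Fin P.N, P.maxStep / P.step n ≤ Cq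

/-- On every open subinterval, `U` is a polynomial of degree at most `d n`. -/
def PiecewisePoly (d : Fin P.N → ℕ) (U : ℝ → ℝ) : Prop :=
  ∀ n : Fin P.N, ∃ p : Polynomial ℝ, p.natDegree ≤ d n ∧
    ∀ t ∈ Ioo (P.left n) (P.right n), U t = p.eval t

/-- The trial space: functions in `H²(0, T)`, taken as their `C¹([0, T])` representatives,
that are piecewise polynomials of degrees at most `r n`. -/
def MemTrial (r : Fin P.N → ℕ) (U : ℝ → ℝ) : Prop :=
  MemSobolev 0 T 2 U ∧ ContDiffOn ℝ 1 U (Icc 0 T) ∧ P.PiecewisePoly r U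

/-- The test space: functions in `L²(0, T)` that are piecewise polynomials of degrees at most
`r n - 2`. -/
def MemTest (r : Fin P.N → ℕ) (φ : ℝ → ℝ) : Prop :=
  MemLp φ 2 (volume.restrict (Ioo 0 T)) ∧ P.PiecewisePoly (fun n => r n - 2) φ

/-- `U` is a `C¹`-continuous Petrov-Galerkin solution for the mesh `P` and the degrees `r`. -/
def IsCPGSolution (r : Fin P.N → ℕ) (f : ℝ → ℝ → ℝ → ℝ) (u₀ u₁ : ℝ) (U : ℝ → ℝ) : Prop :=
  P.MemTrial r U ∧ U 0 = u₀ ∧ derivWithin U (Icc 0 T) 0 = u₁ ∧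
    ∀ φ : ℝ → ℝ, P.MemTest r φ →
      ∑ n : Fin P.N, ∫ t in Ioo (P.left n) (P.right n), deriv (deriv U) t * φ t =
        ∑ n : Fin P.N, ∫ t in Ioo (P.left n) (P.right n), f t (U t) (deriv U t) * φ t

/-- The sum over `n` of
`(k_n / 2)^(2 s_n - 2) Γ(r_n - s_n + 1) / Γ(r_n + s_n - 1) ‖u‖²_{H^(s_n + 1)(I_n)}`. -/
def approxSum (r : Fin P.N → ℕ) (s : Fin P.N → ℝ) (u : ℝ → ℝ) : ℝ :=
  ∑ n : Fin P.N, (P.step n / 2) ^ (2 * s n - 2) *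
    (Real.Gamma ((r n : ℝ) - s n + 1) / Real.Gamma ((r n : ℝ) + s n - 1)) *
    sobolevNorm (P.left n) (P.right n) (s n + 1) u ^ 2

end Mesh

end CPG

end

/-!
The proof compares `u` and `U` directly, without a dual problem.

Let `e = u - U`, let `h` be the largest quotient `k_n / r_n`, let `η` be the error of the piecewise
`L²`-projection of `u''` onto polynomials of degree at most `r_n - 2`, and let `G` be the projection
of `g = f(t, u, u') - f(t, U, U')`. The discrete equation says that `U''` is piecewise the projection
of `f(t, U, U')`, so `e'' = η + G`. Write `e = b + z`, where `b'' = η`, `z'' = G`, and both vanish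
at `0` together with their first derivatives.

* *Smoothing.* A function orthogonal to polynomials on each subinterval has an antiderivative that
  vanishes at the nodes, is smaller by a factor of order `h`, and is again orthogonal, with one degree
  less (`integral_primitive_sq_le`, `Mesh.Orth.wsq_prim_le`, `Mesh.Orth.prim`). As `r_n ≥ 3`, this
  applies twice to `η`, and `‖b‖` is bounded by a multiple of `h² ‖η‖`.
* *Stability.* The Lipschitz condition and Hardy's inequality with an exponential weight absorb the
  feedback of `z` into `G` (`stability_energy`), which gives `‖e‖ + ‖e'‖` of order `h ‖η‖`. The
  projection is stable in the weighted norm because the steps are small (`Mesh.wsq_glue_le`).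
* *Linearization.* Along `u`, the right-hand side is linear in `(e, e')` up to a quadratic term
  (`exists_linearization`), whose `L¹`-norm is therefore of order `h² ‖η‖²`. In the linear problem the
  term with `b'` is integrated by parts, and `g - G` has an antiderivative of order `h²`
  (`stability_linearized`). Altogether `‖e‖` is of order `h² ‖η‖` (`exists_error_le`).

It remains to bound `‖η‖`, a question of best approximation by polynomials. For a polynomial, the
spectral gaps of the Gegenbauer operators with weights `((x - a) (b - x)) ^ i`, applied to the
successive derivatives, give the factor `(n - m)! / (n + m)!` (`spectral_gap`, `exists_poly_approx`).
Density extends this to functions with weak derivatives in `L²` (`exists_poly_near_chain`), which are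
iterated antiderivatives by the lemma of du Bois-Reymond. The norms of fractional order enter through
the `K`-functional (`le_interpENorm`): on each subinterval, together with the logarithmic convexity
of the Gamma function, in `IsProj.integral_sq_le_sobolevNorm`, and for one decomposition on the whole
interval in `Mesh.eLpNorm_sub_glue_le_sobolevNorm`.
-/

namespace CPG

open Polynomial

/-! ### Polynomials and Gegenbauer weights -/

/-- The integral over `(a, b)` as a linear functional on polynomials. -/
noncomputable def polyIntegral (a b : ℝ) : ℝ[X] →ₗ[ℝ] ℝ where
  toFun p := ∫ x in a..b, p.eval x
  map_add' p q := by
    simp only [eval_add]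
    exact intervalIntegral.integral_add (p.continuous.intervalIntegrable _ _)
      (q.continuous.intervalIntegrable _ _)
  map_smul' c p := by
    simp only [eval_smul, smul_eq_mul, RingHom.id_apply]
    exact intervalIntegral.integral_const_mul _ _

/-- The polynomial `(x - a) (b - x)`, positive on `(a, b)` and zero at the end points. -/
noncomputable def bubble (a b : ℝ) : ℝ[X] := (X - C a) * (C b - X)

variable {a b : ℝ}

lemma polyIntegral_apply (p : ℝ[X]) : polyIntegral a b p = ∫ x in a..b, p.eval x := rfl

lemma polyIntegral_derivative (p : ℝ[X]) :
    polyIntegral a b (derivative p) = p.eval b - p.eval a := by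
  rw [polyIntegral_apply]
  exact intervalIntegral.integral_eq_sub_of_hasDerivAt (fun x _ => p.hasDerivAt x)
    ((derivative p).continuous.intervalIntegrable _ _)

lemma polyIntegral_nonneg (hab : a ≤ b) {p : ℝ[X]} (hp : ∀ x ∈ Icc a b, 0 ≤ p.eval x) :
    0 ≤ polyIntegral a b p :=
  intervalIntegral.integral_nonneg hab hp

lemma polyIntegral_mono (hab : a ≤ b) {p q : ℝ[X]} (h : ∀ x ∈ Icc a b, p.eval x ≤ q.eval x) :
    polyIntegral a b p ≤ polyIntegral a b q :=
  intervalIntegral.integral_mono_on hab (p.continuous.intervalIntegrable _ _)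
    (q.continuous.intervalIntegrable _ _) h

lemma bubble_eval_nonneg {x : ℝ} (hx : x ∈ Icc a b) : 0 ≤ (bubble a b).eval x := by
  simp only [bubble, eval_mul, eval_sub, eval_X, eval_C]
  exact mul_nonneg (by linarith [hx.1]) (by linarith [hx.2])

lemma bubble_eval_pos {x : ℝ} (hx : x ∈ Ioo a b) : 0 < (bubble a b).eval x := by
  simp only [bubble, eval_mul, eval_sub, eval_X, eval_C]
  exact mul_pos (by linarith [hx.1]) (by linarith [hx.2])

lemma bubble_eval_le (x : ℝ) : (bubble a b).eval x ≤ ((b - a) / 2) ^ 2 := by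
  simp only [bubble, eval_mul, eval_sub, eval_X, eval_C]
  nlinarith [sq_nonneg (x - (a + b) / 2)]

lemma weighted_sq_nonneg (hab : a ≤ b) (i : ℕ) (p : ℝ[X]) :
    0 ≤ polyIntegral a b (bubble a b ^ i * p * p) := by
  refine polyIntegral_nonneg hab fun x hx => ?_
  have h := pow_nonneg (bubble_eval_nonneg hx) i
  simp only [eval_mul, eval_pow]
  rw [mul_assoc]
  exact mul_nonneg h (mul_self_nonneg _)

lemma weighted_sq_eq_zero (hab : a < b) (i : ℕ) {p : ℝ[X]}
    (h : polyIntegral a b (bubble a b ^ i * p * p) = 0) : p = 0 := by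
  have hz : ∀ x ∈ Ioo a b, p.eval x = 0 := by
    by_contra! hne
    obtain ⟨c, hc, hpc⟩ := hne
    have : 0 < polyIntegral a b (bubble a b ^ i * p * p) := by
      rw [polyIntegral_apply]
      refine intervalIntegral.integral_pos hab (Polynomial.continuous _).continuousOn ?_ ?_
      · intro x hx
        have h := pow_nonneg (bubble_eval_nonneg (Ioc_subset_Icc_self hx)) i
        simp only [eval_mul, eval_pow]
        rw [mul_assoc]
        exact mul_nonneg h (mul_self_nonneg _)
      · refine ⟨c, Ioo_subset_Icc_self hc, ?_⟩
        simp only [eval_mul, eval_pow]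
        rw [mul_assoc]
        exact mul_pos (pow_pos (bubble_eval_pos hc) i) (mul_self_pos.mpr hpc)
    exact absurd h this.ne'
  exact Polynomial.eq_zero_of_infinite_isRoot p ((Ioo_infinite hab).mono fun x hx => hz x hx)

/-- Riesz representation on polynomials of degree less than `n` for the weight
`((x - a) (b - x)) ^ i`; it yields orthogonal projections. -/
lemma exists_representer (hab : a < b) (i n : ℕ) (l : ℝ[X] →ₗ[ℝ] ℝ) :
    ∃ q ∈ degreeLT ℝ n, ∀ s ∈ degreeLT ℝ n,
      polyIntegral a b (bubble a b ^ i * q * s) = l s := by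
  let V := degreeLT ℝ n
  have : FiniteDimensional ℝ V := (degreeLTEquiv ℝ n).symm.finiteDimensional
  let Φ : V →ₗ[ℝ] Module.Dual ℝ V := LinearMap.mk₂ ℝ
    (fun q s => polyIntegral a b (bubble a b ^ i * (q : ℝ[X]) * (s : ℝ[X])))
    (by intro x y z; simp [mul_add, add_mul])
    (by intro c x z; simp)
    (by intro x y z; simp [mul_add])
    (by intro c x z; simp)
  have hinj : Function.Injective Φ := by
    rw [injective_iff_map_eq_zero]
    intro q hq
    have : Φ q q = 0 := by rw [hq]; rfl
    exact Subtype.ext (weighted_sq_eq_zero hab i this)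
  have hsurj : Function.Surjective Φ :=
    (LinearMap.injective_iff_surjective_of_finrank_eq_finrank
      (Subspace.dual_finrank_eq (K := ℝ) (V := V)).symm).mp hinj
  obtain ⟨q, hq⟩ := hsurj (l.comp V.subtype)
  exact ⟨q, q.2, fun s hs => congrArg (fun φ : Module.Dual ℝ V => φ ⟨s, hs⟩) hq⟩

/-- `v` is orthogonal to the polynomials of degree less than `n` for the weight
`((x - a) (b - x)) ^ i`. -/
def WeightedOrth (a b : ℝ) (i n : ℕ) (v : ℝ[X]) : Prop :=
  ∀ s ∈ degreeLT ℝ n, polyIntegral a b (bubble a b ^ i * v * s) = 0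

lemma exists_weightedOrth_sub (hab : a < b) (i n : ℕ) (v : ℝ[X]) :
    ∃ q ∈ degreeLT ℝ n, WeightedOrth a b i n (v - q) := by
  obtain ⟨q, hq, h⟩ := exists_representer hab i n
    ((polyIntegral a b).comp (LinearMap.mulLeft ℝ (bubble a b ^ i * v)))
  refine ⟨q, hq, fun s hs => ?_⟩
  have := h s hs
  simp only [LinearMap.comp_apply, LinearMap.mulLeft_apply] at this
  rw [mul_sub, sub_mul, map_sub, this, sub_self]

/-- The Gegenbauer operator `y ↦ - w ^ (-i) (w ^ (i + 1) y')'` for `w = (x - a) (b - x)`. -/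
noncomputable def gegenbauer (a b : ℝ) (i : ℕ) (y : ℝ[X]) : ℝ[X] :=
  -(((i : ℝ[X]) + 1) * derivative (bubble a b) * derivative y +
    bubble a b * derivative (derivative y))

/-- Symmetry of the Gegenbauer operator, without boundary terms because `bubble` vanishes at the end
points. -/
lemma weighted_derivative_mul (i : ℕ) (u y : ℝ[X]) :
    polyIntegral a b (bubble a b ^ (i + 1) * derivative u * derivative y) =
      polyIntegral a b (bubble a b ^ i * u * gegenbauer a b i y) := by
  have h0 := polyIntegral_derivative (a := a) (b := b)
    (bubble a b ^ (i + 1) * u * derivative y)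
  have h1 : derivative (bubble a b ^ (i + 1) * u * derivative y) =
      bubble a b ^ (i + 1) * derivative u * derivative y -
        bubble a b ^ i * u * gegenbauer a b i y := by
    simp only [derivative_mul, derivative_pow, gegenbauer, Nat.add_sub_cancel, Nat.cast_add,
      Nat.cast_one, map_add, map_one, map_natCast]
    ring
  rw [h1, map_sub] at h0
  have : ∀ x, (bubble a b).eval x = 0 →
      (bubble a b ^ (i + 1) * u * derivative y).eval x = 0 := by
    intro x hx; simp [hx]
  rw [this b (by simp [bubble]), this a (by simp [bubble])] at h0
  linarith

/-- The Gegenbauer operator is triangular on the monomials, with diagonal entries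
`D (D + 2 i + 1)`. -/
lemma gegenbauer_coeff (i D : ℕ) (y : ℝ[X]) (hy : y ∈ degreeLT ℝ (D + 1)) (j : ℕ) (hj : D ≤ j) :
    (gegenbauer a b i y).coeff j = (D * (D + 2 * i + 1) : ℝ) * y.coeff j := by
  have hc : ∀ k, D < k → y.coeff k = 0 := by
    intro k hk
    rw [mem_degreeLT] at hy
    exact coeff_eq_zero_of_degree_lt (lt_of_lt_of_le hy (by exact_mod_cast hk))
  have e1 : gegenbauer a b i y =
      (2 * (i + 1) : ℝ) • (X * derivative y) - ((i + 1) * (a + b) : ℝ) • derivative y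
        + X * (X * derivative (derivative y)) - (a + b) • (X * derivative (derivative y))
        + (a * b) • derivative (derivative y) := by
    simp only [gegenbauer, bubble, derivative_mul, derivative_sub, derivative_X, derivative_C,
      smul_eq_C_mul, map_mul, map_add, map_one, map_natCast, map_ofNat]
    ring
  have hXd : ∀ (z : ℝ[X]) (k : ℕ), (X * derivative z).coeff k = k * z.coeff k := by
    intro z k
    rcases k with _ | k
    · simp
    · rw [coeff_X_mul, coeff_derivative]; push_cast; ring
  have hXXd : (X * (X * derivative (derivative y))).coeff j = j * (j - 1) * y.coeff j := by
    rcases j with _ | j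
    · simp
    · rw [coeff_X_mul, hXd, coeff_derivative]; push_cast; ring
  rw [e1]
  simp only [coeff_add, coeff_sub, coeff_smul, hXd, hXXd, coeff_derivative, smul_eq_mul,
    hc (j + 1) (by omega), hc (j + 1 + 1) (by omega)]
  rcases hj.eq_or_lt with rfl | hlt
  · ring
  · rw [hc j hlt]; ring

lemma gegenbauer_mem (i D : ℕ) {y : ℝ[X]} (hy : y ∈ degreeLT ℝ D) :
    gegenbauer a b i y ∈ degreeLT ℝ D := by
  rw [mem_degreeLT, degree_lt_iff_coeff_zero]
  intro j hj
  have hyj : y.coeff j = 0 := by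
    rw [mem_degreeLT] at hy
    exact coeff_eq_zero_of_degree_lt (lt_of_lt_of_le hy (by exact_mod_cast hj))
  rw [gegenbauer_coeff i j y (degreeLT_mono (by omega) hy) j le_rfl, hyj, mul_zero]

/-- Spectral gap of the Gegenbauer operator on the orthogonal complement of the polynomials of
degree less than `n`, on polynomials. The induction on the degree splits off one eigenfunction at a
time. -/
lemma spectral_gap (hab : a < b) (i n : ℕ) (D : ℕ) :
    ∀ v ∈ degreeLT ℝ D, WeightedOrth a b i n v →
      (n * (n + 2 * i + 1) : ℝ) * polyIntegral a b (bubble a b ^ i * v * v) ≤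
        polyIntegral a b (bubble a b ^ (i + 1) * derivative v * derivative v) := by
  induction D with
  | zero =>
    intro v hv _
    have : v = 0 := by
      rw [mem_degreeLT] at hv
      simpa using hv
    subst this; simp
  | succ D ih =>
    intro v hv hn
    by_cases hDn : D < n
    · rw [hn v (degreeLT_mono (by omega) hv), mul_zero]
      exact weighted_sq_nonneg hab.le _ _
    push Not at hDn
    -- `v = u + y`, where `y` has lower degree and `u` is the orthogonal polynomial of degree `D`
    obtain ⟨y, hy, hu⟩ := exists_weightedOrth_sub hab i D v
    set u := v - y with hudef
    have hv' : v = u + y := by rw [hudef]; ring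
    have hyn : WeightedOrth a b i n y := by
      intro s hs
      have h1 := hn s hs
      have h2 := hu s (degreeLT_mono hDn hs)
      rw [hv', mul_add, add_mul, map_add, h2, zero_add] at h1
      exact h1
    have hu1 : u ∈ degreeLT ℝ (D + 1) :=
      Submodule.sub_mem _ hv (degreeLT_mono (by omega) hy)
    have hyu : polyIntegral a b (bubble a b ^ i * u * y) = 0 := hu y hy
    have hyu' : polyIntegral a b (bubble a b ^ (i + 1) * derivative u * derivative y) = 0 := by
      rw [weighted_derivative_mul]
      exact hu _ (gegenbauer_mem i D hy)
    have huu : polyIntegral a b (bubble a b ^ (i + 1) * derivative u * derivative u) =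
        (D * (D + 2 * i + 1) : ℝ) * polyIntegral a b (bubble a b ^ i * u * u) := by
      rw [weighted_derivative_mul]
      have hlow : gegenbauer a b i u - (D * (D + 2 * i + 1) : ℝ) • u ∈ degreeLT ℝ D := by
        rw [mem_degreeLT, degree_lt_iff_coeff_zero]
        intro j hj
        rw [coeff_sub, coeff_smul, gegenbauer_coeff i D u hu1 j hj, smul_eq_mul, sub_self]
      have := hu _ hlow
      rw [mul_sub, map_sub, mul_smul_comm, map_smul, smul_eq_mul] at this
      linarith
    have e1 : polyIntegral a b (bubble a b ^ i * v * v) =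
        polyIntegral a b (bubble a b ^ i * u * u) + polyIntegral a b (bubble a b ^ i * y * y) := by
      have : bubble a b ^ i * v * v = bubble a b ^ i * u * u + bubble a b ^ i * y * y +
          ((2 : ℝ) • (bubble a b ^ i * u * y)) := by
        rw [hv', smul_eq_C_mul, map_ofNat]; ring
      rw [this, map_add, map_add, map_smul, hyu, smul_zero, add_zero]
    have e2 : polyIntegral a b (bubble a b ^ (i + 1) * derivative v * derivative v) =
        polyIntegral a b (bubble a b ^ (i + 1) * derivative u * derivative u) +
          polyIntegral a b (bubble a b ^ (i + 1) * derivative y * derivative y) := by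
      have : bubble a b ^ (i + 1) * derivative v * derivative v =
          bubble a b ^ (i + 1) * derivative u * derivative u +
          bubble a b ^ (i + 1) * derivative y * derivative y +
          ((2 : ℝ) • (bubble a b ^ (i + 1) * derivative u * derivative y)) := by
        rw [hv', derivative_add, smul_eq_C_mul, map_ofNat]; ring
      rw [this, map_add, map_add, map_smul, hyu', smul_zero, add_zero]
    rw [e1, e2, huu]
    have hnn := weighted_sq_nonneg hab.le i u
    have hle : (n * (n + 2 * i + 1) : ℝ) ≤ (D * (D + 2 * i + 1) : ℝ) := by
      have : (n : ℝ) ≤ D := by exact_mod_cast hDn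
      gcongr
    have := mul_le_mul_of_nonneg_right hle hnn
    linarith [ih y hy hyn]

/-- Differentiation trades one degree of orthogonality for one power of the weight. -/
lemma WeightedOrth.derivative {i n : ℕ} {v : ℝ[X]} (h : WeightedOrth a b i (n + 1) v) :
    WeightedOrth a b (i + 1) n (derivative v) := by
  intro s hs
  have h0 := polyIntegral_derivative (a := a) (b := b) (bubble a b ^ (i + 1) * v * s)
  have h1 : Polynomial.derivative (bubble a b ^ (i + 1) * v * s) =
      bubble a b ^ (i + 1) * Polynomial.derivative v * s +
        bubble a b ^ i * v * (((i : ℝ[X]) + 1) * Polynomial.derivative (bubble a b) * s +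
          bubble a b * Polynomial.derivative s) := by
    simp only [derivative_mul, derivative_pow, Nat.add_sub_cancel, Nat.cast_add,
      Nat.cast_one, map_add, map_one, map_natCast]
    ring
  have hmem : ((i : ℝ[X]) + 1) * Polynomial.derivative (bubble a b) * s +
      bubble a b * Polynomial.derivative s ∈ degreeLT ℝ (n + 1) := by
    have hc : ∀ k, n ≤ k → s.coeff k = 0 := by
      intro k hk
      rw [mem_degreeLT] at hs
      exact coeff_eq_zero_of_degree_lt (lt_of_lt_of_le hs (by exact_mod_cast hk))
    have e1 : ((i : ℝ[X]) + 1) * Polynomial.derivative (bubble a b) * s +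
        bubble a b * Polynomial.derivative s =
        ((i + 1) * (a + b) : ℝ) • s - (2 * (i + 1) : ℝ) • (X * s)
          - X * (X * Polynomial.derivative s) + (a + b) • (X * Polynomial.derivative s)
          - (a * b) • Polynomial.derivative s := by
      simp only [bubble, derivative_mul, derivative_sub, derivative_X, derivative_C,
        smul_eq_C_mul, map_mul, map_add, map_one, map_natCast, map_ofNat]
      ring
    rw [mem_degreeLT, degree_lt_iff_coeff_zero, e1]
    intro j hj
    obtain ⟨j, rfl⟩ : ∃ k, j = k + 1 := ⟨j - 1, by omega⟩
    rcases j with _ | j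
    · simp [coeff_X_mul, coeff_derivative, hc 0 (by omega), hc 1 (by omega), hc 2 (by omega)]
    · simp [coeff_X_mul, coeff_derivative, hc (j + 1) (by omega), hc (j + 1 + 1) (by omega),
        hc (j + 1 + 1 + 1) (by omega)]
  rw [h1, map_add, h _ hmem, add_zero] at h0
  rw [h0]
  simp [bubble]

/-- The factor gained from `m` derivatives in the approximation by polynomials of degree less
than `n`. It equals `(n + m)! / (n - m)!` for `m ≤ n`. -/
noncomputable def gain (n m : ℕ) : ℝ := ∏ i ∈ Finset.range m, ((n - i : ℝ) * (n + i + 1))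

lemma gain_pos {n m : ℕ} (h : m ≤ n) : 0 < gain n m := by
  refine Finset.prod_pos fun i hi => ?_
  have : (i : ℝ) < n := by exact_mod_cast (Finset.mem_range.mp hi).trans_le h
  have h0 : (0 : ℝ) ≤ i := Nat.cast_nonneg i
  exact mul_pos (by linarith) (by linarith)

lemma WeightedOrth.iterate_derivative {n : ℕ} {v : ℝ[X]} (h : WeightedOrth a b 0 n v) (m : ℕ)
    (hm : m ≤ n) : WeightedOrth a b m (n - m) (Polynomial.derivative^[m] v) := by
  induction m with
  | zero => simpa using h
  | succ m ih =>
    rw [Function.iterate_succ_apply']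
    have := ih (by omega)
    rw [show n - m = (n - (m + 1)) + 1 by omega] at this
    exact this.derivative

/-- The spectral gaps of `v, v', v'', …` for the weights of increasing order, multiplied. -/
lemma gain_mul_le (hab : a < b) {n : ℕ} {v : ℝ[X]} (h : WeightedOrth a b 0 n v) (m : ℕ)
    (hm : m ≤ n) :
    gain n m * polyIntegral a b (v * v) ≤ polyIntegral a b
      (bubble a b ^ m * Polynomial.derivative^[m] v * Polynomial.derivative^[m] v) := by
  induction m with
  | zero => simp [gain]
  | succ m ih =>
    have h1 := ih (by omega)
    have h2 := h.iterate_derivative m (by omega)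
    set z := Polynomial.derivative^[m] v with hz
    obtain ⟨D, hD⟩ : ∃ D, z ∈ degreeLT ℝ D :=
      ⟨z.natDegree + 1, mem_degreeLT.mpr (lt_of_le_of_lt degree_le_natDegree
        (by exact_mod_cast Nat.lt_succ_self _))⟩
    have h3 := spectral_gap hab m (n - m) D z hD h2
    rw [Function.iterate_succ_apply', ← hz]
    refine le_trans ?_ h3
    rw [gain, Finset.prod_range_succ, ← gain, Nat.cast_sub (by omega)]
    have hmn : (m : ℝ) ≤ n := by exact_mod_cast (by omega : m ≤ n)
    have : (0 : ℝ) ≤ (n - m) * (n + m + 1) :=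
      mul_nonneg (by linarith) (by positivity)
    calc _ = ((n - m) * (n + m + 1)) * (gain n m * polyIntegral a b (v * v)) := by ring
      _ ≤ ((n - m) * (n + m + 1)) * polyIntegral a b (bubble a b ^ m * z * z) := by gcongr
      _ = _ := by ring

/-- The best approximation of a polynomial `v` by polynomials of degree less than `n`, in terms of
the derivative of order `m`. The weight `bubble ^ m` is at most `((b - a) / 2) ^ (2 * m)`. -/
lemma exists_poly_approx (hab : a < b) {n m : ℕ} (hm : m ≤ n) (v : ℝ[X]) :
    ∃ q ∈ degreeLT ℝ n, gain n m * polyIntegral a b ((v - q) * (v - q)) ≤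
      ((b - a) / 2) ^ (2 * m) *
        polyIntegral a b (Polynomial.derivative^[m] v * Polynomial.derivative^[m] v) := by
  obtain ⟨q, hq, ho⟩ := exists_weightedOrth_sub hab 0 n v
  refine ⟨q, hq, (gain_mul_le hab ho m hm).trans ?_⟩
  have ho' := ho.iterate_derivative m hm
  set e := Polynomial.derivative^[m] (v - q) with he
  set d := Polynomial.derivative^[m] q with hd
  have hdm : d ∈ degreeLT ℝ (n - m) := by
    rw [mem_degreeLT, degree_lt_iff_coeff_zero]
    intro j hj
    rw [hd, coeff_iterate_derivative, coeff_eq_zero_of_degree_lt, smul_zero]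
    rw [mem_degreeLT] at hq
    exact lt_of_lt_of_le hq (by exact_mod_cast (by omega : n ≤ j + m))
  have hv : Polynomial.derivative^[m] v = e + d := by
    rw [he, hd, Polynomial.iterate_derivative_sub]; ring
  have hed := ho' d hdm
  have e1 : polyIntegral a b (bubble a b ^ m * (e + d) * (e + d)) =
      polyIntegral a b (bubble a b ^ m * e * e) + polyIntegral a b (bubble a b ^ m * d * d) := by
    have : bubble a b ^ m * (e + d) * (e + d) = bubble a b ^ m * e * e + bubble a b ^ m * d * d +
        ((2 : ℝ) • (bubble a b ^ m * e * d)) := by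
      rw [smul_eq_C_mul, map_ofNat]; ring
    rw [this, map_add, map_add, map_smul, hed, smul_zero, add_zero]
  have e2 := weighted_sq_nonneg hab.le m d
  rw [hv]
  refine le_trans (by linarith : _ ≤ polyIntegral a b (bubble a b ^ m * (e + d) * (e + d))) ?_
  rw [← smul_eq_mul (((b - a) / 2) ^ (2 * m)) (polyIntegral a b ((e + d) * (e + d))), ← map_smul]
  refine polyIntegral_mono hab.le fun x hx => ?_
  simp only [eval_mul, eval_pow, eval_smul, smul_eq_mul]
  rw [mul_assoc, pow_mul]
  exact mul_le_mul_of_nonneg_right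
    (pow_le_pow_left₀ (bubble_eval_nonneg hx) (bubble_eval_le x) m) (mul_self_nonneg _)

end CPG

namespace CPG

open Polynomial

variable {a b : ℝ}

/-! ### Best approximation in `L²(a, b)` -/

lemma memLp_two_intervalIntegrable_sq (hab : a ≤ b) {y z : ℝ → ℝ}
    (hy : MemLp y 2 (volume.restrict (Ioo a b))) (hz : MemLp z 2 (volume.restrict (Ioo a b))) :
    IntervalIntegrable (fun x => y x * z x) volume a b := by
  rw [intervalIntegrable_iff_integrableOn_Ioo_of_le hab]
  exact hy.integrable_mul hz

lemma memLp_two_intervalIntegrable (hab : a ≤ b) {y : ℝ → ℝ}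
    (hy : MemLp y 2 (volume.restrict (Ioo a b))) : IntervalIntegrable y volume a b := by
  rw [intervalIntegrable_iff_integrableOn_Ioo_of_le hab]
  exact hy.integrable (by norm_num)

lemma eLpNorm_two_sq (hab : a ≤ b) {y : ℝ → ℝ} (hy : MemLp y 2 (volume.restrict (Ioo a b))) :
    eLpNorm y 2 (volume.restrict (Ioo a b)) ^ 2 = ENNReal.ofReal (∫ x in a..b, y x ^ 2) := by
  have h1 := eLpNorm_nnreal_pow_eq_lintegral (p := 2) (f := y)
    (μ := volume.restrict (Ioo a b)) (by norm_num)
  have h2 : ((2 : NNReal) : ℝ≥0∞) = 2 := by norm_num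
  rw [h2] at h1
  have h3 : ((2 : NNReal) : ℝ) = (2 : ℕ) := by norm_num
  rw [h3, ENNReal.rpow_natCast] at h1
  rw [h1, intervalIntegral.integral_of_le hab, integral_Ioc_eq_integral_Ioo,
    ofReal_integral_eq_lintegral_ofReal]
  · refine lintegral_congr fun x => ?_
    rw [ENNReal.rpow_natCast, ← ofReal_norm, ← ENNReal.ofReal_pow (norm_nonneg _),
      Real.norm_eq_abs, sq_abs]
  · exact hy.integrable_sq
  · exact Filter.Eventually.of_forall fun x => sq_nonneg _

lemma continuousOn_memLp_two {y : ℝ → ℝ} (hy : ContinuousOn y (Icc a b)) :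
    MemLp y 2 (volume.restrict (Ioo a b)) := by
  obtain ⟨C, hC⟩ := isCompact_Icc.exists_bound_of_continuousOn hy
  refine MemLp.of_bound ((hy.mono Ioo_subset_Icc_self).aestronglyMeasurable measurableSet_Ioo) C ?_
  filter_upwards [ae_restrict_mem measurableSet_Ioo] with x hx
  exact hC x (Ioo_subset_Icc_self hx)

lemma poly_memLp_two (p : ℝ[X]) :
    MemLp (fun x => p.eval x) 2 (volume.restrict (Ioo a b)) :=
  continuousOn_memLp_two p.continuous.continuousOn

lemma sub_poly_memLp_two {y : ℝ → ℝ} (hy : MemLp y 2 (volume.restrict (Ioo a b))) (p : ℝ[X]) :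
    MemLp (fun x => y x - p.eval x) 2 (volume.restrict (Ioo a b)) :=
  hy.sub (poly_memLp_two p)

/-- `q` is the `L²(a, b)`-orthogonal projection of `y` onto the polynomials of degree less
than `n`. -/
def IsProj (a b : ℝ) (n : ℕ) (y : ℝ → ℝ) (q : ℝ[X]) : Prop :=
  q ∈ degreeLT ℝ n ∧ ∀ s ∈ degreeLT ℝ n, ∫ x in a..b, (y x - q.eval x) * s.eval x = 0

lemma exists_isProj (hab : a < b) (n : ℕ) {y : ℝ → ℝ}
    (hy : MemLp y 2 (volume.restrict (Ioo a b))) : ∃ q, IsProj a b n y q := by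
  have hi : ∀ s : ℝ[X], IntervalIntegrable (fun x => y x * s.eval x) volume a b :=
    fun s => memLp_two_intervalIntegrable_sq hab.le hy (poly_memLp_two s)
  let l : ℝ[X] →ₗ[ℝ] ℝ :=
    { toFun := fun s => ∫ x in a..b, y x * s.eval x
      map_add' := by
        intro s t
        simp only [eval_add, mul_add]
        exact intervalIntegral.integral_add (hi s) (hi t)
      map_smul' := by
        intro c s
        simp only [eval_smul, smul_eq_mul, RingHom.id_apply]
        rw [← intervalIntegral.integral_const_mul]
        congr 1; ext x; ring }
  obtain ⟨q, hq, h⟩ := exists_representer hab 0 n l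
  refine ⟨q, hq, fun s hs => ?_⟩
  have h1 := h s hs
  rw [pow_zero, one_mul, polyIntegral_apply] at h1
  have h2 : (∫ x in a..b, y x * s.eval x) - ∫ x in a..b, (q * s).eval x = 0 := by
    rw [h1]; exact sub_self _
  rw [← intervalIntegral.integral_sub (hi s) ((q * s).continuous.intervalIntegrable _ _)] at h2
  rw [← h2]
  congr 1; ext x; rw [eval_mul]; ring

lemma IsProj.integral_sq_le (hab : a ≤ b) {n : ℕ} {y : ℝ → ℝ} {q : ℝ[X]}
    (hy : MemLp y 2 (volume.restrict (Ioo a b))) (h : IsProj a b n y q) {p : ℝ[X]}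
    (hp : p ∈ degreeLT ℝ n) :
    ∫ x in a..b, (y x - q.eval x) ^ 2 ≤ ∫ x in a..b, (y x - p.eval x) ^ 2 := by
  have h0 := h.2 (q - p) (Submodule.sub_mem _ h.1 hp)
  have m1 : MemLp (fun x => y x - q.eval x) 2 (volume.restrict (Ioo a b)) :=
    hy.sub (poly_memLp_two q)
  have i1 : IntervalIntegrable (fun x => (y x - q.eval x) ^ 2) volume a b := by
    simpa only [sq] using memLp_two_intervalIntegrable_sq hab m1 m1
  have i2 : IntervalIntegrable (fun x => (y x - q.eval x) * (q - p).eval x) volume a b :=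
    memLp_two_intervalIntegrable_sq hab m1 (poly_memLp_two _)
  have i3 : IntervalIntegrable (fun x => ((q - p).eval x) ^ 2) volume a b :=
    ((q - p).continuous.pow 2).intervalIntegrable _ _
  have e : (fun x => (y x - p.eval x) ^ 2) = fun x => (y x - q.eval x) ^ 2 +
      2 * ((y x - q.eval x) * (q - p).eval x) + ((q - p).eval x) ^ 2 := by
    ext x; rw [eval_sub]; ring
  rw [e, intervalIntegral.integral_add (i1.add (i2.const_mul 2)) i3,
    intervalIntegral.integral_add i1 (i2.const_mul 2), intervalIntegral.integral_const_mul, h0]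
  have : 0 ≤ ∫ x in a..b, ((q - p).eval x) ^ 2 :=
    intervalIntegral.integral_nonneg hab fun x _ => sq_nonneg _
  linarith

lemma IsProj.eLpNorm_le (hab : a ≤ b) {n : ℕ} {y : ℝ → ℝ} {q : ℝ[X]}
    (hy : MemLp y 2 (volume.restrict (Ioo a b))) (h : IsProj a b n y q) {p : ℝ[X]}
    (hp : p ∈ degreeLT ℝ n) :
    eLpNorm (fun x => y x - q.eval x) 2 (volume.restrict (Ioo a b)) ≤
      eLpNorm (fun x => y x - p.eval x) 2 (volume.restrict (Ioo a b)) := by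
  rw [← ENNReal.pow_le_pow_left_iff two_ne_zero,
    eLpNorm_two_sq hab (sub_poly_memLp_two hy q), eLpNorm_two_sq hab (sub_poly_memLp_two hy p)]
  exact ENNReal.ofReal_le_ofReal (h.integral_sq_le hab hy hp)

/-- On `(a, b)`, `y` agrees almost everywhere with an antiderivative of `z`. -/
def AEPrimitive (a b : ℝ) (y z : ℝ → ℝ) : Prop :=
  ∃ c : ℝ, y =ᵐ[volume.restrict (Ioo a b)] fun x => c + ∫ t in a..x, z t

lemma continuousOn_primitive (hab : a ≤ b) {z : ℝ → ℝ} (hz : IntervalIntegrable z volume a b) :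
    ContinuousOn (fun x => ∫ t in a..x, z t) (Icc a b) := by
  rw [← uIcc_of_le hab]
  exact intervalIntegral.continuousOn_primitive_interval (hz.def'.mono_set_ae (by
    rw [uIcc_of_le hab, uIoc_of_le hab]; exact Ioc_ae_eq_Icc.symm.le))

lemma AEPrimitive.memLp (hab : a ≤ b) {y z : ℝ → ℝ} (h : AEPrimitive a b y z)
    (hz : MemLp z 2 (volume.restrict (Ioo a b))) : MemLp y 2 (volume.restrict (Ioo a b)) := by
  obtain ⟨c, hc⟩ := h
  refine (memLp_congr_ae hc).mpr (continuousOn_memLp_two ?_)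
  exact continuousOn_const.add (continuousOn_primitive hab (memLp_two_intervalIntegrable hab hz))

lemma eLpNorm_primitive_le (hab : a ≤ b) {z : ℝ → ℝ}
    (hz : MemLp z 2 (volume.restrict (Ioo a b))) :
    eLpNorm (fun x => ∫ t in a..x, z t) 2 (volume.restrict (Ioo a b)) ≤
      ENNReal.ofReal (b - a) * eLpNorm z 2 (volume.restrict (Ioo a b)) := by
  have hzi := memLp_two_intervalIntegrable hab hz
  have hbound : ∀ᵐ x ∂(volume.restrict (Ioo a b)),
      ‖∫ t in a..x, z t‖ ≤ (eLpNorm z 1 (volume.restrict (Ioo a b))).toReal := by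
    filter_upwards [ae_restrict_mem measurableSet_Ioo] with x hx
    have hz1 : IntegrableOn z (Ioo a b) := by
      rwa [intervalIntegrable_iff_integrableOn_Ioo_of_le hab] at hzi
    calc ‖∫ t in a..x, z t‖ ≤ ∫ t in Ioc a x, ‖z t‖ := by
          rw [intervalIntegral.integral_of_le hx.1.le]
          exact norm_integral_le_integral_norm _
      _ ≤ ∫ t in Ioo a b, ‖z t‖ := by
          refine setIntegral_mono_set hz1.norm (Filter.Eventually.of_forall fun _ => norm_nonneg _)
            (LE.le.eventuallyLE ?_)
          intro t ht
          exact ⟨ht.1, ht.2.trans_lt hx.2⟩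
      _ = _ := by
          rw [eLpNorm_one_eq_lintegral_enorm, integral_norm_eq_lintegral_enorm]
          exact hz1.aestronglyMeasurable
  have h1 := eLpNorm_le_of_ae_bound (p := 2) hbound
  have hfin : eLpNorm z 1 (volume.restrict (Ioo a b)) ≠ ⊤ :=
    ((hz.mono_exponent (by norm_num : (1 : ℝ≥0∞) ≤ 2))).2.ne
  rw [ENNReal.ofReal_toReal hfin] at h1
  have h2 := eLpNorm_le_eLpNorm_mul_rpow_measure_univ (p := 1) (q := 2) (by norm_num)
    hz.aestronglyMeasurable
  have h3 : (volume.restrict (Ioo a b)) univ = ENNReal.ofReal (b - a) := by simp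
  rw [h3] at h1 h2
  refine h1.trans ?_
  refine (mul_le_mul_right h2 _).trans ?_
  rw [← mul_assoc, mul_comm _ (eLpNorm z 2 _), mul_assoc, mul_comm]
  gcongr
  rw [← ENNReal.rpow_add_of_nonneg _ _ (by norm_num) (by norm_num)]
  norm_num

lemma exists_poly_eLpNorm_sub_le (hab : a < b) {y : ℝ → ℝ}
    (hy : MemLp y 2 (volume.restrict (Ioo a b))) {ε : ℝ≥0∞} (hε : ε ≠ 0) :
    ∃ v : ℝ[X], eLpNorm (fun x => y x - v.eval x) 2 (volume.restrict (Ioo a b)) ≤ ε := by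
  obtain ⟨g, -, hg, hgc, hgm⟩ := hy.exists_hasCompactSupport_eLpNorm_sub_le (by norm_num)
    (ENNReal.half_pos hε).ne'
  have hvol : (volume.restrict (Ioo a b)) univ = ENNReal.ofReal (b - a) := by simp
  obtain ⟨δ, hδ, hδε⟩ : ∃ δ : ℝ, 0 < δ ∧
      (ENNReal.ofReal (b - a)) ^ ((2 : ℝ≥0∞).toReal)⁻¹ * ENNReal.ofReal δ ≤ ε / 2 := by
    have hc : (ENNReal.ofReal (b - a)) ^ ((2 : ℝ≥0∞).toReal)⁻¹ ≠ ⊤ :=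
      ENNReal.rpow_ne_top_of_nonneg (by positivity) ENNReal.ofReal_ne_top
    have hc0 : (ENNReal.ofReal (b - a)) ^ ((2 : ℝ≥0∞).toReal)⁻¹ ≠ 0 := by
      simp [hab]
    have hpos : 0 < ε / 2 / (ENNReal.ofReal (b - a)) ^ ((2 : ℝ≥0∞).toReal)⁻¹ :=
      ENNReal.div_pos (ENNReal.half_pos hε).ne' hc
    obtain ⟨δ, hδ0, hδ1⟩ := ENNReal.lt_iff_exists_nnreal_btwn.mp hpos
    refine ⟨δ, by exact_mod_cast hδ0, ?_⟩
    rw [mul_comm, ENNReal.ofReal_coe_nnreal, ← ENNReal.le_div_iff_mul_le (Or.inl hc0) (Or.inl hc)]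
    exact hδ1.le
  obtain ⟨v, hv⟩ := exists_polynomial_near_of_continuousOn a b g hgc.continuousOn δ hδ
  refine ⟨v, ?_⟩
  have hgv : eLpNorm (fun x => g x - v.eval x) 2 (volume.restrict (Ioo a b)) ≤ ε / 2 := by
    have hb : ∀ᵐ x ∂(volume.restrict (Ioo a b)), ‖g x - v.eval x‖ ≤ δ := by
      filter_upwards [ae_restrict_mem measurableSet_Ioo] with x hx
      rw [norm_sub_rev]
      exact (hv x (Ioo_subset_Icc_self hx)).le
    have := eLpNorm_le_of_ae_bound (p := 2) hb
    rw [hvol] at this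
    exact this.trans hδε
  have e : (fun x => y x - v.eval x) = (y - g) + fun x => g x - v.eval x := by
    ext x; simp
  rw [e]
  refine (eLpNorm_add_le (hy.sub hgm).aestronglyMeasurable
    (hgm.sub (poly_memLp_two v)).aestronglyMeasurable (by norm_num)).trans ?_
  exact (add_le_add hg hgv).trans (ENNReal.add_halves ε).le

lemma chain_memLp (hab : a ≤ b) (m : ℕ) (Y : ℕ → ℝ → ℝ)
    (hY : ∀ i < m, AEPrimitive a b (Y i) (Y (i + 1)))
    (hm : MemLp (Y m) 2 (volume.restrict (Ioo a b))) :
    MemLp (Y 0) 2 (volume.restrict (Ioo a b)) := by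
  induction m generalizing Y with
  | zero => exact hm
  | succ m ih =>
    exact (hY 0 (by omega)).memLp hab
      (ih (fun i => Y (i + 1)) (fun i hi => hY (i + 1) (by omega)) hm)

lemma exists_antiderivative (p : ℝ[X]) (c : ℝ) :
    ∃ P : ℝ[X], derivative P = p ∧ ∀ x, P.eval x = c + ∫ t in a..x, p.eval t := by
  obtain ⟨P, hP⟩ : ∃ P : ℝ[X], derivative P = p := by
    induction p using Polynomial.induction_on' with
    | add p q hp hq =>
      obtain ⟨P, hP⟩ := hp
      obtain ⟨Q, hQ⟩ := hq
      exact ⟨P + Q, by rw [derivative_add, hP, hQ]⟩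
    | monomial n c =>
      refine ⟨monomial (n + 1) (c / (n + 1)), ?_⟩
      rw [derivative_monomial]
      congr 1
      push_cast
      field_simp
  refine ⟨P + C (c - P.eval a), by simp [hP], fun x => ?_⟩
  have : ∫ t in a..x, p.eval t = P.eval x - P.eval a := by
    rw [← hP]; exact polyIntegral_derivative P
  rw [this]; simp only [eval_add, eval_C]; ring

/-- Polynomials are dense among functions with `m` derivatives in `L²(a, b)`: approximate the
highest derivative and integrate. -/
lemma exists_poly_near_chain (hab : a < b) (m : ℕ) (Y : ℕ → ℝ → ℝ)
    (hY : ∀ i < m, AEPrimitive a b (Y i) (Y (i + 1)))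
    (hm : MemLp (Y m) 2 (volume.restrict (Ioo a b))) {ε : ℝ≥0∞} (hε : ε ≠ 0) :
    ∃ v : ℝ[X], eLpNorm (fun x => Y 0 x - v.eval x) 2 (volume.restrict (Ioo a b)) ≤ ε ∧
      eLpNorm (fun x => Y m x - (derivative^[m] v).eval x) 2 (volume.restrict (Ioo a b)) ≤ ε := by
  induction m generalizing Y ε with
  | zero =>
    obtain ⟨v, hv⟩ := exists_poly_eLpNorm_sub_le hab hm hε
    exact ⟨v, hv, hv⟩
  | succ m ih =>
    have hk0 : ENNReal.ofReal (b - a) ≠ 0 := by simp [hab]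
    have hmin : min ε (ε / ENNReal.ofReal (b - a)) ≠ 0 :=
      (lt_min (pos_iff_ne_zero.mpr hε) (ENNReal.div_pos hε ENNReal.ofReal_ne_top)).ne'
    have hY' : ∀ i < m, AEPrimitive a b (Y (i + 1)) (Y (i + 1 + 1)) :=
      fun i hi => hY (i + 1) (by omega)
    obtain ⟨v, hv0, hv1⟩ := ih (fun i => Y (i + 1)) hY' hm hmin
    have hY1 : MemLp (Y 1) 2 (volume.restrict (Ioo a b)) :=
      chain_memLp hab.le m (fun i => Y (i + 1)) hY' hm
    obtain ⟨c, hc⟩ := hY 0 (by omega)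
    obtain ⟨P, hP, hPe⟩ := exists_antiderivative (a := a) v c
    refine ⟨P, ?_, ?_⟩
    · have hae : (fun x => Y 0 x - P.eval x) =ᵐ[volume.restrict (Ioo a b)]
          fun x => ∫ t in a..x, (Y 1 t - v.eval t) := by
        filter_upwards [hc, ae_restrict_mem measurableSet_Ioo] with x hx hxm
        have hsub : IntervalIntegrable (Y 1) volume a x :=
          (memLp_two_intervalIntegrable hab.le hY1).mono_set (by
            rw [uIcc_of_le hab.le, uIcc_of_le hxm.1.le]; exact Icc_subset_Icc_right hxm.2.le)
        rw [hx, hPe, intervalIntegral.integral_sub hsub (v.continuous.intervalIntegrable _ _)]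
        ring_nf
      rw [eLpNorm_congr_ae hae]
      refine (eLpNorm_primitive_le hab.le (hY1.sub (poly_memLp_two v))).trans ?_
      refine (mul_le_mul_right (hv0.trans (min_le_right _ _)) _).trans ?_
      rw [ENNReal.mul_div_cancel hk0 ENNReal.ofReal_ne_top]
    · rw [Function.iterate_succ_apply, hP]
      exact hv1.trans (min_le_left _ _)

/-- The constant in the approximation by polynomials of degree less than `n` on an interval of
length `k`, in terms of the derivative of order `m`. -/
noncomputable def approxConst (k : ℝ) (n m : ℕ) : ℝ := (k / 2) ^ m / √(gain n m)

lemma approxConst_pos {k : ℝ} (hk : 0 < k) {n m : ℕ} (h : m ≤ n) : 0 < approxConst k n m :=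
  div_pos (by positivity) (Real.sqrt_pos.mpr (gain_pos h))

lemma exists_poly_approx_eLpNorm (hab : a < b) {n m : ℕ} (hm : m ≤ n) (v : ℝ[X]) :
    ∃ q ∈ degreeLT ℝ n,
      eLpNorm (fun x => v.eval x - q.eval x) 2 (volume.restrict (Ioo a b)) ≤
      ENNReal.ofReal (approxConst (b - a) n m) *
        eLpNorm (fun x => (derivative^[m] v).eval x) 2 (volume.restrict (Ioo a b)) := by
  obtain ⟨q, hq, h⟩ := exists_poly_approx hab hm v
  refine ⟨q, hq, ?_⟩
  have hA := approxConst_pos (sub_pos.mpr hab) hm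
  rw [← ENNReal.pow_le_pow_left_iff two_ne_zero, mul_pow,
    eLpNorm_two_sq hab.le (sub_poly_memLp_two (poly_memLp_two v) q),
    eLpNorm_two_sq hab.le (poly_memLp_two _), ← ENNReal.ofReal_pow hA.le,
    ← ENNReal.ofReal_mul (by positivity)]
  apply ENNReal.ofReal_le_ofReal
  have e1 : ∫ x in a..b, (v.eval x - q.eval x) ^ 2 = polyIntegral a b ((v - q) * (v - q)) := by
    rw [polyIntegral_apply]; congr 1; ext x; simp [sq]
  have e2 : ∫ x in a..b, ((derivative^[m] v).eval x) ^ 2 =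
      polyIntegral a b (derivative^[m] v * derivative^[m] v) := by
    rw [polyIntegral_apply]; congr 1; ext x; simp [sq]
  have hg := gain_pos hm
  rw [e1, e2, approxConst, div_pow, Real.sq_sqrt hg.le, ← pow_mul, mul_comm m 2, div_mul_eq_mul_div,
    le_div_iff₀ hg, mul_comm]
  exact h

/-- Best approximation by polynomials of degree less than `n` of a function with `m ≤ n`
derivatives in `L²(a, b)`. -/
lemma IsProj.eLpNorm_le_approxConst (hab : a < b) {n m : ℕ} (hm : m ≤ n) (Y : ℕ → ℝ → ℝ)
    (hY : ∀ i < m, AEPrimitive a b (Y i) (Y (i + 1)))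
    (hYm : MemLp (Y m) 2 (volume.restrict (Ioo a b))) {q : ℝ[X]} (h : IsProj a b n (Y 0) q) :
    eLpNorm (fun x => Y 0 x - q.eval x) 2 (volume.restrict (Ioo a b)) ≤
      ENNReal.ofReal (approxConst (b - a) n m) *
        eLpNorm (Y m) 2 (volume.restrict (Ioo a b)) := by
  have hY0 := chain_memLp hab.le m Y hY hYm
  set A := ENNReal.ofReal (approxConst (b - a) n m) with hA
  have hAt : A ≠ ⊤ := ENNReal.ofReal_ne_top
  refine ENNReal.le_of_forall_pos_le_add fun δ hδ _ => ?_
  have hε : (δ : ℝ≥0∞) / (1 + A) ≠ 0 :=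
    (ENNReal.div_pos (by exact_mod_cast hδ.ne') (by simp [hAt])).ne'
  obtain ⟨v, hv0, hv1⟩ := exists_poly_near_chain hab m Y hY hYm hε
  obtain ⟨p, hp, hvp⟩ := exists_poly_approx_eLpNorm hab hm v
  refine (h.eLpNorm_le hab.le hY0 hp).trans ?_
  have e : (fun x => Y 0 x - p.eval x) =
      (fun x => Y 0 x - v.eval x) + fun x => v.eval x - p.eval x := by
    ext x; simp
  have e' : (fun x => (derivative^[m] v).eval x) =
      Y m - fun x => Y m x - (derivative^[m] v).eval x := by
    ext x; simp
  rw [e]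
  refine (eLpNorm_add_le (hY0.sub (poly_memLp_two v)).aestronglyMeasurable
    ((poly_memLp_two v).sub (poly_memLp_two p)).aestronglyMeasurable (by norm_num)).trans ?_
  have h3 : eLpNorm (fun x => (derivative^[m] v).eval x) 2 (volume.restrict (Ioo a b)) ≤
      eLpNorm (Y m) 2 (volume.restrict (Ioo a b)) + δ / (1 + A) := by
    rw [e']
    refine (eLpNorm_sub_le hYm.aestronglyMeasurable
      (hYm.sub (poly_memLp_two _)).aestronglyMeasurable (by norm_num)).trans ?_
    exact add_le_add le_rfl hv1
  calc _ ≤ (δ : ℝ≥0∞) / (1 + A) +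
        A * (eLpNorm (Y m) 2 (volume.restrict (Ioo a b)) + δ / (1 + A)) :=
        add_le_add hv0 (hvp.trans (mul_le_mul_right h3 _))
    _ = A * eLpNorm (Y m) 2 (volume.restrict (Ioo a b)) + (1 + A) * (δ / (1 + A)) := by ring
    _ = _ := by rw [ENNReal.mul_div_cancel (by simp) (by simp [hAt])]

lemma IsProj.congr_ae {n : ℕ} {y z : ℝ → ℝ} {q : ℝ[X]} (hab : a ≤ b) (h : IsProj a b n y q)
    (hyz : y =ᵐ[volume.restrict (Ioo a b)] z) : IsProj a b n z q := by
  refine ⟨h.1, fun s hs => ?_⟩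
  rw [← h.2 s hs, intervalIntegral.integral_of_le hab, intervalIntegral.integral_of_le hab,
    integral_Ioc_eq_integral_Ioo, integral_Ioc_eq_integral_Ioo]
  refine integral_congr_ae ?_
  filter_upwards [hyz] with x hx
  rw [hx]

/-! ### Integration by parts and smoothing of functions orthogonal to polynomials -/

/-- Integration by parts for antiderivatives of integrable functions. -/
lemma integral_mul_primitive {g h : ℝ → ℝ} (hab : a ≤ b) (hg : IntervalIntegrable g volume a b)
    (hh : IntervalIntegrable h volume a b) (c d : ℝ) :
    ∫ x in a..b, g x * (d + ∫ t in a..x, h t) =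
      (c + ∫ t in a..b, g t) * (d + ∫ t in a..b, h t) - c * d -
        ∫ x in a..b, (c + ∫ t in a..x, g t) * h x := by
  have hG := hg.absolutelyContinuousOnInterval_intervalIntegral (c := a) (by simp)
  have hH := hh.absolutelyContinuousOnInterval_intervalIntegral (c := a) (by simp)
  have hc : ∀ e : ℝ, AbsolutelyContinuousOnInterval (fun _ : ℝ => e) a b := fun e =>
    (LipschitzWith.const e).lipschitzOnWith.absolutelyContinuousOnInterval
  have hG' : AbsolutelyContinuousOnInterval (fun x => c + ∫ t in a..x, g t) a b := (hc c).add hG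
  have hH' : AbsolutelyContinuousOnInterval (fun x => d + ∫ t in a..x, h t) a b := (hc d).add hH
  have key := AbsolutelyContinuousOnInterval.integral_deriv_mul_eq_sub hG' hH'
  have hd : ∀ᵐ x, x ∈ uIoc a b →
      deriv (fun x => c + ∫ t in a..x, g t) x * (d + ∫ t in a..x, h t) +
        (c + ∫ t in a..x, g t) * deriv (fun x => d + ∫ t in a..x, h t) x =
      g x * (d + ∫ t in a..x, h t) + (c + ∫ t in a..x, g t) * h x := by
    filter_upwards [hg.ae_hasDerivAt_integral, hh.ae_hasDerivAt_integral] with x h1 h2 hx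
    have hx' := uIoc_subset_uIcc hx
    rw [((h1 hx' a (by simp)).const_add c).deriv, ((h2 hx' a (by simp)).const_add d).deriv]
  rw [intervalIntegral.integral_congr_ae hd] at key
  have cG : ContinuousOn (fun x => c + ∫ t in a..x, g t) (uIcc a b) := by
    rw [uIcc_of_le hab]; exact continuousOn_const.add (continuousOn_primitive hab hg)
  have cH : ContinuousOn (fun x => d + ∫ t in a..x, h t) (uIcc a b) := by
    rw [uIcc_of_le hab]; exact continuousOn_const.add (continuousOn_primitive hab hh)
  rw [intervalIntegral.integral_add (hg.mul_continuousOn cH) (hh.continuousOn_mul cG)] at key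
  simp only [intervalIntegral.integral_same, add_zero] at key
  linarith

/-- The antiderivative of a function orthogonal to the polynomials of degree less than `n` vanishes
at both ends and is smaller by a factor of order `(b - a) / n`. -/
lemma integral_primitive_sq_le (hab : a < b) {n : ℕ} (hn : 1 ≤ n) {η : ℝ → ℝ}
    (hη : MemLp η 2 (volume.restrict (Ioo a b)))
    (ho : ∀ s ∈ degreeLT ℝ n, ∫ x in a..b, η x * s.eval x = 0) :
    ∫ x in a..b, η x = 0 ∧
      ∫ x in a..b, (∫ t in a..x, η t) ^ 2 ≤ ((b - a) / (2 * n)) ^ 2 * ∫ x in a..b, η x ^ 2 := by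
  have hηi := memLp_two_intervalIntegrable hab.le hη
  have hA := continuousOn_primitive hab.le hηi
  have hAi : IntervalIntegrable (fun x => ∫ t in a..x, η t) volume a b := by
    refine ContinuousOn.intervalIntegrable ?_
    rwa [uIcc_of_le hab.le]
  have h1 : ∫ x in a..b, η x = 0 := by
    have := ho 1 (by
      rw [mem_degreeLT]; exact degree_one_le.trans_lt (by exact_mod_cast hn))
    simpa using this
  refine ⟨h1, ?_⟩
  set A : ℝ → ℝ := fun x => ∫ t in a..x, η t with hAdef
  set B : ℝ → ℝ := fun x => ∫ t in a..x, A t with hBdef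
  have hB := continuousOn_primitive hab.le hAi
  have hAm := continuousOn_memLp_two hA
  have hBm : MemLp B 2 (volume.restrict (Ioo a b)) := continuousOn_memLp_two hB
  obtain ⟨q, hq⟩ := exists_isProj hab n hBm
  have happ := IsProj.eLpNorm_le_approxConst hab hn (fun i => if i = 0 then B else A)
    (by
      intro i hi
      obtain rfl : i = 0 := by omega
      refine ⟨0, Filter.Eventually.of_forall fun x => ?_⟩
      simp [hBdef]) (by simpa using hAm) (q := q) (by simpa using hq)
  simp only [if_true, one_ne_zero, if_false] at happ
  have hc0 := approxConst_pos (sub_pos.mpr hab) hn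
  have hsq : ∫ x in a..b, (B x - q.eval x) ^ 2 ≤
      approxConst (b - a) n 1 ^ 2 * ∫ x in a..b, A x ^ 2 := by
    rw [← ENNReal.pow_le_pow_left_iff two_ne_zero, mul_pow,
      eLpNorm_two_sq hab.le (sub_poly_memLp_two hBm q), eLpNorm_two_sq hab.le hAm,
      ← ENNReal.ofReal_pow hc0.le, ← ENNReal.ofReal_mul (by positivity)] at happ
    refine (ENNReal.ofReal_le_ofReal_iff ?_).mp happ
    exact mul_nonneg (by positivity) (intervalIntegral.integral_nonneg hab.le fun x _ => sq_nonneg _)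
  set c := approxConst (b - a) n 1 with hcdef
  have hcle : c ^ 2 ≤ ((b - a) / (2 * n)) ^ 2 := by
    have hn' : (1 : ℝ) ≤ n := by exact_mod_cast hn
    have : gain n 1 = n * (n + 1) := by simp [gain]
    rw [hcdef, approxConst, this, pow_one, div_pow, Real.sq_sqrt (by positivity), div_pow, div_pow,
      div_div]
    refine div_le_div_of_nonneg_left (sq_nonneg _) (by positivity) ?_
    nlinarith
  -- `∫ A² = -∫ η B = -∫ η (B - q)`, where the approximation error of `B` gains a derivative
  have hηq : ∫ x in a..b, η x * q.eval x = 0 := ho q hq.1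
  have hibp : ∫ x in a..b, A x ^ 2 = - ∫ x in a..b, η x * (B x - q.eval x) := by
    have := integral_mul_primitive hab.le hηi hAi 0 0
    simp only [zero_add, h1, zero_mul, mul_zero, sub_zero, zero_sub] at this
    have e : (fun x => η x * (B x - q.eval x)) = fun x => η x * B x - η x * q.eval x := by
      ext x; ring
    rw [e, intervalIntegral.integral_sub (memLp_two_intervalIntegrable_sq hab.le hη hBm)
      (memLp_two_intervalIntegrable_sq hab.le hη (poly_memLp_two q)), hηq, sub_zero, this, neg_neg]
    congr 1; ext x; rw [sq]
  have iη : IntervalIntegrable (fun x => η x ^ 2) volume a b := by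
    simpa only [sq] using memLp_two_intervalIntegrable_sq hab.le hη hη
  have hBq : MemLp (fun x => B x - q.eval x) 2 (volume.restrict (Ioo a b)) :=
    hBm.sub (poly_memLp_two q)
  have iB : IntervalIntegrable (fun x => (B x - q.eval x) ^ 2) volume a b := by
    simpa only [sq] using memLp_two_intervalIntegrable_sq hab.le hBq hBq
  have hyoung : - ∫ x in a..b, η x * (B x - q.eval x) ≤
      c ^ 2 / 2 * (∫ x in a..b, η x ^ 2) +
        1 / (2 * c ^ 2) * ∫ x in a..b, (B x - q.eval x) ^ 2 := by
    rw [← intervalIntegral.integral_neg, ← intervalIntegral.integral_const_mul,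
      ← intervalIntegral.integral_const_mul, ← intervalIntegral.integral_add (iη.const_mul _)
        (iB.const_mul _)]
    refine intervalIntegral.integral_mono_on hab.le
      (memLp_two_intervalIntegrable_sq hab.le hη hBq).neg ((iη.const_mul _).add (iB.const_mul _)) ?_
    intro x _
    have h2 : 0 ≤ (c * η x + (1 / c) * (B x - q.eval x)) ^ 2 := sq_nonneg _
    have h3 : (c * η x + (1 / c) * (B x - q.eval x)) ^ 2 =
        2 * (c ^ 2 / 2 * η x ^ 2 + 1 / (2 * c ^ 2) * (B x - q.eval x) ^ 2) +
          2 * (η x * (B x - q.eval x)) := by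
      field_simp; ring
    linarith
  have hfin : 1 / (2 * c ^ 2) * ∫ x in a..b, (B x - q.eval x) ^ 2 ≤
      1 / 2 * ∫ x in a..b, A x ^ 2 := by
    calc _ ≤ 1 / (2 * c ^ 2) * (c ^ 2 * ∫ x in a..b, A x ^ 2) := by gcongr
      _ = _ := by field_simp
  have hη0 : 0 ≤ ∫ x in a..b, η x ^ 2 :=
    intervalIntegral.integral_nonneg hab.le fun x _ => sq_nonneg _
  calc ∫ x in a..b, A x ^ 2 ≤ c ^ 2 * ∫ x in a..b, η x ^ 2 := by linarith
    _ ≤ _ := by gcongr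

end CPG

namespace CPG

variable {a b : ℝ}

/-! ### Weak derivatives -/

/-- Test functions on `(a, b)`. -/
structure IsTest (a b : ℝ) (φ : ℝ → ℝ) : Prop where
  smooth : ContDiff ℝ ∞ φ
  compact : HasCompactSupport φ
  subset : tsupport φ ⊆ Ioo a b

lemma IsTest.deriv {φ : ℝ → ℝ} (h : IsTest a b φ) : IsTest a b (deriv φ) :=
  ⟨(contDiff_infty_iff_deriv.mp h.smooth).2, h.compact.deriv,
    tsupport_deriv_subset.trans h.subset⟩

lemma IsTest.iteratedDeriv {φ : ℝ → ℝ} (h : IsTest a b φ) (i : ℕ) :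
    IsTest a b (iteratedDeriv i φ) := by
  induction i with
  | zero => simpa using h
  | succ i ih => rw [iteratedDeriv_succ]; exact ih.deriv

lemma IsTest.eq_zero {φ : ℝ → ℝ} (h : IsTest a b φ) {x : ℝ} (hx : x ∉ Ioo a b) : φ x = 0 :=
  image_eq_zero_of_notMem_tsupport fun hx' => hx (h.subset hx')

lemma IsTest.mono {φ : ℝ → ℝ} {c d : ℝ} (h : IsTest c d φ) (hac : a ≤ c) (hdb : d ≤ b) :
    IsTest a b φ :=
  ⟨h.smooth, h.compact, h.subset.trans (Ioo_subset_Ioo hac hdb)⟩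

lemma IsTest.integrable_mul {φ u : ℝ → ℝ} (h : IsTest a b φ)
    (hu : LocallyIntegrableOn u (Ioo a b)) : Integrable (fun x => u x * φ x) := by
  have h1 : IntegrableOn (fun x => u x * φ x) (tsupport φ) :=
    (hu.integrableOn_compact_subset h.subset h.compact).mul_continuousOn
      h.smooth.continuous.continuousOn h.compact
  rw [integrableOn_iff_integrable_of_support_subset] at h1
  · exact h1
  · intro x hx
    exact subset_tsupport _ (right_ne_zero_of_mul hx)

lemma IsTest.setIntegral_eq {φ : ℝ → ℝ} (h : IsTest a b φ) (u : ℝ → ℝ) :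
    ∫ x in Ioo a b, u x * φ x = ∫ x, u x * φ x := by
  refine setIntegral_eq_integral_of_forall_compl_eq_zero fun x hx => ?_
  rw [h.eq_zero hx, mul_zero]

lemma HasWeakDeriv.ae_eq {i : ℕ} {u v w : ℝ → ℝ} (hv : HasWeakDeriv a b i u v)
    (hw : HasWeakDeriv a b i u w) : v =ᵐ[volume.restrict (Ioo a b)] w := by
  have h := isOpen_Ioo.ae_eq_zero_of_integral_contDiff_smul_eq_zero (hv.2.1.sub hw.2.1)
    (fun g h1 h2 h3 => by
      have ht : IsTest a b g := ⟨h1, h2, h3⟩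
      have e1 := hv.2.2 g h1 h2 h3
      have e2 := hw.2.2 g h1 h2 h3
      rw [e1, ht.setIntegral_eq, ht.setIntegral_eq] at e2
      have e3 := mul_left_cancel₀ (pow_ne_zero i (by norm_num : (-1 : ℝ) ≠ 0)) e2
      have e4 : (fun x => g x • (v - w) x) = fun x => v x * g x - w x * g x := by
        ext x; simp only [Pi.sub_apply, smul_eq_mul]; ring
      rw [e4, integral_sub (ht.integrable_mul hv.2.1) (ht.integrable_mul hw.2.1), e3, sub_self])
  refine (ae_restrict_iff' measurableSet_Ioo).mpr ?_
  filter_upwards [h] with x hx hxm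
  exact sub_eq_zero.mp (hx hxm)

lemma HasWeakDeriv.weakSeminorm_eq {i : ℕ} {u v : ℝ → ℝ} (hv : HasWeakDeriv a b i u v) :
    weakSeminorm a b i u = eLpNorm v 2 (volume.restrict (Ioo a b)) := by
  refine le_antisymm (iInf₂_le v hv) (le_iInf₂ fun w hw => ?_)
  exact (eLpNorm_congr_ae (hv.ae_eq hw)).le

lemma exists_hasWeakDeriv {i : ℕ} {u : ℝ → ℝ} (h : weakSeminorm a b i u < ⊤) :
    ∃ v, HasWeakDeriv a b i u v ∧ MemLp v 2 (volume.restrict (Ioo a b)) ∧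
      weakSeminorm a b i u = eLpNorm v 2 (volume.restrict (Ioo a b)) := by
  obtain ⟨v, hv⟩ := iInf_lt_iff.mp h
  obtain ⟨hv1, hv2⟩ := iInf_lt_iff.mp hv
  exact ⟨v, hv1, ⟨hv1.2.1.aestronglyMeasurable, hv2⟩, hv1.weakSeminorm_eq⟩

lemma HasWeakDeriv.add {i : ℕ} {u₁ u₂ v₁ v₂ : ℝ → ℝ} (h₁ : HasWeakDeriv a b i u₁ v₁)
    (h₂ : HasWeakDeriv a b i u₂ v₂) : HasWeakDeriv a b i (u₁ + u₂) (v₁ + v₂) := by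
  refine ⟨h₁.1.add h₂.1, h₁.2.1.add h₂.2.1, fun φ h1 h2 h3 => ?_⟩
  have ht : IsTest a b φ := ⟨h1, h2, h3⟩
  have e1 := h₁.2.2 φ h1 h2 h3
  have e2 := h₂.2.2 φ h1 h2 h3
  simp only [Pi.add_apply, add_mul]
  rw [integral_add ((ht.iteratedDeriv i).integrable_mul h₁.1).integrableOn
    ((ht.iteratedDeriv i).integrable_mul h₂.1).integrableOn,
    integral_add (ht.integrable_mul h₁.2.1).integrableOn (ht.integrable_mul h₂.2.1).integrableOn,
    e1, e2]
  ring

lemma HasWeakDeriv.zero (i : ℕ) : HasWeakDeriv a b i 0 0 := by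
  refine ⟨locallyIntegrableOn_zero, locallyIntegrableOn_zero, fun φ _ _ _ => ?_⟩
  simp

lemma HasWeakDeriv.mono {c d : ℝ} (hac : a ≤ c) (hdb : d ≤ b) {i : ℕ} {u v : ℝ → ℝ}
    (h : HasWeakDeriv a b i u v) : HasWeakDeriv c d i u v := by
  have hs := Ioo_subset_Ioo hac hdb
  refine ⟨h.1.mono_set hs, h.2.1.mono_set hs, fun φ h1 h2 h3 => ?_⟩
  have ht : IsTest c d φ := ⟨h1, h2, h3⟩
  have ht' := ht.mono hac hdb
  have := h.2.2 φ h1 h2 (h3.trans hs)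
  rwa [(ht'.iteratedDeriv i).setIntegral_eq, ht'.setIntegral_eq,
    ← (ht.iteratedDeriv i).setIntegral_eq, ← ht.setIntegral_eq] at this

lemma HasWeakDeriv.step {i : ℕ} {u v w : ℝ → ℝ} (hv : HasWeakDeriv a b i u v)
    (hw : HasWeakDeriv a b (i + 1) u w) : HasWeakDeriv a b 1 v w := by
  refine ⟨hv.2.1, hw.2.1, fun φ h1 h2 h3 => ?_⟩
  have ht : IsTest a b φ := ⟨h1, h2, h3⟩
  have e1 := hv.2.2 _ ht.deriv.smooth ht.deriv.compact ht.deriv.subset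
  have e2 := hw.2.2 φ h1 h2 h3
  rw [iteratedDeriv_succ', e1, pow_succ, mul_assoc] at e2
  rw [iteratedDeriv_one, pow_one]
  exact mul_left_cancel₀ (pow_ne_zero i (by norm_num : (-1 : ℝ) ≠ 0)) e2

lemma HasWeakDeriv.comp_one {i : ℕ} {u v w : ℝ → ℝ} (hv : HasWeakDeriv a b i u v)
    (hw : HasWeakDeriv a b 1 v w) : HasWeakDeriv a b (i + 1) u w := by
  refine ⟨hv.1, hw.2.1, fun φ h1 h2 h3 => ?_⟩
  have ht : IsTest a b φ := ⟨h1, h2, h3⟩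
  have e1 := hv.2.2 _ ht.deriv.smooth ht.deriv.compact ht.deriv.subset
  have e2 := hw.2.2 φ h1 h2 h3
  rw [iteratedDeriv_one] at e2
  rw [iteratedDeriv_succ', e1, e2]
  ring

lemma integral_primitive_mul_deriv (hab : a ≤ b) {g φ : ℝ → ℝ}
    (hg : IntervalIntegrable g volume a b) (h : IsTest a b φ) (c : ℝ) :
    ∫ x in Ioo a b, (c + ∫ t in a..x, g t) * deriv φ x = - ∫ x in Ioo a b, g x * φ x := by
  have hφ : ∀ x, ∫ t in a..x, deriv φ t = φ x := by
    intro x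
    rw [intervalIntegral.integral_deriv_eq_sub
      (fun t _ => (h.smooth.differentiable (by simp)).differentiableAt)
      (h.deriv.smooth.continuous.intervalIntegrable _ _), h.eq_zero (x := a) (by simp), sub_zero]
  have key := integral_mul_primitive hab hg
    (h.deriv.smooth.continuous.intervalIntegrable (μ := volume) a b) c 0
  simp only [zero_add, hφ, h.eq_zero (x := b) (by simp), mul_zero, sub_zero, zero_sub] at key
  rw [← integral_Ioc_eq_integral_Ioo, ← integral_Ioc_eq_integral_Ioo,
    ← intervalIntegral.integral_of_le hab, ← intervalIntegral.integral_of_le hab, key, neg_neg]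

/-- The lemma of du Bois-Reymond. -/
lemma ae_eq_const_of_integral_mul_deriv_eq_zero (hab : a < b) {h : ℝ → ℝ}
    (hh : LocallyIntegrableOn h (Ioo a b))
    (h0 : ∀ φ, IsTest a b φ → ∫ x in Ioo a b, h x * deriv φ x = 0) :
    ∃ c : ℝ, h =ᵐ[volume.restrict (Ioo a b)] fun _ => c := by
  -- a test function of mean value one
  obtain ⟨ψ, hψ, hψ1⟩ : ∃ ψ, IsTest a b ψ ∧ ∫ x, ψ x = 1 := by
    let f : ContDiffBump ((a + b) / 2) :=
      { rIn := (b - a) / 8, rOut := (b - a) / 4, rIn_pos := by linarith,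
        rIn_lt_rOut := by linarith }
    refine ⟨f.normed volume, ⟨f.contDiff_normed, f.hasCompactSupport_normed, ?_⟩,
      f.integral_normed⟩
    rw [f.tsupport_normed_eq, Real.closedBall_eq_Icc]
    intro x hx
    have h1 := hx.1
    have h2 := hx.2
    simp only [f] at h1 h2
    constructor <;> linarith
  set c := ∫ x in Ioo a b, h x * ψ x with hc
  refine ⟨c, ?_⟩
  have hcl : LocallyIntegrableOn (fun _ : ℝ => c) (Ioo a b) := locallyIntegrableOn_const c
  have key := isOpen_Ioo.ae_eq_zero_of_integral_contDiff_smul_eq_zero (hh.sub hcl)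
    (fun g h1 h2 h3 => by
      have ht : IsTest a b g := ⟨h1, h2, h3⟩
      -- `χ` has mean value zero, hence is the derivative of a test function
      set I := ∫ x, g x with hI
      set χ : ℝ → ℝ := fun x => g x - I * ψ x with hχ
      have hχs : ContDiff ℝ ∞ χ := h1.sub (contDiff_const.mul hψ.smooth)
      obtain ⟨K, hKc, hKs, hK⟩ : ∃ K, IsCompact K ∧ K ⊆ Ioo a b ∧ ∀ x ∉ K, χ x = 0 := by
        refine ⟨tsupport g ∪ tsupport ψ, ht.compact.isCompact.union hψ.compact.isCompact,
          union_subset ht.subset hψ.subset, fun x hx => ?_⟩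
        simp only [mem_union, not_or] at hx
        simp only [hχ]
        rw [image_eq_zero_of_notMem_tsupport hx.1, image_eq_zero_of_notMem_tsupport hx.2]
        ring
      obtain ⟨c', d', hc', hd', hKcd⟩ : ∃ c' d', a < c' ∧ d' < b ∧ K ⊆ Icc c' d' := by
        rcases K.eq_empty_or_nonempty with hKe | hKn
        · exact ⟨a + 1, b - 1, by linarith, by linarith, by simp [hKe]⟩
        · exact ⟨sInf K, sSup K, (hKs (hKc.sInf_mem hKn)).1, (hKs (hKc.sSup_mem hKn)).2,
            fun x hx => ⟨csInf_le hKc.bddBelow hx, le_csSup hKc.bddAbove hx⟩⟩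
      have hχ0 : ∀ x ∉ Icc c' d', χ x = 0 := fun x hx => hK x fun hx' => hx (hKcd hx')
      have gi : Integrable g := h1.continuous.integrable_of_hasCompactSupport h2
      have ψi : Integrable ψ := hψ.smooth.continuous.integrable_of_hasCompactSupport hψ.compact
      have hχi : ∫ x, χ x = 0 := by
        rw [hχ, integral_sub gi (ψi.const_mul I), integral_const_mul, hψ1, mul_one, hI, sub_self]
      set Φ : ℝ → ℝ := fun x => ∫ t in a..x, χ t with hΦ
      have hΦd : ∀ x, HasDerivAt Φ (χ x) x := fun x =>
        intervalIntegral.integral_hasDerivAt_right (hχs.continuous.intervalIntegrable _ _)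
          hχs.continuous.stronglyMeasurable.stronglyMeasurableAtFilter hχs.continuous.continuousAt
      have hΦ' : deriv Φ = χ := funext fun x => (hΦd x).deriv
      have hΦt : ∀ x ∉ Icc c' d', Φ x = 0 := by
        intro x hx
        rw [mem_Icc, not_and_or, not_le, not_le] at hx
        rcases hx with hx | hx
        · rw [hΦ]
          refine intervalIntegral.integral_zero_ae (Filter.Eventually.of_forall fun t htt => ?_)
          refine hχ0 t fun htm => ?_
          rcases le_total a x with hax | hax
          · rw [uIoc_of_le hax] at htt; linarith [htt.2, htm.1]
          · rw [uIoc_of_ge hax] at htt; linarith [htt.2, htm.1]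
        · have e1 : Φ x = ∫ t, χ t := by
            simp only [hΦ]
            by_cases hax : a ≤ x
            · rw [intervalIntegral.integral_eq_integral_of_support_subset]
              intro t htt
              by_contra hcon
              refine htt (hχ0 t fun htm => hcon ⟨?_, ?_⟩)
              · linarith [htm.1]
              · linarith [htm.2]
            · push Not at hax
              have hzero : ∀ t, χ t = 0 := by
                intro t
                refine hχ0 t fun htm => ?_
                linarith [htm.1, htm.2]
              simp [hzero]
          rw [e1, hχi]
      have hΦtest : IsTest a b Φ := by
        have hts : tsupport Φ ⊆ Icc c' d' := by
          refine closure_minimal (fun x hx => ?_) isClosed_Icc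
          by_contra hcon
          exact hx (hΦt x hcon)
        refine ⟨contDiff_infty_iff_deriv.mpr ⟨fun x => (hΦd x).differentiableAt, by rwa [hΦ']⟩,
          HasCompactSupport.of_support_subset_isCompact isCompact_Icc
            ((subset_tsupport _).trans hts), hts.trans fun x hx => ?_⟩
        exact ⟨by linarith [hx.1], by linarith [hx.2]⟩
      have e := h0 Φ hΦtest
      rw [hΦ'] at e
      have e2 : (fun x => h x * χ x) = fun x => h x * g x - I * (h x * ψ x) := by
        ext x; rw [hχ]; ring
      rw [e2, integral_sub (ht.integrable_mul hh).integrableOn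
        ((hψ.integrable_mul hh).integrableOn.const_mul I), integral_const_mul, ← hc,
        ht.setIntegral_eq] at e
      have e3 : (fun x => g x • (h - (fun _ => c : ℝ → ℝ)) x) = fun x => h x * g x - c * g x := by
        ext x; simp only [Pi.sub_apply, smul_eq_mul]; ring
      rw [e3, integral_sub (ht.integrable_mul hh) (gi.const_mul c), integral_const_mul, ← hI]
      linarith)
  refine (ae_restrict_iff' measurableSet_Ioo).mpr ?_
  filter_upwards [key] with x hx hxm
  exact sub_eq_zero.mp (hx hxm)

lemma HasWeakDeriv.aePrimitive (hab : a < b) {g g' : ℝ → ℝ} (h : HasWeakDeriv a b 1 g g')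
    (hg' : MemLp g' 2 (volume.restrict (Ioo a b))) : AEPrimitive a b g g' := by
  have hi := memLp_two_intervalIntegrable hab.le hg'
  have hG : LocallyIntegrableOn (fun x => ∫ t in a..x, g' t) (Ioo a b) :=
    ((continuousOn_primitive hab.le hi).mono Ioo_subset_Icc_self).locallyIntegrableOn
      measurableSet_Ioo
  obtain ⟨c, hc⟩ := ae_eq_const_of_integral_mul_deriv_eq_zero hab (h.1.sub hG) (by
    intro φ hφ
    have e1 := h.2.2 φ hφ.smooth hφ.compact hφ.subset
    have e2 := integral_primitive_mul_deriv hab.le hi hφ 0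
    rw [iteratedDeriv_one] at e1
    simp only [zero_add] at e2
    simp only [Pi.sub_apply, sub_mul]
    rw [integral_sub (hφ.deriv.integrable_mul h.1).integrableOn
      (hφ.deriv.integrable_mul hG).integrableOn, e1, e2]
    ring)
  refine ⟨c, ?_⟩
  filter_upwards [hc] with x hx
  rw [← hx]; simp

/-- The weak derivatives of a function in `H^M(a, b)`, as a chain of antiderivatives. -/
lemma exists_chain (hab : a < b) {M : ℕ} {u : ℝ → ℝ} (h : ∀ i ≤ M, weakSeminorm a b i u < ⊤) :
    ∃ Y : ℕ → ℝ → ℝ, (∀ i ≤ M, HasWeakDeriv a b i u (Y i) ∧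
      MemLp (Y i) 2 (volume.restrict (Ioo a b)) ∧
      weakSeminorm a b i u = eLpNorm (Y i) 2 (volume.restrict (Ioo a b))) ∧
      ∀ i < M, AEPrimitive a b (Y i) (Y (i + 1)) := by
  choose! Y hY using fun i (hi : i ≤ M) => exists_hasWeakDeriv (h i hi)
  refine ⟨Y, hY, fun i hi => ?_⟩
  exact ((hY i hi.le).1.step (hY (i + 1) hi).1).aePrimitive hab (hY (i + 1) hi).2.1

lemma hasWeakDeriv_one_of_hasDerivWithinAt (hab : a < b) {u v : ℝ → ℝ}
    (hu : ∀ t ∈ Icc a b, HasDerivWithinAt u (v t) (Icc a b) t) (hv : ContinuousOn v (Icc a b)) :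
    HasWeakDeriv a b 1 u v := by
  have huc : ContinuousOn u (Icc a b) := fun t ht => (hu t ht).continuousWithinAt
  have hvi : IntervalIntegrable v volume a b := by
    refine ContinuousOn.intervalIntegrable ?_
    rwa [uIcc_of_le hab.le]
  refine ⟨(huc.mono Ioo_subset_Icc_self).locallyIntegrableOn measurableSet_Ioo,
    (hv.mono Ioo_subset_Icc_self).locallyIntegrableOn measurableSet_Ioo, fun φ h1 h2 h3 => ?_⟩
  rw [iteratedDeriv_one, pow_one, neg_one_mul,
    ← integral_primitive_mul_deriv hab.le hvi ⟨h1, h2, h3⟩ (u a)]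
  refine setIntegral_congr_fun measurableSet_Ioo fun x hx => ?_
  have : ∫ t in a..x, v t = u x - u a := by
    refine intervalIntegral.integral_eq_sub_of_hasDerivAt_of_le hx.1.le
      (huc.mono (Icc_subset_Icc_right hx.2.le)) (fun t ht => ?_) ?_
    · exact (hu t ⟨ht.1.le, ht.2.le.trans hx.2.le⟩).hasDerivAt
        (Icc_mem_nhds ht.1 (ht.2.trans hx.2))
    · exact hvi.mono_set (by
        rw [uIcc_of_le hab.le, uIcc_of_le hx.1.le]; exact Icc_subset_Icc_right hx.2.le)
  simp only [this]
  ring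

lemma hasWeakDeriv_two (hab : a < b) {u v F : ℝ → ℝ}
    (hu : ∀ t ∈ Icc a b, HasDerivWithinAt u (v t) (Icc a b) t)
    (hv : ∀ t ∈ Icc a b, HasDerivWithinAt v (F t) (Icc a b) t) (hF : ContinuousOn F (Icc a b)) :
    HasWeakDeriv a b 2 u F :=
  (hasWeakDeriv_one_of_hasDerivWithinAt hab hu
    (fun t ht => (hv t ht).continuousWithinAt)).comp_one
    (hasWeakDeriv_one_of_hasDerivWithinAt hab hv hF)

end CPG

namespace CPG

variable {a b : ℝ}

/-! ### Sobolev norms and the `K`-functional -/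

lemma intSobolevENorm_sq (M : ℕ) (u : ℝ → ℝ) :
    intSobolevENorm a b M u ^ 2 = ∑ i ∈ Finset.range (M + 1), weakSeminorm a b i u ^ 2 := by
  rw [intSobolevENorm, ← ENNReal.rpow_natCast, ← ENNReal.rpow_mul]
  norm_num

lemma weakSeminorm_le_intSobolevENorm {i M : ℕ} (h : i ≤ M) (u : ℝ → ℝ) :
    weakSeminorm a b i u ≤ intSobolevENorm a b M u := by
  rw [← ENNReal.pow_le_pow_left_iff two_ne_zero, intSobolevENorm_sq]
  exact Finset.single_le_sum (f := fun i => weakSeminorm a b i u ^ 2) (fun _ _ => zero_le)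
    (Finset.mem_range.mpr (by omega))

lemma intSobolevENorm_lt_top_iff {M : ℕ} {u : ℝ → ℝ} :
    intSobolevENorm a b M u < ⊤ ↔ ∀ i ≤ M, weakSeminorm a b i u < ⊤ := by
  refine ⟨fun h i hi => (weakSeminorm_le_intSobolevENorm hi u).trans_lt h, fun h => ?_⟩
  refine ENNReal.rpow_lt_top_of_nonneg (by norm_num) (ENNReal.sum_lt_top.mpr fun i hi => ?_).ne
  exact ENNReal.pow_lt_top (h i (by have := Finset.mem_range.mp hi; omega))

lemma weakSeminorm_zero (i : ℕ) : weakSeminorm a b i 0 = 0 := by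
  rw [(HasWeakDeriv.zero i).weakSeminorm_eq, eLpNorm_zero]

lemma intSobolevENorm_zero (M : ℕ) : intSobolevENorm a b M 0 = 0 := by
  rw [← pow_eq_zero_iff two_ne_zero, intSobolevENorm_sq]
  simp [weakSeminorm_zero]

lemma weakSeminorm_le_sub_add (i : ℕ) (u w : ℝ → ℝ) :
    weakSeminorm a b i u ≤ weakSeminorm a b i (u - w) + weakSeminorm a b i w := by
  by_cases h1 : weakSeminorm a b i (u - w) < ⊤
  · by_cases h2 : weakSeminorm a b i w < ⊤
    · obtain ⟨v1, hv1, hm1, e1⟩ := exists_hasWeakDeriv h1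
      obtain ⟨v2, hv2, hm2, e2⟩ := exists_hasWeakDeriv h2
      have h3 := hv1.add hv2
      rw [sub_add_cancel] at h3
      rw [h3.weakSeminorm_eq, e1, e2]
      exact eLpNorm_add_le hm1.aestronglyMeasurable hm2.aestronglyMeasurable (by norm_num)
    · rw [not_lt_top_iff.mp h2, add_top]; exact le_top
  · rw [not_lt_top_iff.mp h1, top_add]; exact le_top

lemma weakSeminorm_le_kFunctional {i m : ℕ} (hi : i ≤ m) (u : ℝ → ℝ) :
    weakSeminorm a b i u ≤ kFunctional a b m 1 u := by
  refine le_iInf fun w => (weakSeminorm_le_sub_add i u w).trans ?_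
  rw [ENNReal.ofReal_one, one_mul]
  exact add_le_add (weakSeminorm_le_intSobolevENorm hi _)
    (weakSeminorm_le_intSobolevENorm (by omega) _)

lemma kFunctional_mono (m : ℕ) (u : ℝ → ℝ) {s t : ℝ} (hst : s ≤ t) :
    kFunctional a b m s u ≤ kFunctional a b m t u :=
  iInf_mono fun w => by gcongr

lemma kFunctional_le_intSobolevENorm (m : ℕ) (u : ℝ → ℝ) (t : ℝ) :
    kFunctional a b m t u ≤ intSobolevENorm a b m u := by
  refine (iInf_le _ 0).trans ?_
  rw [sub_zero, intSobolevENorm_zero, mul_zero, add_zero]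

lemma kFunctional_le_mul (m : ℕ) (u : ℝ → ℝ) (t : ℝ) :
    kFunctional a b m t u ≤ ENNReal.ofReal t * intSobolevENorm a b (m + 1) u := by
  refine (iInf_le _ u).trans ?_
  rw [sub_self, intSobolevENorm_zero, zero_add]

lemma interpENorm_sq (m : ℕ) (θ : ℝ) (u : ℝ → ℝ) :
    interpENorm a b m θ u ^ 2 = ∫⁻ t in Ioi (0 : ℝ),
      (ENNReal.ofReal (t ^ (-θ)) * kFunctional a b m t u) ^ 2 * ENNReal.ofReal (1 / t) := by
  rw [interpENorm, ← ENNReal.rpow_natCast, ← ENNReal.rpow_mul]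
  norm_num

/-- The `K`-functional at one point is controlled by the interpolation norm, with a constant
independent of `θ`: restrict the defining integral to `(t, 2t)`. -/
lemma kFunctional_le_interpENorm (m : ℕ) {θ : ℝ} (h0 : 0 ≤ θ) (h1 : θ ≤ 1) (u : ℝ → ℝ) {t : ℝ}
    (ht : 0 < t) :
    kFunctional a b m t u ≤ ENNReal.ofReal (4 * t ^ θ) * interpENorm a b m θ u := by
  set K := kFunctional a b m t u with hK
  set X := ENNReal.ofReal ((2 * t) ^ (-θ)) * K with hX
  have hlow : X ^ 2 * ENNReal.ofReal (1 / 2) ≤ interpENorm a b m θ u ^ 2 := by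
    rw [interpENorm_sq]
    calc X ^ 2 * ENNReal.ofReal (1 / 2)
        = ∫⁻ _ in Ioc t (2 * t), X ^ 2 * ENNReal.ofReal (1 / (2 * t)) := by
          rw [setLIntegral_const, Real.volume_Ioc, mul_assoc, ← ENNReal.ofReal_mul (by positivity)]
          congr 2
          field_simp
          ring
      _ ≤ ∫⁻ s in Ioc t (2 * t),
          (ENNReal.ofReal (s ^ (-θ)) * kFunctional a b m s u) ^ 2 * ENNReal.ofReal (1 / s) := by
          refine setLIntegral_mono' measurableSet_Ioc fun s hs => ?_
          have hs0 : 0 < s := ht.trans hs.1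
          rw [hX, hK]
          gcongr ?_ ^ 2 * ENNReal.ofReal ?_
          · refine mul_le_mul' (ENNReal.ofReal_le_ofReal ?_) (kFunctional_mono m u hs.1.le)
            exact Real.rpow_le_rpow_of_nonpos hs0 hs.2 (by linarith)
          · exact one_div_le_one_div_of_le hs0 hs.2
      _ ≤ _ := lintegral_mono_set fun s hs => ht.trans hs.1
  have hX2 : X ≤ 2 * interpENorm a b m θ u := by
    rw [← ENNReal.pow_le_pow_left_iff two_ne_zero, mul_pow 2]
    have e : X ^ 2 = 2 * (X ^ 2 * ENNReal.ofReal (1 / 2)) := by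
      rw [mul_comm (X ^ 2), ← mul_assoc, show (2 : ℝ≥0∞) = ENNReal.ofReal 2 by simp,
        ← ENNReal.ofReal_mul (by norm_num)]
      norm_num
    rw [e]
    calc 2 * (X ^ 2 * ENNReal.ofReal (1 / 2)) ≤ 2 * interpENorm a b m θ u ^ 2 := by gcongr
      _ ≤ 2 ^ 2 * interpENorm a b m θ u ^ 2 := by gcongr; norm_num
  have hKX : K = ENNReal.ofReal ((2 * t) ^ θ) * X := by
    rw [hX, ← mul_assoc, ← ENNReal.ofReal_mul (by positivity),
      ← Real.rpow_add (by positivity)]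
    simp
  rw [hKX]
  calc ENNReal.ofReal ((2 * t) ^ θ) * X
      ≤ ENNReal.ofReal ((2 * t) ^ θ) * (2 * interpENorm a b m θ u) := by gcongr
    _ = ENNReal.ofReal (2 * (2 * t) ^ θ) * interpENorm a b m θ u := by
        rw [ENNReal.ofReal_mul (by norm_num)]; simp; ring
    _ ≤ _ := by
        refine mul_le_mul' (ENNReal.ofReal_le_ofReal ?_) le_rfl
        rw [Real.mul_rpow (by norm_num) ht.le]
        have : (2 : ℝ) ^ θ ≤ 2 := by
          calc (2 : ℝ) ^ θ ≤ 2 ^ (1 : ℝ) := Real.rpow_le_rpow_of_exponent_le (by norm_num) h1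
            _ = 2 := by norm_num
        have := mul_le_mul_of_nonneg_right this (Real.rpow_nonneg ht.le θ)
        linarith

/-- Interpolation of a bound valid for all decompositions. -/
lemma le_interpENorm (m : ℕ) {θ : ℝ} (h0 : 0 ≤ θ) (h1 : θ ≤ 1) (u : ℝ → ℝ) {A₀ A₁ : ℝ}
    (hA₀ : 0 < A₀) (hA₁ : 0 < A₁) {D : ℝ≥0∞}
    (h : ∀ w : ℝ → ℝ, D ≤ ENNReal.ofReal A₀ * intSobolevENorm a b m (u - w) +
      ENNReal.ofReal A₁ * intSobolevENorm a b (m + 1) w) :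
    D ≤ ENNReal.ofReal (4 * A₀ * (A₁ / A₀) ^ θ) * interpENorm a b m θ u := by
  have hD : D ≤ ENNReal.ofReal A₀ * kFunctional a b m (A₁ / A₀) u := by
    rw [kFunctional, ENNReal.mul_iInf_of_ne (by simp [hA₀]) ENNReal.ofReal_ne_top]
    refine le_iInf fun w => (h w).trans (le_of_eq ?_)
    rw [mul_add, ← mul_assoc, ← ENNReal.ofReal_mul hA₀.le, mul_div_cancel₀ _ hA₀.ne']
  refine hD.trans ?_
  refine (mul_le_mul_right (kFunctional_le_interpENorm m h0 h1 u (div_pos hA₁ hA₀)) _).trans ?_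
  rw [← mul_assoc, ← ENNReal.ofReal_mul hA₀.le]
  apply le_of_eq
  congr 2
  ring

lemma interpENorm_lt_top {m : ℕ} {θ : ℝ} (h0 : 0 < θ) {u : ℝ → ℝ}
    (hu : intSobolevENorm a b m u < ⊤)
    (h : ∫⁻ t in Ioc (0 : ℝ) 1,
      (ENNReal.ofReal (t ^ (-θ)) * kFunctional a b m t u) ^ 2 * ENNReal.ofReal (1 / t) < ⊤) :
    interpENorm a b m θ u < ⊤ := by
  refine ENNReal.rpow_lt_top_of_nonneg (by norm_num) (ne_of_lt ?_)
  rw [← Ioc_union_Ioi_eq_Ioi (zero_le_one' ℝ)]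
  refine (lintegral_union_le _ _ _).trans_lt (ENNReal.add_lt_top.mpr ⟨h, ?_⟩)
  have hint : IntegrableOn (fun t : ℝ => t ^ (-2 * θ - 1)) (Ioi 1) :=
    integrableOn_Ioi_rpow_of_lt (by linarith) one_pos
  calc ∫⁻ t in Ioi (1 : ℝ),
        (ENNReal.ofReal (t ^ (-θ)) * kFunctional a b m t u) ^ 2 * ENNReal.ofReal (1 / t)
      ≤ ∫⁻ t in Ioi (1 : ℝ), intSobolevENorm a b m u ^ 2 * ENNReal.ofReal (t ^ (-2 * θ - 1)) := by
        refine setLIntegral_mono' measurableSet_Ioi fun t ht => ?_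
        have ht0 : (0 : ℝ) < t := one_pos.trans ht
        rw [mul_pow, ← ENNReal.ofReal_pow (by positivity), mul_comm (ENNReal.ofReal _), mul_assoc,
          ← ENNReal.ofReal_mul (by positivity)]
        refine mul_le_mul' (pow_le_pow_left' (kFunctional_le_intSobolevENorm m u t) 2) (le_of_eq ?_)
        congr 1
        rw [Real.rpow_sub ht0, Real.rpow_one, ← Real.rpow_natCast, ← Real.rpow_mul ht0.le]
        push_cast
        rw [show -θ * 2 = -2 * θ by ring]
        ring
    _ = intSobolevENorm a b m u ^ 2 * ∫⁻ t in Ioi (1 : ℝ), ENNReal.ofReal (t ^ (-2 * θ - 1)) :=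
        lintegral_const_mul' _ _ (ENNReal.pow_lt_top hu).ne
    _ < ⊤ := by
        refine ENNReal.mul_lt_top (ENNReal.pow_lt_top hu) ?_
        rw [← ofReal_integral_eq_lintegral_ofReal hint]
        · exact ENNReal.ofReal_lt_top
        · filter_upwards [ae_restrict_mem measurableSet_Ioi] with t ht
          exact Real.rpow_nonneg (one_pos.trans ht).le _

lemma interpENorm_lt_top_of_intSobolevENorm {m : ℕ} {θ : ℝ} (h0 : 0 < θ) (h1 : θ < 1) {u : ℝ → ℝ}
    (hu : intSobolevENorm a b (m + 1) u < ⊤) : interpENorm a b m θ u < ⊤ := by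
  have hum : intSobolevENorm a b m u < ⊤ := intSobolevENorm_lt_top_iff.mpr fun i hi =>
    intSobolevENorm_lt_top_iff.mp hu i (by omega)
  refine interpENorm_lt_top h0 hum ?_
  have hint : IntegrableOn (fun t : ℝ => t ^ (1 - 2 * θ)) (Ioc 0 1) := by
    have := intervalIntegral.intervalIntegrable_rpow' (a := 0) (b := 1) (r := 1 - 2 * θ)
      (by linarith)
    rwa [intervalIntegrable_iff_integrableOn_Ioc_of_le zero_le_one] at this
  calc ∫⁻ t in Ioc (0 : ℝ) 1,
        (ENNReal.ofReal (t ^ (-θ)) * kFunctional a b m t u) ^ 2 * ENNReal.ofReal (1 / t)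
      ≤ ∫⁻ t in Ioc (0 : ℝ) 1,
          intSobolevENorm a b (m + 1) u ^ 2 * ENNReal.ofReal (t ^ (1 - 2 * θ)) := by
        refine setLIntegral_mono' measurableSet_Ioc fun t ht => ?_
        have ht0 : (0 : ℝ) < t := ht.1
        refine (mul_le_mul' (pow_le_pow_left' (mul_le_mul' le_rfl
          (kFunctional_le_mul m u t)) 2) le_rfl).trans (le_of_eq ?_)
        rw [← mul_assoc, ← ENNReal.ofReal_mul (by positivity), mul_pow,
          ← ENNReal.ofReal_pow (by positivity), mul_comm (ENNReal.ofReal _), mul_assoc,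
          ← ENNReal.ofReal_mul (by positivity)]
        congr 2
        rw [Real.rpow_sub ht0, Real.rpow_one, mul_pow, ← Real.rpow_natCast (t ^ (-θ)),
          ← Real.rpow_mul ht0.le]
        push_cast
        rw [show -θ * 2 = -(2 * θ) by ring, Real.rpow_neg ht0.le]
        field_simp
    _ = intSobolevENorm a b (m + 1) u ^ 2 *
          ∫⁻ t in Ioc (0 : ℝ) 1, ENNReal.ofReal (t ^ (1 - 2 * θ)) :=
        lintegral_const_mul' _ _ (ENNReal.pow_lt_top hu).ne
    _ < ⊤ := by
        refine ENNReal.mul_lt_top (ENNReal.pow_lt_top hu) ?_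
        rw [← ofReal_integral_eq_lintegral_ofReal hint]
        · exact ENNReal.ofReal_lt_top
        · filter_upwards [ae_restrict_mem measurableSet_Ioc] with t ht
          exact Real.rpow_nonneg ht.1.le _

lemma intSobolevENorm_lt_top_of_interpENorm {m : ℕ} {θ : ℝ} (h0 : 0 ≤ θ) (h1 : θ ≤ 1) {u : ℝ → ℝ}
    (h : interpENorm a b m θ u < ⊤) : intSobolevENorm a b m u < ⊤ := by
  refine intSobolevENorm_lt_top_iff.mpr fun i hi => ?_
  refine (weakSeminorm_le_kFunctional hi u).trans_lt
    ((kFunctional_le_interpENorm m h0 h1 u one_pos).trans_lt ?_)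
  exact ENNReal.mul_lt_top ENNReal.ofReal_lt_top h

/-- Monotonicity of the interpolation spaces: large `t` do not matter, since the `K`-functional is
bounded. -/
lemma interpENorm_lt_top_mono {m : ℕ} {θ θ' : ℝ} (h0 : 0 < θ) (h : θ ≤ θ') (h1 : θ' ≤ 1)
    {u : ℝ → ℝ} (hu : interpENorm a b m θ' u < ⊤) : interpENorm a b m θ u < ⊤ := by
  refine interpENorm_lt_top h0 (intSobolevENorm_lt_top_of_interpENorm (h0.le.trans h) h1 hu) ?_
  have hu2 : interpENorm a b m θ' u ^ 2 < ⊤ := ENNReal.pow_lt_top hu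
  rw [interpENorm_sq] at hu2
  refine lt_of_le_of_lt ?_ hu2
  refine (setLIntegral_mono' measurableSet_Ioc fun t ht => ?_).trans
    (lintegral_mono_set (Ioc_subset_Ioi_self))
  have : t ^ (-θ) ≤ t ^ (-θ') := Real.rpow_le_rpow_of_exponent_ge ht.1 ht.2 (by linarith)
  gcongr

lemma MemSobolev.intSobolevENorm_lt_top {s : ℝ} {u : ℝ → ℝ} (hs : 0 ≤ s)
    (h : MemSobolev a b s u) : intSobolevENorm a b ⌊s⌋₊ u < ⊤ := by
  unfold MemSobolev sobolevENorm at h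
  split_ifs at h with hi
  · exact h
  · have h1 := Nat.floor_le hs
    have h2 := Nat.lt_floor_add_one s
    exact intSobolevENorm_lt_top_of_interpENorm (by linarith) (by linarith) h

lemma MemSobolev.mono {s s' : ℝ} {u : ℝ → ℝ} (hs : 0 ≤ s) (hss : s ≤ s')
    (h : MemSobolev a b s' u) : MemSobolev a b s u := by
  have h1 := Nat.floor_le hs
  have h2 := Nat.lt_floor_add_one s
  have h3 := Nat.floor_le (hs.trans hss)
  have h4 := Nat.lt_floor_add_one s'
  have hfl : ⌊s⌋₊ ≤ ⌊s'⌋₊ := Nat.floor_le_floor hss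
  have hint := h.intSobolevENorm_lt_top (hs.trans hss)
  have hmono : ∀ {k l : ℕ}, k ≤ l → intSobolevENorm a b l u < ⊤ → intSobolevENorm a b k u < ⊤ :=
    fun hkl hl => intSobolevENorm_lt_top_iff.mpr fun i hi =>
      intSobolevENorm_lt_top_iff.mp hl i (hi.trans hkl)
  unfold MemSobolev sobolevENorm at h ⊢
  split_ifs with hi
  · exact hmono hfl hint
  have hθ : 0 < s - ⌊s⌋₊ := sub_pos.mpr (lt_of_le_of_ne h1 (Ne.symm hi))
  rcases hfl.eq_or_lt with he | hlt
  · split_ifs at h with hi'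
    · exfalso
      rw [← he] at hi'
      linarith
    · rw [← he] at h h4
      exact interpENorm_lt_top_mono hθ (by linarith) (by linarith) h
  · exact interpENorm_lt_top_of_intSobolevENorm hθ (by linarith) (hmono hlt hint)

/-! ### Approximation of the second derivative in Sobolev norms -/

open Polynomial

/-- The best approximation of the second derivative `F` of `u` by polynomials of degree less
than `n`. -/
lemma IsProj.eLpNorm_le_weakSeminorm (hab : a < b) {n m : ℕ} (hm : m ≤ n) {u F : ℝ → ℝ} {q : ℝ[X]}
    (hF : HasWeakDeriv a b 2 u F) (hq : IsProj a b n F q)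
    (hu : ∀ i ≤ m + 2, weakSeminorm a b i u < ⊤) :
    eLpNorm (fun x => F x - q.eval x) 2 (volume.restrict (Ioo a b)) ≤
      ENNReal.ofReal (approxConst (b - a) n m) * weakSeminorm a b (m + 2) u := by
  obtain ⟨Y, hY, hc⟩ := exists_chain hab hu
  have h2 : F =ᵐ[volume.restrict (Ioo a b)] Y 2 := hF.ae_eq (hY 2 (by omega)).1
  have key := IsProj.eLpNorm_le_approxConst hab hm (fun i => Y (i + 2))
    (fun i hi => hc (i + 2) (by omega)) (hY (m + 2) le_rfl).2.1 (hq.congr_ae hab.le h2)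
  rw [(hY (m + 2) le_rfl).2.2]
  refine le_trans (le_of_eq (eLpNorm_congr_ae ?_)) key
  filter_upwards [h2] with x hx
  rw [hx]

/-- A decomposition `u = (u - w) + w` allows different orders of approximation for its parts. -/
lemma IsProj.eLpNorm_le_add (hab : a < b) {n m : ℕ} (hm : m + 1 ≤ n) {u F w : ℝ → ℝ} {q : ℝ[X]}
    (hF : HasWeakDeriv a b 2 u F) (hFm : MemLp F 2 (volume.restrict (Ioo a b)))
    (hq : IsProj a b n F q)
    (hu : ∀ i ≤ m + 2, weakSeminorm a b i (u - w) < ⊤)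
    (hw : ∀ i ≤ m + 3, weakSeminorm a b i w < ⊤) :
    eLpNorm (fun x => F x - q.eval x) 2 (volume.restrict (Ioo a b)) ≤
      ENNReal.ofReal (approxConst (b - a) n m) * weakSeminorm a b (m + 2) (u - w) +
      ENNReal.ofReal (approxConst (b - a) n (m + 1)) * weakSeminorm a b (m + 3) w := by
  obtain ⟨y₁, hy₁, hm₁, -⟩ := exists_hasWeakDeriv (hu 2 (by omega))
  obtain ⟨y₂, hy₂, hm₂, -⟩ := exists_hasWeakDeriv (hw 2 (by omega))
  obtain ⟨q₁, hq₁⟩ := exists_isProj hab n hm₁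
  obtain ⟨q₂, hq₂⟩ := exists_isProj hab n hm₂
  have h1 := hq₁.eLpNorm_le_weakSeminorm hab (by omega) hy₁ hu
  have h2 := hq₂.eLpNorm_le_weakSeminorm hab hm hy₂ hw
  have hsum := hy₁.add hy₂
  rw [sub_add_cancel] at hsum
  have hae := hF.ae_eq hsum
  refine (hq.eLpNorm_le hab.le hFm (Submodule.add_mem _ hq₁.1 hq₂.1)).trans ?_
  refine le_trans ?_ (add_le_add h1 h2)
  refine le_trans (le_of_eq (eLpNorm_congr_ae ?_)) (eLpNorm_add_le
    (sub_poly_memLp_two hm₁ q₁).aestronglyMeasurable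
    (sub_poly_memLp_two hm₂ q₂).aestronglyMeasurable (by norm_num))
  filter_upwards [hae] with x hx
  simp only [hx, Pi.add_apply, eval_add]
  ring

lemma gain_eq_Gamma {n m : ℕ} (h : m ≤ n) :
    gain n m = Real.Gamma (n + m + 1) / Real.Gamma (n - m + 1) := by
  induction m with
  | zero => simp [gain, Real.Gamma_nat_eq_factorial, Nat.factorial_ne_zero]
  | succ m ih =>
    have hnm : (m : ℝ) + 1 ≤ n := by exact_mod_cast h
    have hm0 : (0 : ℝ) ≤ m := Nat.cast_nonneg m
    have e1 : Real.Gamma ((n : ℝ) + m + 1 + 1) = (n + m + 1) * Real.Gamma (n + m + 1) :=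
      Real.Gamma_add_one (by positivity)
    have e2 : Real.Gamma ((n : ℝ) - m + 1) = (n - m) * Real.Gamma (n - m) :=
      Real.Gamma_add_one (by linarith)
    have hpos : 0 < Real.Gamma ((n : ℝ) - m) := Real.Gamma_pos_of_pos (by linarith)
    rw [gain, Finset.prod_range_succ, ← gain, ih (by omega), e2]
    push_cast
    rw [show (n : ℝ) + (m + 1) + 1 = n + m + 1 + 1 by ring, e1,
      show (n : ℝ) - (m + 1) + 1 = n - m by ring]
    have : (n : ℝ) - m ≠ 0 := by linarith
    field_simp

/-- A consequence of the logarithmic convexity of the Gamma function. -/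
lemma Gamma_add_le {y θ : ℝ} (hy : 0 < y) (h0 : 0 ≤ θ) (h1 : θ ≤ 1) :
    Real.Gamma (y + θ) ≤ Real.Gamma y * y ^ θ := by
  rcases h0.eq_or_lt with rfl | h0
  · simp
  rcases h1.eq_or_lt with rfl | h1
  · rw [Real.rpow_one, mul_comm, Real.Gamma_add_one hy.ne']
  have h := Real.Gamma_mul_add_mul_le_rpow_Gamma_mul_rpow_Gamma hy (by linarith : 0 < y + 1)
    (sub_pos.mpr h1) h0 (by ring)
  have hG := Real.Gamma_pos_of_pos hy
  rw [Real.Gamma_add_one hy.ne', Real.mul_rpow hy.le hG.le] at h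
  calc Real.Gamma (y + θ) = Real.Gamma ((1 - θ) * y + θ * (y + 1)) := by congr 1; ring
    _ ≤ _ := h
    _ = (Real.Gamma y ^ (1 - θ) * Real.Gamma y ^ θ) * y ^ θ := by ring
    _ = _ := by rw [← Real.rpow_add hG]; simp

/-- The interpolated approximation constant, bounded by the Gamma quotient of real order. -/
lemma interp_approxConst_sq_le {k : ℝ} (hk : 0 < k) {n m : ℕ} (hm : m + 1 ≤ n) {θ : ℝ}
    (h0 : 0 ≤ θ) (h1 : θ ≤ 1) :
    (approxConst k n m * (approxConst k n (m + 1) / approxConst k n m) ^ θ) ^ 2 ≤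
      2 * ((k / 2) ^ (2 * (m + θ)) *
        (Real.Gamma (n - m + 1 - θ) / Real.Gamma (n + m + 1 + θ))) := by
  have hnm : (m : ℝ) + 1 ≤ n := by exact_mod_cast hm
  have hm0 : (0 : ℝ) ≤ m := Nat.cast_nonneg m
  have hk2 : 0 < k / 2 := by positivity
  set x : ℝ := n - m with hx
  set y : ℝ := n + m + 1 with hy
  have hx1 : 1 ≤ x := by linarith
  have hy1 : 0 < y := by positivity
  have hg := gain_pos (n := n) (m := m) (by omega)
  have hgs : gain n (m + 1) = gain n m * (x * y) := by
    rw [gain, Finset.prod_range_succ, ← gain]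
  have hrat : approxConst k n (m + 1) / approxConst k n m = (k / 2) / √(x * y) := by
    rw [approxConst, approxConst, hgs, Real.sqrt_mul hg.le, pow_succ]
    have : √(gain n m) ≠ 0 := (Real.sqrt_pos.mpr hg).ne'
    have : √(x * y) ≠ 0 := (Real.sqrt_pos.mpr (by positivity)).ne'
    field_simp
  have hG1 : 0 < Real.Gamma (x + 1 - θ) := Real.Gamma_pos_of_pos (by linarith)
  have hG2 : 0 < Real.Gamma (y + θ) := Real.Gamma_pos_of_pos (by linarith)
  have hG3 : 0 < Real.Gamma y := Real.Gamma_pos_of_pos hy1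
  have hG4 : 0 < Real.Gamma (x + 1) := Real.Gamma_pos_of_pos (by linarith)
  have hlhs : (approxConst k n m * (approxConst k n (m + 1) / approxConst k n m) ^ θ) ^ 2 =
      (k / 2) ^ (2 * (m + θ)) * (Real.Gamma (x + 1) / (Real.Gamma y * (x ^ θ * y ^ θ))) := by
    have e1 : (((k / 2) / √(x * y)) ^ θ) ^ 2 = (k / 2) ^ (2 * θ) / (x ^ θ * y ^ θ) := by
      rw [← Real.rpow_natCast, ← Real.rpow_mul (by positivity), mul_comm θ, Real.rpow_mul
        (by positivity), Real.rpow_natCast, div_pow, Real.sq_sqrt (by positivity),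
        Real.div_rpow (by positivity) (by positivity), Real.mul_rpow (by linarith) hy1.le,
        Real.rpow_mul hk2.le, Real.rpow_two]
    have e2 : (k / 2) ^ (2 * (m + θ)) = ((k / 2) ^ m) ^ 2 * (k / 2) ^ (2 * θ) := by
      rw [mul_add, Real.rpow_add hk2, ← pow_mul, ← Real.rpow_natCast, mul_comm m 2]
      push_cast; rfl
    rw [hrat, mul_pow, e1, e2, approxConst, div_pow, Real.sq_sqrt hg.le,
      gain_eq_Gamma (by omega : m ≤ n), ← hx, ← hy]
    field_simp
  rw [hlhs, mul_left_comm (2 : ℝ), show (n : ℝ) - m + 1 - θ = x + 1 - θ by rw [hx],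
    show (n : ℝ) + m + 1 + θ = y + θ by rw [hy]]
  refine mul_le_mul_of_nonneg_left ?_ (Real.rpow_nonneg hk2.le _)
  have i1 : Real.Gamma (x + 1) ≤ 2 * x ^ θ * Real.Gamma (x + 1 - θ) := by
    have := Gamma_add_le (y := x + 1 - θ) (by linarith) h0 h1
    rw [sub_add_cancel] at this
    refine this.trans ?_
    rw [mul_comm]
    refine mul_le_mul_of_nonneg_right ?_ hG1.le
    calc (x + 1 - θ) ^ θ ≤ (2 * x) ^ θ := Real.rpow_le_rpow (by linarith) (by linarith) h0
      _ = 2 ^ θ * x ^ θ := Real.mul_rpow (by norm_num) (by linarith)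
      _ ≤ 2 * x ^ θ := by
        gcongr
        calc (2 : ℝ) ^ θ ≤ 2 ^ (1 : ℝ) := Real.rpow_le_rpow_of_exponent_le (by norm_num) h1
          _ = 2 := by norm_num
  have i2 : Real.Gamma (y + θ) ≤ Real.Gamma y * y ^ θ := Gamma_add_le hy1 h0 h1
  have hxθ : 0 < x ^ θ := Real.rpow_pos_of_pos (by linarith) _
  have hyθ : 0 < y ^ θ := Real.rpow_pos_of_pos hy1 _
  rw [← mul_div_assoc, div_le_div_iff₀ (by positivity) hG2]
  calc Real.Gamma (x + 1) * Real.Gamma (y + θ)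
      ≤ (2 * x ^ θ * Real.Gamma (x + 1 - θ)) * (Real.Gamma y * y ^ θ) := by gcongr
    _ = _ := by ring

/-- The projection error of the second derivative in terms of the Sobolev norm of real order
`s + 1`. -/
lemma IsProj.integral_sq_le_sobolevNorm (hab : a < b) {r : ℕ} {s : ℝ} (hs1 : 1 ≤ s)
    (hsr : s ≤ r) {u F : ℝ → ℝ} {q : ℝ[X]} (hF : HasWeakDeriv a b 2 u F)
    (hFm : MemLp F 2 (volume.restrict (Ioo a b))) (hq : IsProj a b (r - 1) F q)
    (hu : MemSobolev a b (s + 1) u) :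
    ∫ x in a..b, (F x - q.eval x) ^ 2 ≤ 32 * (((b - a) / 2) ^ (2 * s - 2) *
      (Real.Gamma ((r : ℝ) - s + 1) / Real.Gamma ((r : ℝ) + s - 1)) *
      sobolevNorm a b (s + 1) u ^ 2) := by
  have hk : 0 < b - a := sub_pos.mpr hab
  obtain ⟨m, hm⟩ : ∃ m, ⌊s⌋₊ = m + 1 :=
    ⟨⌊s⌋₊ - 1, by have := (Nat.one_le_floor_iff s).mpr hs1; omega⟩
  have hfl : ⌊s + 1⌋₊ = m + 2 := by rw [Nat.floor_add_one (by linarith), hm]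
  have hf1 : ((m : ℝ) + 1) ≤ s := by
    have := Nat.floor_le (by linarith : 0 ≤ s); rw [hm] at this; exact_mod_cast this
  have hf2 : s < (m : ℝ) + 1 + 1 := by
    have := Nat.lt_floor_add_one s; rw [hm] at this; exact_mod_cast this
  have hr1 : 1 ≤ r := by
    have : (1 : ℝ) ≤ r := hs1.trans hsr
    exact_mod_cast this
  have hn : ((r - 1 : ℕ) : ℝ) = r - 1 := by rw [Nat.cast_sub hr1]; simp
  have hmn : m ≤ r - 1 := by
    have : (m : ℝ) ≤ ((r - 1 : ℕ) : ℝ) := by rw [hn]; linarith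
    exact_mod_cast this
  have hGpos : 0 ≤ Real.Gamma ((r : ℝ) - s + 1) / Real.Gamma ((r : ℝ) + s - 1) :=
    div_nonneg (Real.Gamma_pos_of_pos (by linarith)).le (Real.Gamma_pos_of_pos (by linarith)).le
  have hlt : sobolevENorm a b (s + 1) u < ⊤ := hu
  -- reduce to an estimate of `eLpNorm`
  suffices H : ∃ A : ℝ, 0 ≤ A ∧ A ^ 2 ≤ 32 * (((b - a) / 2) ^ (2 * s - 2) *
      (Real.Gamma ((r : ℝ) - s + 1) / Real.Gamma ((r : ℝ) + s - 1))) ∧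
      eLpNorm (fun x => F x - q.eval x) 2 (volume.restrict (Ioo a b)) ≤
        ENNReal.ofReal A * sobolevENorm a b (s + 1) u by
    obtain ⟨A, hA0, hA, hle⟩ := H
    have e : sobolevENorm a b (s + 1) u = ENNReal.ofReal (sobolevNorm a b (s + 1) u) :=
      (ENNReal.ofReal_toReal hlt.ne).symm
    have hN : 0 ≤ sobolevNorm a b (s + 1) u := ENNReal.toReal_nonneg
    rw [e, ← ENNReal.ofReal_mul hA0, ← ENNReal.pow_le_pow_left_iff two_ne_zero,
      eLpNorm_two_sq hab.le (sub_poly_memLp_two hFm q), ← ENNReal.ofReal_pow (by positivity),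
      ENNReal.ofReal_le_ofReal_iff (by positivity), mul_pow] at hle
    refine hle.trans ?_
    calc _ ≤ (32 * (((b - a) / 2) ^ (2 * s - 2) *
          (Real.Gamma ((r : ℝ) - s + 1) / Real.Gamma ((r : ℝ) + s - 1)))) *
          sobolevNorm a b (s + 1) u ^ 2 := by gcongr
      _ = _ := by ring
  have hint := hu.intSobolevENorm_lt_top (by linarith)
  rw [hfl] at hint
  have hseq : s + 1 = (⌊s + 1⌋₊ : ℝ) ↔ s = m + 1 := by
    rw [hfl]; push_cast
    constructor <;> intro h <;> linarith
  unfold sobolevENorm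
  split_ifs with hi
  · have hsm := hseq.mp hi
    refine ⟨approxConst (b - a) (r - 1) m, (approxConst_pos hk hmn).le, ?_, ?_⟩
    · have hg := gain_pos hmn
      have e1 : approxConst (b - a) (r - 1) m ^ 2 = ((b - a) / 2) ^ (2 * s - 2) *
          (Real.Gamma ((r : ℝ) - s + 1) / Real.Gamma ((r : ℝ) + s - 1)) := by
        rw [approxConst, div_pow, Real.sq_sqrt hg.le, gain_eq_Gamma hmn, hn, hsm, ← pow_mul,
          ← Real.rpow_natCast, show (r : ℝ) - 1 + m + 1 = r + (m + 1) - 1 by ring,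
          show (r : ℝ) - 1 - m + 1 = r - (m + 1) + 1 by ring,
          show (2 : ℝ) * (m + 1) - 2 = ((m * 2 : ℕ) : ℝ) by push_cast; ring]
        rw [div_div_eq_mul_div, mul_div_assoc]
      rw [e1]
      have : 0 ≤ ((b - a) / 2) ^ (2 * s - 2) *
          (Real.Gamma ((r : ℝ) - s + 1) / Real.Gamma ((r : ℝ) + s - 1)) :=
        mul_nonneg (by positivity) hGpos
      linarith
    · rw [hfl]
      refine (hq.eLpNorm_le_weakSeminorm hab hmn hF (intSobolevENorm_lt_top_iff.mp hint)).trans ?_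
      gcongr
      exact weakSeminorm_le_intSobolevENorm le_rfl u
  · have hne : s ≠ m + 1 := fun h => hi (hseq.mpr h)
    have hlt' : (m : ℝ) + 1 < s := lt_of_le_of_ne hf1 (Ne.symm hne)
    have hmn' : m + 1 ≤ r - 1 := by
      have : (m : ℝ) + 1 < r := hlt'.trans_le hsr
      have : m + 1 < r := by exact_mod_cast this
      omega
    set θ := s + 1 - (⌊s + 1⌋₊ : ℝ) with hθ
    have hθe : θ = s - (m + 1) := by rw [hθ, hfl]; push_cast; ring
    have hA0 := approxConst_pos hk hmn
    have hA1 := approxConst_pos hk hmn'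
    refine ⟨4 * approxConst (b - a) (r - 1) m *
      (approxConst (b - a) (r - 1) (m + 1) / approxConst (b - a) (r - 1) m) ^ θ, by positivity,
      ?_, ?_⟩
    · have := interp_approxConst_sq_le hk hmn' (θ := θ) (by linarith) (by linarith)
      rw [hn, hθe, show 2 * ((m : ℝ) + (s - (m + 1))) = 2 * s - 2 by ring,
        show (r : ℝ) - 1 - m + 1 - (s - (m + 1)) = r - s + 1 by ring,
        show (r : ℝ) - 1 + m + 1 + (s - (m + 1)) = r + s - 1 by ring] at this
      rw [hθe, mul_assoc 4, mul_pow]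
      linarith
    · rw [hfl]
      refine le_interpENorm (m + 2) (by linarith) (by linarith) u hA0 hA1 fun w => ?_
      by_cases hw1 : intSobolevENorm a b (m + 2) (u - w) < ⊤
      · by_cases hw2 : intSobolevENorm a b (m + 2 + 1) w < ⊤
        · refine (hq.eLpNorm_le_add hab hmn' hF hFm (intSobolevENorm_lt_top_iff.mp hw1)
            (intSobolevENorm_lt_top_iff.mp hw2)).trans ?_
          gcongr
          · exact weakSeminorm_le_intSobolevENorm le_rfl _
          · exact weakSeminorm_le_intSobolevENorm le_rfl _
        · rw [not_lt_top_iff.mp hw2, ENNReal.mul_top (by simp [hA1]), add_top]; exact le_top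
      · rw [not_lt_top_iff.mp hw1, ENNReal.mul_top (by simp [hA0]), top_add]; exact le_top

end CPG

namespace CPG

/-! ### Weighted `L²` estimates for antiderivatives -/

/-- The square of the `L²(0, T)`-norm with the exponential weight `exp (-l t)`. -/
noncomputable def wsq (T l : ℝ) (h : ℝ → ℝ) : ℝ := ∫ t in (0 : ℝ)..T, Real.exp (-l * t) * h t ^ 2

/-- The antiderivative vanishing at `0`. -/
noncomputable def prim (h : ℝ → ℝ) : ℝ → ℝ := fun x => ∫ t in (0 : ℝ)..x, h t

variable {T l : ℝ} {h k : ℝ → ℝ}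

lemma wsq_integrable (hT : 0 ≤ T) (hh : MemLp h 2 (volume.restrict (Ioo 0 T))) :
    IntervalIntegrable (fun t => Real.exp (-l * t) * h t ^ 2) volume 0 T := by
  have : IntervalIntegrable (fun t => h t ^ 2) volume 0 T := by
    simpa only [sq] using memLp_two_intervalIntegrable_sq hT hh hh
  exact this.continuousOn_mul (by fun_prop)

lemma wsq_zero_eq : wsq T 0 h = ∫ t in (0 : ℝ)..T, h t ^ 2 := by simp [wsq]

lemma wsq_nonneg (hT : 0 ≤ T) : 0 ≤ wsq T l h :=
  intervalIntegral.integral_nonneg hT fun t _ => by positivity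

lemma intervalIntegral_mono_Ioo {a b : ℝ} (hab : a ≤ b) {f g : ℝ → ℝ}
    (hf : IntervalIntegrable f volume a b) (hg : IntervalIntegrable g volume a b)
    (h : ∀ x ∈ Ioo a b, f x ≤ g x) : ∫ x in a..b, f x ≤ ∫ x in a..b, g x := by
  rw [intervalIntegral.integral_of_le hab, intervalIntegral.integral_of_le hab,
    integral_Ioc_eq_integral_Ioo, integral_Ioc_eq_integral_Ioo]
  rw [intervalIntegrable_iff_integrableOn_Ioo_of_le hab] at hf hg
  exact setIntegral_mono_on hf hg measurableSet_Ioo h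

/-- A pointwise quadratic bound by finitely many functions, integrated. -/
lemma wsq_le_sum (hT : 0 ≤ T) (hh : MemLp h 2 (volume.restrict (Ioo 0 T))) {n : ℕ}
    (c : Fin n → ℝ) (ks : Fin n → ℝ → ℝ) (hk : ∀ i, MemLp (ks i) 2 (volume.restrict (Ioo 0 T)))
    (hle : ∀ t ∈ Ioo 0 T, h t ^ 2 ≤ ∑ i, c i * ks i t ^ 2) :
    wsq T l h ≤ ∑ i, c i * wsq T l (ks i) := by
  have hi : ∀ i, IntervalIntegrable (fun t => c i * (Real.exp (-l * t) * ks i t ^ 2)) volume 0 T :=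
    fun i => (wsq_integrable hT (hk i)).const_mul _
  have hs : IntervalIntegrable
      (fun t => ∑ i, c i * (Real.exp (-l * t) * ks i t ^ 2)) volume 0 T := by
    have := IntervalIntegrable.sum Finset.univ (fun i _ => hi i)
    convert! this using 1
    ext t
    simp
  calc wsq T l h ≤ ∫ t in (0 : ℝ)..T, ∑ i, c i * (Real.exp (-l * t) * ks i t ^ 2) := by
        refine intervalIntegral_mono_Ioo hT (wsq_integrable hT hh) hs fun t ht => ?_
        calc _ ≤ Real.exp (-l * t) * ∑ i, c i * ks i t ^ 2 := by gcongr; exact hle t ht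
          _ = _ := by rw [Finset.mul_sum]; exact Finset.sum_congr rfl fun i _ => by ring
    _ = ∑ i, c i * wsq T l (ks i) := by
        rw [intervalIntegral.integral_finsetSum (fun i _ => hi i)]
        exact Finset.sum_congr rfl fun i _ => intervalIntegral.integral_const_mul _ _

lemma wsq_le_add (hT : 0 ≤ T) (hh : MemLp h 2 (volume.restrict (Ioo 0 T))) {k₁ k₂ : ℝ → ℝ}
    (h₁ : MemLp k₁ 2 (volume.restrict (Ioo 0 T))) (h₂ : MemLp k₂ 2 (volume.restrict (Ioo 0 T)))
    {c₁ c₂ : ℝ} (hle : ∀ t ∈ Ioo 0 T, h t ^ 2 ≤ c₁ * k₁ t ^ 2 + c₂ * k₂ t ^ 2) :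
    wsq T l h ≤ c₁ * wsq T l k₁ + c₂ * wsq T l k₂ := by
  have := wsq_le_sum (l := l) hT hh ![c₁, c₂] ![k₁, k₂]
    (by intro i; fin_cases i <;> assumption) (by intro t ht; simpa using hle t ht)
  simpa using this

lemma wsq_le_mul (hT : 0 ≤ T) (hh : MemLp h 2 (volume.restrict (Ioo 0 T)))
    (hk : MemLp k 2 (volume.restrict (Ioo 0 T)))
    {c : ℝ} (hle : ∀ t ∈ Ioo 0 T, h t ^ 2 ≤ c * k t ^ 2) :
    wsq T l h ≤ c * wsq T l k := by
  have := wsq_le_add (l := l) hT hh hk hk (c₁ := c) (c₂ := 0) (by simpa using hle)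
  simpa using this

lemma wsq_le_wsq_zero (hT : 0 ≤ T) (hl : 0 ≤ l) (hh : MemLp h 2 (volume.restrict (Ioo 0 T))) :
    wsq T l h ≤ wsq T 0 h := by
  refine intervalIntegral_mono_Ioo hT (wsq_integrable hT hh) (wsq_integrable hT hh) fun t ht => ?_
  gcongr
  nlinarith [ht.1]

lemma wsq_zero_le (hT : 0 ≤ T) (hl : 0 ≤ l) (hh : MemLp h 2 (volume.restrict (Ioo 0 T))) :
    wsq T 0 h ≤ Real.exp (l * T) * wsq T l h := by
  rw [wsq, wsq, ← intervalIntegral.integral_const_mul]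
  refine intervalIntegral_mono_Ioo hT (wsq_integrable hT hh)
    ((wsq_integrable hT hh).const_mul _) fun t ht => ?_
  rw [← mul_assoc, ← Real.exp_add]
  gcongr
  nlinarith [ht.1, ht.2]

lemma continuousOn_prim (hT : 0 ≤ T) (hh : IntervalIntegrable h volume 0 T) :
    ContinuousOn (prim h) (Icc 0 T) := continuousOn_primitive hT hh

lemma prim_memLp (hT : 0 ≤ T) (hh : MemLp h 2 (volume.restrict (Ioo 0 T))) :
    MemLp (prim h) 2 (volume.restrict (Ioo 0 T)) :=
  continuousOn_memLp_two (continuousOn_prim hT (memLp_two_intervalIntegrable hT hh))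

lemma prim_sq (hh : IntervalIntegrable h volume 0 T) {x : ℝ} (hx : x ∈ Icc 0 T) :
    prim h x ^ 2 = ∫ t in (0 : ℝ)..x, 2 * (prim h t * h t) := by
  have hi : IntervalIntegrable h volume 0 x := hh.mono_set (by
    rw [uIcc_of_le hx.1, uIcc_of_le (hx.1.trans hx.2)]; exact Icc_subset_Icc_right hx.2)
  have := integral_mul_primitive hx.1 hi hi 0 0
  simp only [zero_add, mul_zero, sub_zero] at this
  have e : (fun t => h t * ∫ s in (0 : ℝ)..t, h s) = fun t => (∫ s in (0 : ℝ)..t, h s) * h t := by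
    ext t; ring
  rw [e] at this
  rw [intervalIntegral.integral_const_mul, sq]
  simp only [prim]
  linarith

/-- A Hardy type inequality: in the norm with weight `exp (-l t)`, the antiderivative is smaller
than the function by the factor `2 / l`. -/
lemma wsq_prim_le (hT : 0 ≤ T) (hl : 0 < l) (hh : MemLp h 2 (volume.restrict (Ioo 0 T))) :
    wsq T l (prim h) ≤ 4 / l ^ 2 * wsq T l h := by
  have hi := memLp_two_intervalIntegrable hT hh
  have hH := prim_memLp hT hh
  have hHc := continuousOn_prim hT hi
  have hHh : IntervalIntegrable (fun t => 2 * (prim h t * h t)) volume 0 T :=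
    (memLp_two_intervalIntegrable_sq hT hH hh).const_mul 2
  have hE : ∀ x, (1 : ℝ) + ∫ t in (0 : ℝ)..x, -l * Real.exp (-l * t) = Real.exp (-l * x) := by
    intro x
    have := intervalIntegral.integral_eq_sub_of_hasDerivAt (a := 0) (b := x)
      (f := fun t => Real.exp (-l * t)) (f' := fun t => -l * Real.exp (-l * t))
      (fun t _ => by
        have := ((hasDerivAt_id t).const_mul (-l)).exp
        simpa [mul_comm] using this)
      (Continuous.intervalIntegrable (by fun_prop) _ _)
    rw [this]; simp
  have key := integral_mul_primitive hT
    (Continuous.intervalIntegrable (by fun_prop : Continuous fun t => -l * Real.exp (-l * t)) 0 T)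
    hHh 1 0
  simp only [hE, zero_add, mul_zero, sub_zero] at key
  have e1 : ∫ x in (0 : ℝ)..T, -l * Real.exp (-l * x) * ∫ t in (0 : ℝ)..x, 2 * (prim h t * h t) =
      -l * wsq T l (prim h) := by
    rw [wsq, ← intervalIntegral.integral_const_mul]
    refine intervalIntegral.integral_congr fun x hx => ?_
    rw [uIcc_of_le hT] at hx
    rw [← prim_sq hi hx]
    ring
  rw [e1] at key
  have hnn : 0 ≤ Real.exp (-l * T) * ∫ t in (0 : ℝ)..T, 2 * (prim h t * h t) := by
    rw [← prim_sq hi ⟨hT, le_rfl⟩]; positivity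
  have hyoung : ∫ x in (0 : ℝ)..T, Real.exp (-l * x) * (2 * (prim h x * h x)) ≤
      l / 2 * wsq T l (prim h) + 2 / l * wsq T l h := by
    rw [wsq, wsq, ← intervalIntegral.integral_const_mul, ← intervalIntegral.integral_const_mul,
      ← intervalIntegral.integral_add ((wsq_integrable hT hH).const_mul _)
        ((wsq_integrable hT hh).const_mul _)]
    refine intervalIntegral_mono_Ioo hT (hHh.continuousOn_mul (by fun_prop))
      (((wsq_integrable hT hH).const_mul _).add ((wsq_integrable hT hh).const_mul _)) fun t _ => ?_
    have h1 : 2 * (prim h t * h t) ≤ l / 2 * prim h t ^ 2 + 2 / l * h t ^ 2 := by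
      have h2 := sq_nonneg (l * prim h t - 2 * h t)
      have h3 : l / 2 * prim h t ^ 2 + 2 / l * h t ^ 2 - 2 * (prim h t * h t) =
          (l * prim h t - 2 * h t) ^ 2 / (2 * l) := by
        field_simp; ring
      have h4 : 0 ≤ (l * prim h t - 2 * h t) ^ 2 / (2 * l) := by positivity
      linarith
    have := mul_le_mul_of_nonneg_left h1 (Real.exp_pos (-l * t)).le
    linarith
  have : l / 2 * wsq T l (prim h) ≤ 2 / l * wsq T l h := by linarith
  calc wsq T l (prim h) = 2 / l * (l / 2 * wsq T l (prim h)) := by field_simp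
    _ ≤ 2 / l * (2 / l * wsq T l h) := by gcongr
    _ = _ := by field_simp; ring

lemma wsq_zero_prim_le (hT : 0 ≤ T) (hh : MemLp h 2 (volume.restrict (Ioo 0 T))) :
    wsq T 0 (prim h) ≤ Real.exp (2 * T) * wsq T 0 h := by
  refine (wsq_zero_le hT zero_le_two (prim_memLp hT hh)).trans ?_
  have h1 := wsq_prim_le hT two_pos hh
  have h2 := wsq_le_wsq_zero hT zero_le_two hh
  norm_num at h1
  gcongr
  exact h1.trans h2

/-! ### Stability of the perturbed problem -/

/-- The first stability estimate. The splitting `e = b + z`, `e' = a + z'` with `z'' = G` and the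
weighted bound of `G` by the Lipschitz nonlinearity `g` are combined; with the weight
`exp (-(16 L + 4) t)` the contributions of `z` and `z'` are absorbed by Hardy's inequality. -/
lemma stability_energy (hT : 0 ≤ T) {L : ℝ} (hL : 0 < L) {a b G g : ℝ → ℝ}
    (ha : MemLp a 2 (volume.restrict (Ioo 0 T))) (hb : MemLp b 2 (volume.restrict (Ioo 0 T)))
    (hG : MemLp G 2 (volume.restrict (Ioo 0 T))) (hg : MemLp g 2 (volume.restrict (Ioo 0 T)))
    (hgL : ∀ t ∈ Ioo 0 T, |g t| ≤
      L * (|b t + prim (prim G) t| + |a t + prim G t|))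
    (hw : wsq T (16 * L + 4) G ≤ 3 * wsq T (16 * L + 4) g) :
    wsq T 0 G ≤ 24 * L ^ 2 * Real.exp ((16 * L + 4) * T) * (wsq T 0 a + wsq T 0 b) := by
  set l := 16 * L + 4 with hl
  have hl0 : 0 < l := by positivity
  have hz1 := prim_memLp hT hG
  have hz := prim_memLp hT hz1
  have h1 : wsq T l g ≤ 4 * L ^ 2 * wsq T l a + 4 * L ^ 2 * wsq T l b +
      4 * L ^ 2 * wsq T l (prim G) + 4 * L ^ 2 * wsq T l (prim (prim G)) := by
    have := wsq_le_sum (l := l) hT hg (fun _ : Fin 4 => 4 * L ^ 2)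
      ![a, b, prim G, prim (prim G)]
      (by intro i; fin_cases i <;> assumption) (by
        intro t ht
        have h2 := hgL t ht
        have h3 : g t ^ 2 ≤ (L * (|b t + prim (prim G) t| + |a t + prim G t|)) ^ 2 := by
          rw [← sq_abs (g t)]; gcongr
        refine h3.trans ?_
        simp only [Fin.sum_univ_four, Matrix.cons_val]
        rw [mul_pow]
        have h5 : (|b t + prim (prim G) t| + |a t + prim G t|) ^ 2 ≤
            4 * (a t ^ 2 + b t ^ 2 + prim G t ^ 2 + prim (prim G) t ^ 2) := by
          nlinarith [sq_abs (b t + prim (prim G) t), sq_abs (a t + prim G t),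
            sq_nonneg (|b t + prim (prim G) t| - |a t + prim G t|),
            sq_nonneg (b t - prim (prim G) t), sq_nonneg (a t - prim G t)]
        have := mul_le_mul_of_nonneg_left h5 (sq_nonneg L)
        linarith)
    simpa [Fin.sum_univ_four] using this
  have h2 := wsq_prim_le hT hl0 hG
  have h3 := wsq_prim_le hT hl0 hz1
  have hGn : 0 ≤ wsq T l G := wsq_nonneg hT
  have hl2 : 4 / l ^ 2 ≤ 1 / 4 := by
    rw [div_le_iff₀ (by positivity), hl]; nlinarith
  have hlL : L ^ 2 * (4 / l ^ 2) ≤ 1 / 64 := by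
    rw [← mul_div_assoc, div_le_iff₀ (by positivity), hl]; nlinarith
  have h4 : wsq T l (prim (prim G)) ≤ 1 / 4 * (4 / l ^ 2 * wsq T l G) := by
    refine h3.trans ?_
    have h5 : 0 ≤ wsq T l (prim G) := wsq_nonneg hT
    calc _ ≤ 1 / 4 * wsq T l (prim G) := by gcongr
      _ ≤ _ := by gcongr
  have h6 : 12 * L ^ 2 * (wsq T l (prim G) + wsq T l (prim (prim G))) ≤ 1 / 2 * wsq T l G := by
    calc _ ≤ 12 * L ^ 2 * (4 / l ^ 2 * wsq T l G + 1 / 4 * (4 / l ^ 2 * wsq T l G)) := by gcongr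
      _ = 15 * (L ^ 2 * (4 / l ^ 2)) * wsq T l G := by ring
      _ ≤ 15 * (1 / 64) * wsq T l G := by gcongr
      _ ≤ _ := by linarith
  have h7 : wsq T l G ≤ 24 * L ^ 2 * (wsq T l a + wsq T l b) := by linarith
  have h8 := wsq_zero_le hT hl0.le hG
  have h9 := wsq_le_wsq_zero hT hl0.le ha
  have h10 := wsq_le_wsq_zero hT hl0.le hb
  calc wsq T 0 G ≤ Real.exp (l * T) * wsq T l G := h8
    _ ≤ Real.exp (l * T) * (24 * L ^ 2 * (wsq T 0 a + wsq T 0 b)) := by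
        gcongr
        exact h7.trans (by gcongr)
    _ = _ := by ring

lemma prim_add (hT : 0 ≤ T) (hh : IntervalIntegrable h volume 0 T)
    (hk : IntervalIntegrable k volume 0 T) {x : ℝ} (hx : x ∈ Icc 0 T) :
    prim (fun t => h t + k t) x = prim h x + prim k x := by
  have hs : uIcc 0 x ⊆ uIcc 0 T := by
    rw [uIcc_of_le hx.1, uIcc_of_le hT]; exact Icc_subset_Icc_right hx.2
  exact intervalIntegral.integral_add (hh.mono_set hs) (hk.mono_set hs)

lemma continuousOn_mul_memLp {c : ℝ → ℝ} {M : ℝ} (hc : ContinuousOn c (Icc 0 T))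
    (hcM : ∀ t ∈ Icc 0 T, |c t| ≤ M)
    (hh : MemLp h 2 (volume.restrict (Ioo 0 T))) :
    MemLp (fun t => c t * h t) 2 (volume.restrict (Ioo 0 T)) := by
  refine MemLp.of_le_mul (c := M) hh
    (((hc.mono Ioo_subset_Icc_self).aestronglyMeasurable measurableSet_Ioo).mul
      hh.aestronglyMeasurable) ?_
  filter_upwards [ae_restrict_mem measurableSet_Ioo] with t ht
  rw [norm_mul]
  exact mul_le_mul_of_nonneg_right (hcM t (Ioo_subset_Icc_self ht)) (norm_nonneg _)

/-- The second stability estimate, for the linearized problem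
`z'' = α (b + z) + β (a + z') + R - ζ` with `b' = a`. The term `β a` is integrated by parts, so that
only `b`, the antiderivative of `ζ` and the `L¹`-norm of `R` enter. -/
lemma stability_linearized (hT : 0 ≤ T) {M ρ : ℝ} (hM : 0 ≤ M) {a G ζ R α β β' : ℝ → ℝ}
    (ha : ContinuousOn a (Icc 0 T))
    (hG : MemLp G 2 (volume.restrict (Ioo 0 T))) (hζ : MemLp ζ 2 (volume.restrict (Ioo 0 T)))
    (hR : ContinuousOn R (Icc 0 T))
    (hα : ContinuousOn α (Icc 0 T)) (hβ' : ContinuousOn β' (Icc 0 T))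
    (hαM : ∀ t ∈ Icc 0 T, |α t| ≤ M) (hβM : ∀ t ∈ Icc 0 T, |β t| ≤ M)
    (hβ'M : ∀ t ∈ Icc 0 T, |β' t| ≤ M)
    (hβ : ∀ t ∈ Icc 0 T, β t = β 0 + prim β' t)
    (hρ : ∫ t in (0 : ℝ)..T, |R t| ≤ ρ)
    (hGe : ∀ t ∈ Ioo 0 T, G t = α t * (prim a t + prim (prim G) t) +
      β t * (a t + prim G t) + R t - ζ t) :
    wsq T 0 (prim G) ≤ 20 * Real.exp ((8 * M + 4) * T) * (Real.exp (2 * T) * M ^ 2 *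
      (3 * wsq T 0 (prim a)) + T * ρ ^ 2 + wsq T 0 (prim ζ)) := by
  set m := 8 * M + 4 with hm
  have hm0 : 0 < m := by positivity
  have hbc : ContinuousOn β (Icc 0 T) := by
    refine ContinuousOn.congr (continuousOn_const.add (continuousOn_prim hT ?_)) hβ
    exact ContinuousOn.intervalIntegrable (by rwa [uIcc_of_le hT])
  have hβ'i : IntervalIntegrable β' volume 0 T :=
    ContinuousOn.intervalIntegrable (by rwa [uIcc_of_le hT])
  have ham := continuousOn_memLp_two ha
  have hai := memLp_two_intervalIntegrable hT ham
  have hRm := continuousOn_memLp_two hR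
  have hb := prim_memLp hT ham
  have hz1 := prim_memLp hT hG
  have hz := prim_memLp hT hz1
  have hαb := continuousOn_mul_memLp hα hαM hb
  have hβa := continuousOn_mul_memLp hbc hβM ham
  have hαz := continuousOn_mul_memLp hα hαM hz
  have hβz := continuousOn_mul_memLp hbc hβM hz1
  have hβb := continuousOn_mul_memLp hbc hβM hb
  have hβ'b := continuousOn_mul_memLp hβ' hβ'M hb
  set p : ℝ → ℝ := fun t => α t * prim (prim G) t + β t * prim G t with hp
  have hpm : MemLp p 2 (volume.restrict (Ioo 0 T)) := hαz.add hβz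
  set Φ : ℝ → ℝ := fun t => prim (fun t => α t * prim a t) t + β t * prim a t
    - prim (fun t => β' t * prim a t) t + prim R t - prim ζ t with hΦ
  have hΦm : MemLp Φ 2 (volume.restrict (Ioo 0 T)) :=
    ((((prim_memLp hT hαb).add hβb).sub (prim_memLp hT hβ'b)).add (prim_memLp hT hRm)).sub
      (prim_memLp hT hζ)
  have hsplit : ∀ x ∈ Icc 0 T, prim G x = prim p x + Φ x := by
    intro x hx
    have hs : uIcc 0 x ⊆ uIcc 0 T := by
      rw [uIcc_of_le hx.1, uIcc_of_le hT]; exact Icc_subset_Icc_right hx.2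
    have i1 := (memLp_two_intervalIntegrable hT hpm).mono_set hs
    have i2 := (memLp_two_intervalIntegrable hT hαb).mono_set hs
    have i3 := (memLp_two_intervalIntegrable hT hβa).mono_set hs
    have i4 := (memLp_two_intervalIntegrable hT hRm).mono_set hs
    have i5 := (memLp_two_intervalIntegrable hT hζ).mono_set hs
    have e1 : prim G x = ∫ t in (0 : ℝ)..x, (p t + α t * prim a t + β t * a t + R t - ζ t) := by
      rw [prim, intervalIntegral.integral_of_le hx.1, intervalIntegral.integral_of_le hx.1,
        integral_Ioc_eq_integral_Ioo, integral_Ioc_eq_integral_Ioo]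
      refine setIntegral_congr_fun measurableSet_Ioo fun t ht => ?_
      rw [hGe t ⟨ht.1, ht.2.trans_le hx.2⟩, hp]
      ring
    have e2 : ∫ t in (0 : ℝ)..x, β t * a t = β x * prim a x - prim (fun t => β' t * prim a t) x := by
      have := integral_mul_primitive hx.1 (hai.mono_set hs) (hβ'i.mono_set hs) 0 (β 0)
      simp only [zero_add, zero_mul, sub_zero] at this
      have e3 : ∫ t in (0 : ℝ)..x, β t * a t =
          ∫ t in (0 : ℝ)..x, a t * (β 0 + ∫ s in (0 : ℝ)..t, β' s) := by
        refine intervalIntegral.integral_congr fun t ht => ?_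
        rw [uIcc_of_le hx.1] at ht
        rw [hβ t ⟨ht.1, ht.2.trans hx.2⟩, prim, mul_comm]
      rw [e3, this, hβ x hx, mul_comm]
      simp only [prim, mul_comm]
    rw [e1, intervalIntegral.integral_sub (((i1.add i2).add i3).add i4) i5,
      intervalIntegral.integral_add ((i1.add i2).add i3) i4,
      intervalIntegral.integral_add (i1.add i2) i3, intervalIntegral.integral_add i1 i2, e2, hΦ]
    simp only [prim]
    ring
  -- absorption of the linear terms in the weighted norm
  have habs : wsq T m (prim G) ≤ 4 * wsq T m Φ := by
    have h1 := wsq_le_add (l := m) hT hz1 (prim_memLp hT hpm) hΦm (c₁ := 2) (c₂ := 2) (by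
      intro t ht
      rw [hsplit t (Ioo_subset_Icc_self ht)]
      nlinarith [sq_nonneg (prim p t - Φ t)])
    have h2 := wsq_prim_le hT hm0 hpm
    have h3 := wsq_le_add (l := m) hT hpm hz hz1 (c₁ := 2 * M ^ 2) (c₂ := 2 * M ^ 2) (by
      intro t ht
      have h4 : (α t * prim (prim G) t) ^ 2 ≤ M ^ 2 * prim (prim G) t ^ 2 := by
        rw [mul_pow]
        gcongr 1
        rw [← sq_abs]
        exact pow_le_pow_left₀ (abs_nonneg _) (hαM t (Ioo_subset_Icc_self ht)) 2
      have h5 : (β t * prim G t) ^ 2 ≤ M ^ 2 * prim G t ^ 2 := by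
        rw [mul_pow]
        gcongr 1
        rw [← sq_abs]
        exact pow_le_pow_left₀ (abs_nonneg _) (hβM t (Ioo_subset_Icc_self ht)) 2
      simp only [hp]
      nlinarith [sq_nonneg (α t * prim (prim G) t - β t * prim G t)])
    have h4 := wsq_prim_le hT hm0 hz1
    have hn : 0 ≤ wsq T m (prim G) := wsq_nonneg hT
    have hm2 : 4 / m ^ 2 ≤ 1 / 4 := by
      rw [div_le_iff₀ (by positivity), hm]; nlinarith
    have hmM : M ^ 2 * (4 / m ^ 2) ≤ 1 / 16 := by
      rw [← mul_div_assoc, div_le_iff₀ (by positivity), hm]; nlinarith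
    have h5 : wsq T m (prim (prim G)) ≤ 1 / 4 * wsq T m (prim G) := h4.trans (by gcongr)
    have h6 : wsq T m (prim p) ≤ 5 / 32 * wsq T m (prim G) := by
      calc _ ≤ 4 / m ^ 2 * wsq T m p := h2
        _ ≤ 4 / m ^ 2 * (2 * M ^ 2 * (1 / 4 * wsq T m (prim G)) + 2 * M ^ 2 * wsq T m (prim G)) := by
            gcongr
            exact h3.trans (by gcongr)
        _ = 5 / 2 * (M ^ 2 * (4 / m ^ 2)) * wsq T m (prim G) := by ring
        _ ≤ 5 / 2 * (1 / 16) * wsq T m (prim G) := by gcongr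
        _ = _ := by ring
    have hΦn : 0 ≤ wsq T m Φ := wsq_nonneg hT
    linarith
  have hR1 : ∀ t ∈ Icc 0 T, |prim R t| ≤ ρ := by
    intro t ht
    have hRi : IntervalIntegrable (fun t => |R t|) volume 0 T :=
      (memLp_two_intervalIntegrable hT hRm).abs
    calc |prim R t| ≤ ∫ s in (0 : ℝ)..t, |R s| :=
          intervalIntegral.abs_integral_le_integral_abs ht.1
      _ ≤ ∫ s in (0 : ℝ)..T, |R s| := by
          refine intervalIntegral.integral_mono_interval le_rfl ht.1 ht.2 ?_ hRi
          exact Filter.Eventually.of_forall fun s => abs_nonneg _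
      _ ≤ ρ := hρ
  have hΦle : wsq T 0 Φ ≤ 5 * (Real.exp (2 * T) * M ^ 2 * (3 * wsq T 0 (prim a)) + T * ρ ^ 2 +
      wsq T 0 (prim ζ)) := by
    have h1 := wsq_le_sum (l := 0) hT hΦm (fun _ : Fin 5 => 5)
      ![prim (fun t => α t * prim a t), fun t => β t * prim a t,
        prim (fun t => β' t * prim a t), prim R, prim ζ]
      (by
        intro i
        fin_cases i
        · exact prim_memLp hT hαb
        · exact hβb
        · exact prim_memLp hT hβ'b
        · exact prim_memLp hT hRm
        · exact prim_memLp hT hζ) (by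
        intro t _
        simp only [Fin.sum_univ_five, Matrix.cons_val, hΦ]
        set c1 := prim (fun t => α t * prim a t) t
        set c2 := β t * prim a t
        set c3 := prim (fun t => β' t * prim a t) t
        set c4 := prim R t
        set c5 := prim ζ t
        nlinarith [sq_nonneg (c1 - c2), sq_nonneg (c1 + c3), sq_nonneg (c1 - c4),
          sq_nonneg (c1 + c5), sq_nonneg (c2 + c3), sq_nonneg (c2 - c4), sq_nonneg (c2 + c5),
          sq_nonneg (c3 + c4), sq_nonneg (c3 - c5), sq_nonneg (c4 + c5)])
    simp only [Fin.sum_univ_five, Matrix.cons_val] at h1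
    have hmul : ∀ c : ℝ → ℝ, (∀ t ∈ Icc 0 T, |c t| ≤ M) →
        MemLp (fun t => c t * prim a t) 2 (volume.restrict (Ioo 0 T)) →
        wsq T 0 (fun t => c t * prim a t) ≤ M ^ 2 * wsq T 0 (prim a) := by
      intro c hc hcm
      refine wsq_le_mul hT hcm hb fun t ht => ?_
      rw [mul_pow]
      gcongr 1
      rw [← sq_abs]
      exact pow_le_pow_left₀ (abs_nonneg _) (hc t (Ioo_subset_Icc_self ht)) 2
    have hE : 1 ≤ Real.exp (2 * T) := Real.one_le_exp (by linarith)
    have hbn : 0 ≤ wsq T 0 (prim a) := wsq_nonneg hT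
    have j1 : wsq T 0 (prim (fun t => α t * prim a t)) ≤
        Real.exp (2 * T) * (M ^ 2 * wsq T 0 (prim a)) :=
      (wsq_zero_prim_le hT hαb).trans (by gcongr; exact hmul α hαM hαb)
    have j2 : wsq T 0 (fun t => β t * prim a t) ≤
        Real.exp (2 * T) * (M ^ 2 * wsq T 0 (prim a)) :=
      (hmul β hβM hβb).trans (le_mul_of_one_le_left (by positivity) hE)
    have j3 : wsq T 0 (prim (fun t => β' t * prim a t)) ≤
        Real.exp (2 * T) * (M ^ 2 * wsq T 0 (prim a)) :=
      (wsq_zero_prim_le hT hβ'b).trans (by gcongr; exact hmul β' hβ'M hβ'b)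
    have j4 : wsq T 0 (prim R) ≤ T * ρ ^ 2 := by
      have hone : MemLp (fun _ : ℝ => (1 : ℝ)) 2 (volume.restrict (Ioo 0 T)) := memLp_const 1
      have := wsq_le_mul (l := 0) hT (prim_memLp hT hRm) hone (c := ρ ^ 2) (by
        intro t ht
        rw [one_pow, mul_one, ← sq_abs]
        exact pow_le_pow_left₀ (abs_nonneg _) (hR1 t (Ioo_subset_Icc_self ht)) 2)
      refine this.trans (le_of_eq ?_)
      simp [wsq, mul_comm]
    linarith
  have hfin := wsq_zero_le hT hm0.le hz1
  have hΦ0 := wsq_le_wsq_zero hT hm0.le hΦm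
  calc wsq T 0 (prim G) ≤ Real.exp (m * T) * wsq T m (prim G) := hfin
    _ ≤ Real.exp (m * T) * (4 * (5 * (Real.exp (2 * T) * M ^ 2 * (3 * wsq T 0 (prim a)) +
        T * ρ ^ 2 + wsq T 0 (prim ζ)))) := by
        gcongr
        linarith
    _ = _ := by ring

end CPG

namespace CPG

/-! ### Linearization of the right-hand side along the exact solution -/

lemma contDiffOn_one_of_hasDerivWithinAt {E : Type*} [NormedAddCommGroup E] [NormedSpace ℝ E]
    {T : ℝ} (hT : 0 < T) {g g' : ℝ → E}
    (hg : ∀ t ∈ Icc 0 T, HasDerivWithinAt g (g' t) (Icc 0 T) t)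
    (hg' : ContinuousOn g' (Icc 0 T)) : ContDiffOn ℝ 1 g (Icc 0 T) := by
  rw [contDiffOn_one_iff_derivWithin (uniqueDiffOn_Icc hT)]
  refine ⟨fun t ht => (hg t ht).differentiableWithinAt, hg'.congr fun t ht => ?_⟩
  exact (hg t ht).derivWithin (uniqueDiffOn_Icc hT t ht)

lemma eq_add_prim_of_hasDerivWithinAt {T : ℝ} {g g' : ℝ → ℝ}
    (hg : ∀ t ∈ Icc 0 T, HasDerivWithinAt g (g' t) (Icc 0 T) t)
    (hg' : ContinuousOn g' (Icc 0 T)) {x : ℝ} (hx : x ∈ Icc 0 T) : g x = g 0 + prim g' x := by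
  have hs : Icc 0 x ⊆ Icc 0 T := Icc_subset_Icc_right hx.2
  have : ∫ t in (0 : ℝ)..x, g' t = g x - g 0 := by
    refine intervalIntegral.integral_eq_sub_of_hasDerivAt_of_le hx.1
      (fun t ht => ((hg t (hs ht)).continuousWithinAt).mono hs) (fun t ht => ?_) ?_
    · exact (hg t ⟨ht.1.le, ht.2.le.trans hx.2⟩).hasDerivAt
        (Icc_mem_nhds ht.1 (ht.2.trans_le hx.2))
    · refine ContinuousOn.intervalIntegrable ?_
      rw [uIcc_of_le hx.1]
      exact hg'.mono hs
  rw [prim, this]; ring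

/-- Along the exact solution, `f` differs from its linearization in `(u, u')` by a quadratic term,
globally in the increments. The Lipschitz condition controls the linearization error for large
increments, where the second derivatives of `f` are not bounded, and the mean value inequality
controls it for small ones. The coefficient `β` of `u'` is continuously differentiable in `t`. -/
lemma exists_linearization {T L : ℝ} (hT : 0 < T) (hL : 0 < L) {f : ℝ → ℝ → ℝ → ℝ}
    (hLip : UniformLipschitz T L f)
    (hf : ContDiffOn ℝ 2 (fun p : ℝ × ℝ × ℝ => f p.1 p.2.1 p.2.2)
      (Icc 0 T ×ˢ (univ : Set (ℝ × ℝ)))) {u v : ℝ → ℝ}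
    (hu : ∀ t ∈ Icc 0 T, HasDerivWithinAt u (v t) (Icc 0 T) t)
    (hv : ∀ t ∈ Icc 0 T, HasDerivWithinAt v (f t (u t) (v t)) (Icc 0 T) t) :
    ∃ (M : ℝ) (α β β' : ℝ → ℝ), 0 ≤ M ∧ ContinuousOn α (Icc 0 T) ∧ ContinuousOn β (Icc 0 T) ∧
      ContinuousOn β' (Icc 0 T) ∧
      (∀ t ∈ Icc 0 T, |α t| ≤ M) ∧ (∀ t ∈ Icc 0 T, |β t| ≤ M) ∧ (∀ t ∈ Icc 0 T, |β' t| ≤ M) ∧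
      (∀ t ∈ Icc 0 T, β t = β 0 + prim β' t) ∧
      ∀ t ∈ Icc 0 T, ∀ x y : ℝ,
        |f t (u t) (v t) - f t x y - α t * (u t - x) - β t * (v t - y)| ≤
          M * ((u t - x) ^ 2 + (v t - y) ^ 2) := by
  set S : Set (ℝ × ℝ × ℝ) := Icc 0 T ×ˢ (univ : Set (ℝ × ℝ)) with hS
  set F : ℝ × ℝ × ℝ → ℝ := fun p => f p.1 p.2.1 p.2.2 with hF
  have hSu : UniqueDiffOn ℝ S := (uniqueDiffOn_Icc hT).prod uniqueDiffOn_univ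
  set D : ℝ × ℝ × ℝ → (ℝ × ℝ × ℝ →L[ℝ] ℝ) := fderivWithin ℝ F S with hD
  have hD1 : ContDiffOn ℝ 1 D S := hf.fderivWithin hSu (by norm_num)
  have huc : ContinuousOn u (Icc 0 T) := fun t ht => (hu t ht).continuousWithinAt
  have hvc : ContinuousOn v (Icc 0 T) := fun t ht => (hv t ht).continuousWithinAt
  set γ : ℝ → ℝ × ℝ × ℝ := fun t => (t, u t, v t) with hγ
  have hγS : MapsTo γ (Icc 0 T) S := fun t ht => ⟨ht, mem_univ _⟩
  have hγc : ContinuousOn γ (Icc 0 T) := continuousOn_id.prodMk (huc.prodMk hvc)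
  have hFγ : ContinuousOn (fun t => f t (u t) (v t)) (Icc 0 T) := hf.continuousOn.comp hγc hγS
  have hγ1 : ContDiffOn ℝ 1 γ (Icc 0 T) :=
    contDiffOn_id.prodMk ((contDiffOn_one_of_hasDerivWithinAt hT hu hvc).prodMk
      (contDiffOn_one_of_hasDerivWithinAt hT hv hFγ))
  have hDγ : ContDiffOn ℝ 1 (fun t => D (γ t)) (Icc 0 T) := hD1.comp hγ1 hγS
  set α : ℝ → ℝ := fun t => D (γ t) (0, 1, 0) with hα
  set β : ℝ → ℝ := fun t => D (γ t) (0, 0, 1) with hβ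
  have hα1 : ContDiffOn ℝ 1 α (Icc 0 T) := hDγ.clm_apply contDiffOn_const
  have hβ1 : ContDiffOn ℝ 1 β (Icc 0 T) := hDγ.clm_apply contDiffOn_const
  set β' : ℝ → ℝ := derivWithin β (Icc 0 T) with hβ'
  have hβ'c : ContinuousOn β' (Icc 0 T) :=
    hβ1.continuousOn_derivWithin (uniqueDiffOn_Icc hT) le_rfl
  have hβd : ∀ t ∈ Icc 0 T, HasDerivWithinAt β (β' t) (Icc 0 T) t := fun t ht =>
    (hβ1.differentiableOn one_ne_zero t ht).hasDerivWithinAt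
  obtain ⟨Mα, hMα⟩ := isCompact_Icc.exists_bound_of_continuousOn hα1.continuousOn
  obtain ⟨Mβ, hMβ⟩ := isCompact_Icc.exists_bound_of_continuousOn hβ1.continuousOn
  obtain ⟨Mβ', hMβ'⟩ := isCompact_Icc.exists_bound_of_continuousOn hβ'c
  obtain ⟨Mu, hMu⟩ := isCompact_Icc.exists_bound_of_continuousOn huc
  obtain ⟨Mv, hMv⟩ := isCompact_Icc.exists_bound_of_continuousOn hvc
  -- a compact convex neighbourhood of the trajectory
  set K : Set (ℝ × ℝ × ℝ) := Icc 0 T ×ˢ (Icc (-Mu - 1) (Mu + 1) ×ˢ Icc (-Mv - 1) (Mv + 1)) with hK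
  have hKc : IsCompact K := isCompact_Icc.prod (isCompact_Icc.prod isCompact_Icc)
  have hKconv : Convex ℝ K := (convex_Icc _ _).prod ((convex_Icc _ _).prod (convex_Icc _ _))
  have hKS : K ⊆ S := prod_mono le_rfl (subset_univ _)
  obtain ⟨B, hB⟩ := hKc.exists_bound_of_continuousOn
    ((hD1.continuousOn_fderivWithin hSu le_rfl).mono hKS)
  have hDL : ∀ p ∈ K, ∀ p' ∈ K, ‖D p' - D p‖ ≤ B * ‖p' - p‖ := by
    intro p hp p' hp'
    refine hKconv.norm_image_sub_le_of_norm_hasFDerivWithin_le (fun x hx => ?_) hB hp hp'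
    exact (hD1.differentiableOn one_ne_zero x (hKS hx)).hasFDerivWithinAt.mono hKS
  have ht0 : (0 : ℝ) ∈ Icc 0 T := ⟨le_rfl, hT.le⟩
  have hMα0 : 0 ≤ Mα := (norm_nonneg _).trans (hMα 0 ht0)
  have hMβ0 : 0 ≤ Mβ := (norm_nonneg _).trans (hMβ 0 ht0)
  have hMβ'0 : 0 ≤ Mβ' := (norm_nonneg _).trans (hMβ' 0 ht0)
  have hMu0 : 0 ≤ Mu := (norm_nonneg _).trans (hMu 0 ht0)
  have hMv0 : 0 ≤ Mv := (norm_nonneg _).trans (hMv 0 ht0)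
  have hB0 : 0 ≤ B := (norm_nonneg _).trans (hB (0, 0, 0) ⟨ht0, ⟨by constructor <;> simp <;> linarith,
    by constructor <;> simp <;> linarith⟩⟩)
  set M := 2 * (L + Mα + Mβ) + Mβ' + B with hM
  refine ⟨M, α, β, β', by positivity, hα1.continuousOn, hβ1.continuousOn, hβ'c,
    fun t ht => (hMα t ht).trans (by rw [hM]; linarith),
    fun t ht => (hMβ t ht).trans (by rw [hM]; linarith),
    fun t ht => (hMβ' t ht).trans (by rw [hM]; linarith),
    fun t ht => eq_add_prim_of_hasDerivWithinAt hβd hβ'c ht, fun t ht x y => ?_⟩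
  set dx := u t - x with hdx
  set dy := v t - y with hdy
  have hsq : 0 ≤ dx ^ 2 + dy ^ 2 := by positivity
  by_cases hsmall : |dx| ≤ 1 ∧ |dy| ≤ 1
  · have hu' := abs_le.mp (hMu t ht)
    have hv' := abs_le.mp (hMv t ht)
    have hx' := abs_le.mp hsmall.1
    have hy' := abs_le.mp hsmall.2
    have hpK : γ t ∈ K := ⟨ht, ⟨⟨by simp only [hγ]; linarith, by simp only [hγ]; linarith⟩,
      ⟨by simp only [hγ]; linarith, by simp only [hγ]; linarith⟩⟩⟩
    have hqK : (t, x, y) ∈ K := ⟨ht, ⟨⟨by simp only; linarith, by simp only; linarith⟩,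
      ⟨by simp only; linarith, by simp only; linarith⟩⟩⟩
    set q : ℝ × ℝ × ℝ := (t, x, y) with hq
    have hsub : q - γ t = (0, -dx, -dy) := by
      simp [hq, hγ, hdx, hdy]
    -- mean value inequality on the part of the neighbourhood where the derivative differs from
    -- `D (γ t)` by at most `B * ‖q - γ t‖`
    have hmv := (hKconv.inter (convex_closedBall (γ t) ‖q - γ t‖)).norm_image_sub_le_of_norm_hasFDerivWithin_le'
      (f := F) (f' := D) (φ := D (γ t)) (C := B * ‖q - γ t‖) (x := γ t) (y := q)
      (fun z hz => ((hf.differentiableOn two_ne_zero z (hKS hz.1)).hasFDerivWithinAt).mono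
        (inter_subset_left.trans hKS))
      (fun z hz => (hDL _ hpK _ hz.1).trans (by
        gcongr
        rw [← dist_eq_norm]; exact hz.2))
      ⟨hpK, Metric.mem_closedBall_self (norm_nonneg _)⟩
      ⟨hqK, by rw [Metric.mem_closedBall, dist_eq_norm]⟩
    have hDe : D (γ t) (q - γ t) = -(α t * dx) - β t * dy := by
      have : ((0, -dx, -dy) : ℝ × ℝ × ℝ) = (-dx) • (0, 1, 0) + (-dy) • (0, 0, 1) := by
        simp
      rw [hsub, this, map_add, map_smul, map_smul, smul_eq_mul, smul_eq_mul]
      ring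
    have hnorm : ‖q - γ t‖ ^ 2 ≤ dx ^ 2 + dy ^ 2 := by
      rw [hsub, Prod.norm_def, Prod.norm_def]
      simp only [norm_zero, norm_neg, Real.norm_eq_abs]
      rw [max_eq_right (le_max_of_le_left (abs_nonneg _))]
      rcases le_total |dx| |dy| with hle | hle
      · rw [max_eq_right hle, sq_abs]; nlinarith [sq_nonneg dx]
      · rw [max_eq_left hle, sq_abs]; nlinarith [sq_nonneg dy]
    rw [hDe, Real.norm_eq_abs] at hmv
    have e : f t (u t) (v t) - f t x y - α t * dx - β t * dy =
        -(F q - F (γ t) - (-(α t * dx) - β t * dy)) := by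
      simp only [hF, hq, hγ]; ring
    rw [e, abs_neg]
    calc _ ≤ B * ‖q - γ t‖ * ‖q - γ t‖ := hmv
      _ = B * ‖q - γ t‖ ^ 2 := by ring
      _ ≤ B * (dx ^ 2 + dy ^ 2) := by gcongr
      _ ≤ M * (dx ^ 2 + dy ^ 2) := by
        gcongr
        rw [hM]; linarith
  · have hlin : |dx| + |dy| ≤ 2 * (dx ^ 2 + dy ^ 2) := by
      rw [← sq_abs dx, ← sq_abs dy]
      have h1 := abs_nonneg dx
      have h2 := abs_nonneg dy
      rw [not_and_or, not_le, not_le] at hsmall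
      rcases hsmall with h | h
      · nlinarith [sq_nonneg (|dx| - 2 * |dy|), sq_nonneg (|dy| - 1 / 4)]
      · nlinarith [sq_nonneg (|dy| - 2 * |dx|), sq_nonneg (|dx| - 1 / 4)]
    have h1 := hLip t ht (u t) (v t) x y
    have h2 : |α t * dx| ≤ Mα * |dx| := by
      rw [abs_mul]; gcongr; exact hMα t ht
    have h3 : |β t * dy| ≤ Mβ * |dy| := by
      rw [abs_mul]; gcongr; exact hMβ t ht
    have h4 : |f t (u t) (v t) - f t x y - α t * dx - β t * dy| ≤
        |f t (u t) (v t) - f t x y| + |α t * dx| + |β t * dy| :=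
      (abs_sub _ _).trans (by gcongr; exact abs_sub _ _)
    have h5 := abs_nonneg dx
    have h6 := abs_nonneg dy
    calc _ ≤ L * (|dx| + |dy|) + Mα * |dx| + Mβ * |dy| := h4.trans (by gcongr)
      _ ≤ (L + Mα + Mβ) * (|dx| + |dy|) := by nlinarith
      _ ≤ (L + Mα + Mβ) * (2 * (dx ^ 2 + dy ^ 2)) := by gcongr
      _ ≤ M * (dx ^ 2 + dy ^ 2) := by rw [hM]; nlinarith

end CPG

namespace CPG

open Polynomial

/-! ### Piecewise functions on a mesh -/

namespace Mesh

variable {T : ℝ} (P : Mesh T)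

lemma left_lt_right (n : Fin P.N) : P.left n < P.right n :=
  P.strictMono (Fin.castSucc_lt_succ)

lemma step_pos (n : Fin P.N) : 0 < P.step n := sub_pos.mpr (P.left_lt_right n)

lemma node_nonneg (j : Fin (P.N + 1)) : 0 ≤ P.node j := by
  rw [← P.first]; exact P.strictMono.monotone (Fin.zero_le j)

lemma node_le (j : Fin (P.N + 1)) : P.node j ≤ T :=
  (P.strictMono.monotone (Fin.le_last j)).trans_eq P.last

lemma left_nonneg (n : Fin P.N) : 0 ≤ P.left n := P.node_nonneg _

lemma right_le (n : Fin P.N) : P.right n ≤ T := P.node_le _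

lemma nonneg (P : Mesh T) : 0 ≤ T :=
  (P.node_nonneg (Fin.last P.N)).trans (P.node_le _)

lemma N_pos (hT : 0 < T) : 0 < P.N := by
  rcases Nat.eq_zero_or_pos P.N with h | h
  · exfalso
    have : Fin.last P.N = 0 := Fin.ext (by simp [h])
    have h1 := P.last
    rw [this, P.first] at h1
    exact hT.ne h1
  · exact h

lemma Ioo_subset (n : Fin P.N) : Ioo (P.left n) (P.right n) ⊆ Ioo 0 T :=
  Ioo_subset_Ioo (P.left_nonneg n) (P.right_le n)

lemma Icc_subset (n : Fin P.N) : Icc (P.left n) (P.right n) ⊆ Icc 0 T :=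
  Icc_subset_Icc (P.left_nonneg n) (P.right_le n)

lemma uIcc_subset (n : Fin P.N) : uIcc (P.left n) (P.right n) ⊆ uIcc 0 T := by
  rw [uIcc_of_le (P.left_lt_right n).le, uIcc_of_le P.nonneg]
  exact P.Icc_subset n

lemma right_le_left {n m : Fin P.N} (h : n < m) : P.right n ≤ P.left m :=
  P.strictMono.monotone (Fin.le_def.mpr (by
    have := Fin.lt_def.mp h; simp only [Fin.val_succ, Fin.val_castSucc]; omega))

lemma eq_of_mem {n m : Fin P.N} {t : ℝ} (hn : t ∈ Ioo (P.left n) (P.right n))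
    (hm : t ∈ Ioo (P.left m) (P.right m)) : n = m := by
  rcases lt_trichotomy n m with h | h | h
  · exact absurd (P.right_le_left h) (by linarith [hn.2, hm.1])
  · exact h
  · exact absurd (P.right_le_left h) (by linarith [hn.1, hm.2])

lemma exists_mem_Ioo {t : ℝ} (ht : t ∈ Ioo 0 T) (hn : t ∉ range P.node) :
    ∃ n, t ∈ Ioo (P.left n) (P.right n) := by
  have key : ∀ j : Fin (P.N + 1), t < P.node j → ∃ n, t ∈ Ioo (P.left n) (P.right n) := by
    intro j
    induction j using Fin.induction with
    | zero => intro h; rw [P.first] at h; exact absurd h ht.1.not_gt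
    | succ i ih =>
      intro h
      by_cases h' : t < P.node i.castSucc
      · exact ih h'
      · refine ⟨i, lt_of_le_of_ne (not_lt.mp h') fun he => hn ⟨_, he⟩, h⟩
  exact key (Fin.last _) (by rw [P.last]; exact ht.2)

lemma sum_integral {h : ℝ → ℝ} (hh : IntervalIntegrable h volume 0 T) :
    ∑ n, ∫ t in P.left n..P.right n, h t = ∫ t in (0 : ℝ)..T, h t := by
  have hi : ∀ j, IntervalIntegrable h volume 0 (P.node j) := fun j => hh.mono_set (by
    rw [uIcc_of_le (P.node_nonneg j), uIcc_of_le P.nonneg]; exact Icc_subset_Icc_right (P.node_le j))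
  have h1 : ∀ n, ∫ t in P.left n..P.right n, h t =
      (∫ t in (0 : ℝ)..P.node n.succ, h t) - ∫ t in (0 : ℝ)..P.node n.castSucc, h t := fun n =>
    (intervalIntegral.integral_interval_sub_left (hi _) (hi _)).symm
  have h2 := Fin.sum_univ_succ (fun j : Fin (P.N + 1) => ∫ t in (0 : ℝ)..P.node j, h t)
  have h3 := Fin.sum_univ_castSucc (fun j : Fin (P.N + 1) => ∫ t in (0 : ℝ)..P.node j, h t)
  rw [P.first, intervalIntegral.integral_same] at h2
  rw [P.last] at h3
  rw [Finset.sum_congr rfl fun n _ => h1 n, Finset.sum_sub_distrib]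
  linarith

lemma memLp_local {h : ℝ → ℝ} (hh : MemLp h 2 (volume.restrict (Ioo 0 T))) (n : Fin P.N) :
    MemLp h 2 (volume.restrict (Ioo (P.left n) (P.right n))) :=
  hh.mono_measure (Measure.restrict_mono (P.Ioo_subset n) le_rfl)

/-- The piecewise polynomial with the given pieces (and value zero at the nodes). -/
noncomputable def glue (q : Fin P.N → ℝ[X]) : ℝ → ℝ := fun t =>
  ∑ n, (Ioo (P.left n) (P.right n)).indicator (fun t => (q n).eval t) t

lemma glue_eq (q : Fin P.N → ℝ[X]) {n : Fin P.N} {t : ℝ} (ht : t ∈ Ioo (P.left n) (P.right n)) :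
    P.glue q t = (q n).eval t := by
  rw [glue, Finset.sum_eq_single n]
  · rw [indicator_of_mem ht]
  · intro m _ hm
    exact indicator_of_notMem (fun h => hm (P.eq_of_mem h ht)) _
  · simp

lemma glue_memLp (q : Fin P.N → ℝ[X]) (p : ℝ≥0∞) :
    MemLp (P.glue q) p (volume.restrict (Ioo 0 T)) := by
  refine memLp_finsetSum _ fun n _ => ?_
  refine MemLp.indicator measurableSet_Ioo ?_
  obtain ⟨C, hC⟩ := isCompact_Icc.exists_bound_of_continuousOn (s := Icc 0 T)
    (q n).continuous.continuousOn
  refine MemLp.of_bound (q n).continuous.aestronglyMeasurable C ?_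
  filter_upwards [ae_restrict_mem measurableSet_Ioo] with t ht
  exact hC t (Ioo_subset_Icc_self ht)

lemma integral_congr_piece {f g : ℝ → ℝ} (n : Fin P.N)
    (h : ∀ t ∈ Ioo (P.left n) (P.right n), f t = g t) :
    ∫ t in P.left n..P.right n, f t = ∫ t in P.left n..P.right n, g t := by
  rw [intervalIntegral.integral_of_le (P.left_lt_right n).le,
    intervalIntegral.integral_of_le (P.left_lt_right n).le,
    integral_Ioc_eq_integral_Ioo, integral_Ioc_eq_integral_Ioo]
  exact setIntegral_congr_fun measurableSet_Ioo h

lemma prim_node_eq_zero {η : ℝ → ℝ} (hη : IntervalIntegrable η volume 0 T)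
    (h0 : ∀ n, ∫ t in P.left n..P.right n, η t = 0) (j : Fin (P.N + 1)) :
    prim η (P.node j) = 0 := by
  have hi : ∀ j, IntervalIntegrable η volume 0 (P.node j) := fun j => hη.mono_set (by
    rw [uIcc_of_le (P.node_nonneg j), uIcc_of_le P.nonneg]; exact Icc_subset_Icc_right (P.node_le j))
  induction j using Fin.induction with
  | zero => rw [P.first]; simp [prim]
  | succ n ih =>
    have := intervalIntegral.integral_interval_sub_left (hi n.succ) (hi n.castSucc)
    have h1 := h0 n
    rw [left, right] at h1
    rw [h1, sub_eq_zero] at this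
    rw [prim, this]
    exact ih

lemma prim_eq_local {η : ℝ → ℝ} (hη : IntervalIntegrable η volume 0 T)
    (h0 : ∀ n, ∫ t in P.left n..P.right n, η t = 0) (n : Fin P.N) {x : ℝ}
    (hx : x ∈ Icc (P.left n) (P.right n)) : prim η x = ∫ t in P.left n..x, η t := by
  have hs : ∀ y ∈ Icc 0 T, IntervalIntegrable η volume 0 y := fun y hy => hη.mono_set (by
    rw [uIcc_of_le hy.1, uIcc_of_le P.nonneg]; exact Icc_subset_Icc_right hy.2)
  have h1 := hs x (P.Icc_subset n hx)
  have h2 := hs (P.left n) (P.Icc_subset n ⟨le_rfl, (P.left_lt_right n).le⟩)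
  rw [← intervalIntegral.integral_interval_sub_left h1 h2]
  have := P.prim_node_eq_zero hη h0 n.castSucc
  rw [prim] at this
  rw [left, this, sub_zero, prim]

/-- `η` is orthogonal, on each subinterval, to the polynomials of degree less than `d n`. -/
def Orth (d : Fin P.N → ℕ) (η : ℝ → ℝ) : Prop :=
  ∀ n, ∀ s ∈ degreeLT ℝ (d n), ∫ t in P.left n..P.right n, η t * s.eval t = 0

lemma Orth.integral_eq_zero {P : Mesh T} {d : Fin P.N → ℕ} {η : ℝ → ℝ} (h : P.Orth d η)
    (hd : ∀ n, 1 ≤ d n) (n : Fin P.N) : ∫ t in P.left n..P.right n, η t = 0 := by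
  have := h n 1 (by
    rw [mem_degreeLT]; exact degree_one_le.trans_lt (by exact_mod_cast hd n))
  simpa using this

/-- Antiderivatives of piecewise orthogonal functions are small. -/
lemma Orth.wsq_prim_le {P : Mesh T} {d : Fin P.N → ℕ} {η : ℝ → ℝ} (h : P.Orth d η)
    (hd : ∀ n, 1 ≤ d n) (hη : MemLp η 2 (volume.restrict (Ioo 0 T))) {A : ℝ}
    (hA : ∀ n, P.step n / (2 * d n) ≤ A) : wsq T 0 (prim η) ≤ A ^ 2 * wsq T 0 η := by
  have hT := P.nonneg
  have hηi := memLp_two_intervalIntegrable hT hη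
  have h0 := h.integral_eq_zero hd
  have hp := prim_memLp hT hη
  have i1 := wsq_integrable (l := 0) hT hp
  have i2 := wsq_integrable (l := 0) hT hη
  rw [wsq, wsq, ← P.sum_integral i1, ← P.sum_integral i2, Finset.mul_sum]
  refine Finset.sum_le_sum fun n _ => ?_
  have hloc := integral_primitive_sq_le (P.left_lt_right n) (hd n) (P.memLp_local hη n) (h n)
  simp only [neg_zero, zero_mul, Real.exp_zero, one_mul]
  have e : ∫ t in P.left n..P.right n, prim η t ^ 2 =
      ∫ x in P.left n..P.right n, (∫ t in P.left n..x, η t) ^ 2 :=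
    P.integral_congr_piece n fun t ht => by
      rw [P.prim_eq_local hηi h0 n (Ioo_subset_Icc_self ht)]
  rw [e]
  refine hloc.2.trans ?_
  have hnn : 0 ≤ ∫ x in P.left n..P.right n, η x ^ 2 :=
    intervalIntegral.integral_nonneg (P.left_lt_right n).le fun x _ => sq_nonneg _
  have : 0 ≤ P.step n / (2 * d n) := div_nonneg (P.step_pos n).le (by positivity)
  gcongr
  exact hA n

/-- Antiderivatives of piecewise orthogonal functions are piecewise orthogonal, with one degree
less. -/
lemma Orth.prim {P : Mesh T} {d : Fin P.N → ℕ} {η : ℝ → ℝ} (h : P.Orth (fun n => d n + 1) η)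
    (hη : MemLp η 2 (volume.restrict (Ioo 0 T))) : P.Orth d (prim η) := by
  intro n s hs
  have hT := P.nonneg
  have hηi := memLp_two_intervalIntegrable hT hη
  have h0 := h.integral_eq_zero (fun n => Nat.le_add_left 1 _)
  have hlr := (P.left_lt_right n).le
  obtain ⟨S, hS, hSe⟩ := exists_antiderivative (a := P.left n) s 0
  have hSd : S ∈ degreeLT ℝ (d n + 1) := by
    rw [mem_degreeLT, degree_lt_iff_coeff_zero]
    intro j hj
    obtain ⟨j, rfl⟩ : ∃ i, j = i + 1 := ⟨j - 1, by omega⟩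
    have h1 : s.coeff j = 0 := by
      rw [mem_degreeLT] at hs
      exact coeff_eq_zero_of_degree_lt (lt_of_lt_of_le hs (by exact_mod_cast (by omega : d n ≤ j)))
    rw [← hS, coeff_derivative] at h1
    have : (j : ℝ) + 1 ≠ 0 := by positivity
    exact (mul_eq_zero.mp h1).resolve_right this
  have key := integral_mul_primitive hlr (hηi.mono_set (P.uIcc_subset n))
    (s.continuous.intervalIntegrable (P.left n) (P.right n)) 0 0
  have e1 : ∫ x in P.left n..P.right n, η x * (0 + ∫ t in P.left n..x, s.eval t) =
      ∫ x in P.left n..P.right n, η x * S.eval x := by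
    congr 1; ext x; rw [hSe]
  rw [e1, h n S hSd, h0 n] at key
  simp only [zero_add, zero_mul, mul_zero, sub_zero, zero_sub] at key
  rw [P.integral_congr_piece n (g := fun x => (∫ t in P.left n..x, η t) * s.eval x)
    fun t ht => by rw [P.prim_eq_local hηi h0 n (Ioo_subset_Icc_self ht)]]
  linarith

/-- Piecewise Pythagoras for a piecewise projection. -/
lemma pythagoras {d : Fin P.N → ℕ} {g : ℝ → ℝ} (hg : MemLp g 2 (volume.restrict (Ioo 0 T)))
    {q : Fin P.N → ℝ[X]} (hq : ∀ n, IsProj (P.left n) (P.right n) (d n) g (q n)) (n : Fin P.N) :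
    ∫ t in P.left n..P.right n, g t ^ 2 = (∫ t in P.left n..P.right n, P.glue q t ^ 2) +
      ∫ t in P.left n..P.right n, (g t - P.glue q t) ^ 2 := by
  have hlr := (P.left_lt_right n).le
  have hG := P.memLp_local (P.glue_memLp q 2) n
  have hζ : MemLp (fun t => g t - P.glue q t) 2
      (volume.restrict (Ioo (P.left n) (P.right n))) := (P.memLp_local hg n).sub hG
  have i1 : IntervalIntegrable (fun t => P.glue q t ^ 2) volume (P.left n) (P.right n) := by
    simpa only [sq] using memLp_two_intervalIntegrable_sq hlr hG hG
  have i2 : IntervalIntegrable (fun t => (g t - P.glue q t) ^ 2) volume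
      (P.left n) (P.right n) := by
    simpa only [sq] using memLp_two_intervalIntegrable_sq hlr hζ hζ
  have i3 := memLp_two_intervalIntegrable_sq hlr hζ hG
  have h0 : ∫ t in P.left n..P.right n, (g t - P.glue q t) * P.glue q t = 0 := by
    rw [← (hq n).2 (q n) (hq n).1]
    exact P.integral_congr_piece n fun t ht => by rw [P.glue_eq q ht]
  have e : (fun t => g t ^ 2) = fun t => P.glue q t ^ 2 + (g t - P.glue q t) ^ 2 +
      2 * ((g t - P.glue q t) * P.glue q t) := by
    ext t; ring
  rw [e, intervalIntegral.integral_add (i1.add i2) (i3.const_mul 2),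
    intervalIntegral.integral_add i1 i2, intervalIntegral.integral_const_mul, h0]
  ring

lemma wsq_sub_glue_le {d : Fin P.N → ℕ} {g : ℝ → ℝ} (hg : MemLp g 2 (volume.restrict (Ioo 0 T)))
    {q : Fin P.N → ℝ[X]} (hq : ∀ n, IsProj (P.left n) (P.right n) (d n) g (q n)) :
    wsq T 0 (fun t => g t - P.glue q t) ≤ wsq T 0 g := by
  have hζ : MemLp (fun t => g t - P.glue q t) 2 (volume.restrict (Ioo 0 T)) :=
    hg.sub (P.glue_memLp q 2)
  rw [wsq, wsq, ← P.sum_integral (wsq_integrable P.nonneg hg),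
    ← P.sum_integral (wsq_integrable P.nonneg hζ)]
  refine Finset.sum_le_sum fun n _ => ?_
  simp only [neg_zero, zero_mul, Real.exp_zero, one_mul]
  rw [P.pythagoras hg hq n]
  have : 0 ≤ ∫ t in P.left n..P.right n, P.glue q t ^ 2 :=
    intervalIntegral.integral_nonneg (P.left_lt_right n).le fun x _ => sq_nonneg _
  linarith

/-- The piecewise projection is stable in weighted norms if the weight varies at most by the factor
`exp 1` on each subinterval. -/
lemma wsq_glue_le {d : Fin P.N → ℕ} {g : ℝ → ℝ} (hg : MemLp g 2 (volume.restrict (Ioo 0 T)))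
    {q : Fin P.N → ℝ[X]} (hq : ∀ n, IsProj (P.left n) (P.right n) (d n) g (q n)) {l : ℝ}
    (hl : 0 ≤ l) (hstep : ∀ n, l * P.step n ≤ 1) :
    wsq T l (P.glue q) ≤ 3 * wsq T l g := by
  have hGm := P.glue_memLp q 2
  have i1 := wsq_integrable (l := l) P.nonneg hg
  have i2 := wsq_integrable (l := l) P.nonneg hGm
  rw [wsq, wsq, ← P.sum_integral i1, ← P.sum_integral i2, Finset.mul_sum]
  refine Finset.sum_le_sum fun n _ => ?_
  have hlr := (P.left_lt_right n).le
  have j1 := i1.mono_set (P.uIcc_subset n)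
  have j2 := i2.mono_set (P.uIcc_subset n)
  have k1 : IntervalIntegrable (fun t => g t ^ 2) volume (P.left n) (P.right n) := by
    have := P.memLp_local hg n
    simpa only [sq] using memLp_two_intervalIntegrable_sq hlr this this
  have k2 : IntervalIntegrable (fun t => P.glue q t ^ 2) volume (P.left n) (P.right n) := by
    have := P.memLp_local hGm n
    simpa only [sq] using memLp_two_intervalIntegrable_sq hlr this this
  have hpyth : ∫ t in P.left n..P.right n, P.glue q t ^ 2 ≤
      ∫ t in P.left n..P.right n, g t ^ 2 := by
    rw [P.pythagoras hg hq n]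
    have : 0 ≤ ∫ t in P.left n..P.right n, (g t - P.glue q t) ^ 2 :=
      intervalIntegral.integral_nonneg hlr fun x _ => sq_nonneg _
    linarith
  have hexp : Real.exp 1 ≤ 3 := Real.exp_one_lt_three.le
  calc ∫ t in P.left n..P.right n, Real.exp (-l * t) * P.glue q t ^ 2
      ≤ ∫ t in P.left n..P.right n, Real.exp (-l * P.left n) * P.glue q t ^ 2 := by
        refine intervalIntegral_mono_Ioo hlr j2 (k2.const_mul _) fun t ht => ?_
        gcongr ?_ * _
        exact Real.exp_le_exp.mpr (by nlinarith [ht.1])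
    _ = Real.exp (-l * P.left n) * ∫ t in P.left n..P.right n, P.glue q t ^ 2 :=
        intervalIntegral.integral_const_mul _ _
    _ ≤ Real.exp (-l * P.left n) * ∫ t in P.left n..P.right n, g t ^ 2 := by gcongr
    _ = ∫ t in P.left n..P.right n, Real.exp (-l * P.left n) * g t ^ 2 :=
        (intervalIntegral.integral_const_mul _ _).symm
    _ ≤ ∫ t in P.left n..P.right n, 3 * (Real.exp (-l * t) * g t ^ 2) := by
        refine intervalIntegral_mono_Ioo hlr (k1.const_mul _) (j1.const_mul _) fun t ht => ?_
        rw [← mul_assoc]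
        gcongr ?_ * _
        have h1 := hstep n
        rw [step] at h1
        calc Real.exp (-l * P.left n) ≤ Real.exp (1 + -l * t) :=
              Real.exp_le_exp.mpr (by nlinarith [ht.2])
          _ = Real.exp 1 * Real.exp (-l * t) := Real.exp_add _ _
          _ ≤ _ := by gcongr
    _ = _ := intervalIntegral.integral_const_mul _ _

/-! ### The discrete solution -/

lemma mem_degreeLT_of_natDegree_le {p : ℝ[X]} {r : ℕ} (h : p.natDegree ≤ r) :
    p ∈ degreeLT ℝ (r + 1) := by
  rw [mem_degreeLT]
  exact lt_of_le_of_lt degree_le_natDegree (by exact_mod_cast Nat.lt_succ_of_le h)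

lemma natDegree_le_of_mem_degreeLT {p : ℝ[X]} {r : ℕ} (h : p ∈ degreeLT ℝ (r + 1)) :
    p.natDegree ≤ r := by
  rw [mem_degreeLT] at h
  exact natDegree_le_of_degree_le (Order.le_of_lt_succ (by exact_mod_cast h))

/-- The second derivative of a Petrov-Galerkin solution is, on each subinterval, the
`L²`-projection of the right-hand side. -/
lemma IsCPGSolution.exists_pieces {P : Mesh T} {r : Fin P.N → ℕ} (hr : ∀ n, 3 ≤ r n)
    {f : ℝ → ℝ → ℝ → ℝ} {u₀ u₁ : ℝ} {U : ℝ → ℝ} (h : P.IsCPGSolution r f u₀ u₁ U) :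
    ∃ w : Fin P.N → ℝ[X],
      (∀ n, ∀ t ∈ Ioo (P.left n) (P.right n),
        HasDerivAt (derivWithin U (Icc 0 T)) ((w n).eval t) t) ∧
      ∀ n, IsProj (P.left n) (P.right n) (r n - 1)
        (fun t => f t (U t) (derivWithin U (Icc 0 T) t)) (w n) := by
  obtain ⟨⟨-, hU1, hUp⟩, -, -, htest⟩ := h
  choose p hpd hp using hUp
  have hder : ∀ n, ∀ t ∈ Ioo (P.left n) (P.right n), deriv U t = (derivative (p n)).eval t := by
    intro n t ht
    have : U =ᶠ[nhds t] fun t => (p n).eval t := by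
      filter_upwards [isOpen_Ioo.mem_nhds ht] with x hx
      exact hp n x hx
    rw [this.deriv_eq, Polynomial.deriv]
  have hder2 : ∀ n, ∀ t ∈ Ioo (P.left n) (P.right n),
      deriv (deriv U) t = (derivative (derivative (p n))).eval t := by
    intro n t ht
    have : deriv U =ᶠ[nhds t] fun t => (derivative (p n)).eval t := by
      filter_upwards [isOpen_Ioo.mem_nhds ht] with x hx
      exact hder n x hx
    rw [this.deriv_eq, Polynomial.deriv]
  have hdW : ∀ n, ∀ t ∈ Ioo (P.left n) (P.right n), derivWithin U (Icc 0 T) t = deriv U t := by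
    intro n t ht
    have ht' := P.Ioo_subset n ht
    exact derivWithin_of_mem_nhds (Icc_mem_nhds ht'.1 ht'.2)
  refine ⟨fun n => derivative (derivative (p n)), fun n t ht => ?_, fun n => ⟨?_, fun s hs => ?_⟩⟩
  · have : derivWithin U (Icc 0 T) =ᶠ[nhds t] fun t => (derivative (p n)).eval t := by
      filter_upwards [isOpen_Ioo.mem_nhds ht] with x hx
      rw [hdW n x hx, hder n x hx]
    exact ((derivative (p n)).hasDerivAt t).congr_of_eventuallyEq this
  · have h1 : (derivative (derivative (p n))).natDegree ≤ r n - 2 := by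
      have h2 := natDegree_derivative_le (p n)
      have h3 := natDegree_derivative_le (derivative (p n))
      have h4 := hpd n
      omega
    have := mem_degreeLT_of_natDegree_le h1
    rwa [show r n - 2 + 1 = r n - 1 by have := hr n; omega] at this
  · set φ : ℝ → ℝ := (Ioo (P.left n) (P.right n)).indicator fun t => s.eval t with hφ
    have hφt : P.MemTest r φ := by
      constructor
      · exact (poly_memLp_two s).indicator measurableSet_Ioo
      · intro m
        by_cases hmn : m = n
        · subst hmn
          refine ⟨s, ?_, fun t ht => by rw [hφ, indicator_of_mem ht]⟩
          refine natDegree_le_of_mem_degreeLT ?_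
          rwa [show r m - 2 + 1 = r m - 1 by have := hr m; omega]
        · refine ⟨0, by simp, fun t ht => ?_⟩
          rw [hφ, indicator_of_notMem, eval_zero]
          exact fun h => hmn (P.eq_of_mem ht h)
    have key := htest φ hφt
    have hz : ∀ m, m ≠ n → ∀ H : ℝ → ℝ, ∫ t in Ioo (P.left m) (P.right m), H t * φ t = 0 := by
      intro m hm H
      refine setIntegral_eq_zero_of_forall_eq_zero fun t ht => ?_
      rw [hφ, indicator_of_notMem, mul_zero]
      exact fun h => hm (P.eq_of_mem ht h)
    rw [Finset.sum_eq_single n (fun m _ hm => hz m hm _) (by simp),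
      Finset.sum_eq_single n (fun m _ hm => hz m hm _) (by simp)] at key
    have e1 : ∫ t in Ioo (P.left n) (P.right n), deriv (deriv U) t * φ t =
        ∫ t in P.left n..P.right n, (derivative (derivative (p n))).eval t * s.eval t := by
      rw [intervalIntegral.integral_of_le (P.left_lt_right n).le, integral_Ioc_eq_integral_Ioo]
      refine setIntegral_congr_fun measurableSet_Ioo fun t ht => ?_
      rw [hder2 n t ht, hφ, indicator_of_mem ht]
    have e2 : ∫ t in Ioo (P.left n) (P.right n), f t (U t) (deriv U t) * φ t =
        ∫ t in P.left n..P.right n, f t (U t) (derivWithin U (Icc 0 T) t) * s.eval t := by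
      rw [intervalIntegral.integral_of_le (P.left_lt_right n).le, integral_Ioc_eq_integral_Ioo]
      refine setIntegral_congr_fun measurableSet_Ioo fun t ht => ?_
      rw [hdW n t ht, hφ, indicator_of_mem ht]
    rw [e1, e2] at key
    by_cases hint : IntervalIntegrable
        (fun t => f t (U t) (derivWithin U (Icc 0 T) t) * s.eval t) volume (P.left n) (P.right n)
    · have e3 : (fun t => (f t (U t) (derivWithin U (Icc 0 T) t) -
          (derivative (derivative (p n))).eval t) * s.eval t) =
          fun t => f t (U t) (derivWithin U (Icc 0 T) t) * s.eval t -
            (derivative (derivative (p n)) * s).eval t := by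
        ext t; rw [eval_mul]; ring
      rw [e3, intervalIntegral.integral_sub hint ((Polynomial.continuous _).intervalIntegrable _ _),
        ← key]
      simp only [eval_mul, sub_self]
    -- the integral is zero by convention; this case does not occur for continuous `f`
    · refine intervalIntegral.integral_undef fun hcon => hint ?_
      have := hcon.add ((derivative (derivative (p n)) * s).continuous.intervalIntegrable
        (μ := volume) (P.left n) (P.right n))
      convert! this using 1
      ext t
      simp only [eval_mul]
      ring

end Mesh

end CPG

namespace CPG

open Polynomial

/-! ### The error estimate in terms of the projection error of the second derivative -/

lemma Mesh.glue_sub {T : ℝ} (P : Mesh T) (q w : Fin P.N → ℝ[X]) (t : ℝ) :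
    P.glue (fun n => q n - w n) t = P.glue q t - P.glue w t := by
  simp only [Mesh.glue, ← Finset.sum_sub_distrib]
  refine Finset.sum_congr rfl fun n _ => ?_
  simp only [eval_sub, indicator]
  split_ifs <;> ring

lemma prim_congr {T : ℝ} {h k : ℝ → ℝ} (hk : ∀ t ∈ Icc 0 T, h t = k t) {x : ℝ} (hx : x ∈ Icc 0 T) :
    prim h x = prim k x := by
  refine intervalIntegral.integral_congr fun t ht => ?_
  rw [uIcc_of_le hx.1] at ht
  exact hk t ⟨ht.1, ht.2.trans hx.2⟩

lemma Mesh.IsCPGSolution.derivWithin_eq {T : ℝ} {P : Mesh T} (hT : 0 < T)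
    {r : Fin P.N → ℕ} {f : ℝ → ℝ → ℝ → ℝ} {u₀ u₁ : ℝ} {U : ℝ → ℝ} (h : P.IsCPGSolution r f u₀ u₁ U)
    {w : Fin P.N → ℝ[X]} (hw : ∀ n, ∀ t ∈ Ioo (P.left n) (P.right n),
      HasDerivAt (derivWithin U (Icc 0 T)) ((w n).eval t) t) {x : ℝ} (hx : x ∈ Icc 0 T) :
    derivWithin U (Icc 0 T) x = u₁ + prim (P.glue w) x := by
  have hVc : ContinuousOn (derivWithin U (Icc 0 T)) (Icc 0 T) :=
    h.1.2.1.continuousOn_derivWithin (uniqueDiffOn_Icc hT) le_rfl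
  have hi : IntervalIntegrable (P.glue w) volume 0 x :=
    (memLp_two_intervalIntegrable hT.le (P.glue_memLp w 2)).mono_set (by
      rw [uIcc_of_le hx.1, uIcc_of_le hT.le]; exact Icc_subset_Icc_right hx.2)
  have := integral_eq_of_hasDerivAt_off_countable_of_le (derivWithin U (Icc 0 T)) (P.glue w) hx.1
    (s := range P.node) (finite_range _).countable (hVc.mono (Icc_subset_Icc_right hx.2))
    (fun t ht => by
      obtain ⟨n, hn⟩ := P.exists_mem_Ioo ⟨ht.1.1, ht.1.2.trans_le hx.2⟩ ht.2
      rw [P.glue_eq w hn]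
      exact hw n t hn) hi
  rw [prim, this, h.2.2.1]
  ring

set_option maxHeartbeats 1000000 in
/-- The error is of size `h ^ 2` times the piecewise projection error `η` of `u''`, where `h` bounds
the quotients of step and degree. With `G` the projection of `g = f(t, u, u') - f(t, U, U')`, the
error `e = u - U` satisfies `e'' = η + G`. Two antiderivatives of `η` gain `h ^ 2`; the remaining
part `z` with `z'' = G` is first bounded with one power of `h` by `stability_energy`, which makes the
quadratic linearization error small enough for `stability_linearized`. -/
theorem exists_error_le {T L : ℝ} (hT : 0 < T) (hL : 0 < L) {f : ℝ → ℝ → ℝ → ℝ}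
    (hLip : UniformLipschitz T L f)
    (hf : ContDiffOn ℝ 2 (fun p : ℝ × ℝ × ℝ => f p.1 p.2.1 p.2.2)
      (Icc 0 T ×ˢ (univ : Set (ℝ × ℝ)))) {u v : ℝ → ℝ}
    (hu : ∀ t ∈ Icc 0 T, HasDerivWithinAt u (v t) (Icc 0 T) t)
    (hv : ∀ t ∈ Icc 0 T, HasDerivWithinAt v (f t (u t) (v t)) (Icc 0 T) t) :
    ∃ C : ℝ, 0 < C ∧ ∀ (P : Mesh T) (r : Fin P.N → ℕ), (∀ n, 3 ≤ r n) →
      (∀ n, P.step n ≤ 1 / (16 * L + 4)) → ∀ U : ℝ → ℝ, P.IsCPGSolution r f (u 0) (v 0) U →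
      ∀ q : Fin P.N → ℝ[X],
      (∀ n, IsProj (P.left n) (P.right n) (r n - 1) (fun t => f t (u t) (v t)) (q n)) →
      ∀ h : ℝ, 0 ≤ h → h ≤ T → (∀ n, P.step n ≤ h * r n) →
      L2Norm 0 T (u - U) ^ 2 ≤ C * h ^ 4 *
        ∑ n, ∫ t in P.left n..P.right n, (f t (u t) (v t) - (q n).eval t) ^ 2 := by
  obtain ⟨M, α, β, β', hM, hα, hβ, hβ', hαM, hβM, hβ'M, hβp, hlin⟩ :=
    exists_linearization hT hL hLip hf hu hv
  have hucont : ContinuousOn u (Icc 0 T) := fun t ht => (hu t ht).continuousWithinAt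
  have hvcont : ContinuousOn v (Icc 0 T) := fun t ht => (hv t ht).continuousWithinAt
  have hcomp : ∀ {x y : ℝ → ℝ}, ContinuousOn x (Icc 0 T) → ContinuousOn y (Icc 0 T) →
      ContinuousOn (fun t => f t (x t) (y t)) (Icc 0 T) := fun {x y} hx hy =>
    hf.continuousOn.comp (f := fun t => (t, x t, y t)) (continuousOn_id.prodMk (hx.prodMk hy))
      (fun t ht => ⟨ht, mem_univ _⟩)
  set F : ℝ → ℝ := fun t => f t (u t) (v t) with hF
  have hFc : ContinuousOn F (Icc 0 T) := hcomp hucont hvcont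
  have hFm := continuousOn_memLp_two hFc
  set K := Real.exp (2 * T) with hK
  have hK0 : 0 < K := Real.exp_pos _
  set E₀ := wsq T 0 F with hE₀
  have hE₀n : 0 ≤ E₀ := wsq_nonneg hT.le
  set c₁ := 24 * L ^ 2 * Real.exp ((16 * L + 4) * T) with hc₁
  set c₂ := c₁ * (1 + 4 * T ^ 2) with hc₂
  set c₃ := 8 * T ^ 2 + 2 * (K * (K * c₂)) + (2 + 2 * (K * c₂)) with hc₃
  set c₄ := 20 * Real.exp ((8 * M + 4) * T) with hc₄
  set c₅ := c₄ * (K * M ^ 2 * (3 * 16) + T * (16 * (M * c₃) ^ 2 * E₀) + 32 * L ^ 2 * c₃) with hc₅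
  have hc₁0 : 0 < c₁ := by positivity
  have hc₂0 : 0 < c₂ := by positivity
  have hc₃0 : 0 < c₃ := by positivity
  have hc₄0 : 0 < c₄ := by positivity
  have hc₅0 : 0 < c₅ := by positivity
  refine ⟨32 + 2 * (K * c₅), by positivity, fun P r hr hstep U hU q hq h hh0 hhT hh => ?_⟩
  have hr' : ∀ n, (3 : ℝ) ≤ r n := fun n => by exact_mod_cast hr n
  obtain ⟨w, hw1, hw2⟩ := hU.exists_pieces hr
  set V := derivWithin U (Icc 0 T) with hV
  have hVc : ContinuousOn V (Icc 0 T) :=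
    hU.1.2.1.continuousOn_derivWithin (uniqueDiffOn_Icc hT) le_rfl
  have hUc : ContinuousOn U (Icc 0 T) := hU.1.2.1.continuousOn
  have hUd : ∀ t ∈ Icc 0 T, HasDerivWithinAt U (V t) (Icc 0 T) t := fun t ht =>
    (hU.1.2.1.differentiableOn one_ne_zero t ht).hasDerivWithinAt
  set FU : ℝ → ℝ := fun t => f t (U t) (V t) with hFU
  have hFUc : ContinuousOn FU (Icc 0 T) := hcomp hUc hVc
  set g : ℝ → ℝ := fun t => F t - FU t with hg
  have hgc : ContinuousOn g (Icc 0 T) := hFc.sub hFUc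
  have hgm := continuousOn_memLp_two hgc
  set η : ℝ → ℝ := fun t => F t - P.glue q t with hη
  have hqm := P.glue_memLp q 2
  have hwm := P.glue_memLp w 2
  have hηm : MemLp η 2 (volume.restrict (Ioo 0 T)) := hFm.sub hqm
  set G : ℝ → ℝ := P.glue (fun n => q n - w n) with hG
  have hGm : MemLp G 2 (volume.restrict (Ioo 0 T)) := P.glue_memLp _ 2
  set ζ : ℝ → ℝ := fun t => g t - G t with hζ
  have hζm : MemLp ζ 2 (volume.restrict (Ioo 0 T)) := hgm.sub hGm
  have hII : ∀ {k : ℝ → ℝ}, MemLp k 2 (volume.restrict (Ioo 0 T)) →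
      IntervalIntegrable k volume 0 T := fun hk => memLp_two_intervalIntegrable hT.le hk
  -- `G` is the projection of `g`
  have hGproj : ∀ n, IsProj (P.left n) (P.right n) (r n - 1) g (q n - w n) := by
    intro n
    refine ⟨Submodule.sub_mem _ (hq n).1 (hw2 n).1, fun s hs => ?_⟩
    have hlr := (P.left_lt_right n).le
    have i1 := memLp_two_intervalIntegrable_sq hlr
      (sub_poly_memLp_two (P.memLp_local hFm n) (q n)) (poly_memLp_two s)
    have i2 := memLp_two_intervalIntegrable_sq hlr
      (sub_poly_memLp_two (P.memLp_local (continuousOn_memLp_two hFUc) n) (w n)) (poly_memLp_two s)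
    have e : (fun t => (g t - (q n - w n).eval t) * s.eval t) =
        fun t => (F t - (q n).eval t) * s.eval t - (FU t - (w n).eval t) * s.eval t := by
      ext t; simp only [hg, eval_sub]; ring
    rw [e, intervalIntegral.integral_sub i1 i2, (hq n).2 s hs, (hw2 n).2 s hs, sub_zero]
  -- the representation of the error
  have he1 : ∀ t ∈ Icc 0 T, v t - V t = prim η t + prim G t := by
    intro t ht
    have h1 := eq_add_prim_of_hasDerivWithinAt hv hFc ht
    have h2 := hU.derivWithin_eq hT hw1 ht
    have h3 := prim_add hT.le (hII hηm) (hII hqm) ht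
    have h4 := prim_add hT.le (hII hGm) (hII hwm) ht
    have e3 : (fun t => η t + P.glue q t) = F := by ext t; simp [hη]
    have e4 : (fun t => G t + P.glue w t) = P.glue q := by
      ext t; rw [hG, P.glue_sub]; ring
    rw [e3] at h3
    rw [e4] at h4
    rw [h1, hV, h2]
    linarith
  have hpη := continuousOn_prim hT.le (hII hηm)
  have hpG := continuousOn_prim hT.le (hII hGm)
  have ham := prim_memLp hT.le hηm
  have hbm := prim_memLp hT.le ham
  have hz1m := prim_memLp hT.le hGm
  have hzm := prim_memLp hT.le hz1m
  have he : ∀ t ∈ Icc 0 T, u t - U t = prim (prim η) t + prim (prim G) t := by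
    intro t ht
    have h1 := eq_add_prim_of_hasDerivWithinAt hu hvcont ht
    have h2 := eq_add_prim_of_hasDerivWithinAt hUd hVc ht
    have h3 := prim_add hT.le (hII ham) (hII hz1m) ht
    have h4 := prim_add hT.le (hII (continuousOn_memLp_two hVc)) (hII (ham.add hz1m)) ht
    have h5 := prim_congr (h := v) (k := fun t => V t + (prim η + prim G) t)
      (fun s hs => by have := he1 s hs; simp only [Pi.add_apply]; linarith) ht
    have h6 : prim (prim η + prim G) t = prim (fun t => prim η t + prim G t) t := rfl
    rw [hU.2.1] at h2
    rw [h1, h2, h5, h4, h6, h3]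
    ring
  -- the smoothing property
  have hηo : P.Orth (fun n => r n - 1) η := by
    intro n s hs
    rw [← (hq n).2 s hs]
    exact P.integral_congr_piece n fun t ht => by simp only [hη]; rw [P.glue_eq q ht]
  have hζo : P.Orth (fun n => r n - 1) ζ := by
    intro n s hs
    rw [← (hGproj n).2 s hs]
    exact P.integral_congr_piece n fun t ht => by simp only [hζ, hG]; rw [P.glue_eq _ ht]
  have hA1 : ∀ n, P.step n / (2 * ((r n - 1 : ℕ) : ℝ)) ≤ 2 * h := by
    intro n
    have h1 := hh n
    have h2 := hr' n
    rw [Nat.cast_sub (by have := hr n; omega), Nat.cast_one, div_le_iff₀ (by linarith only [h2])]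
    linarith only [h1, mul_le_mul_of_nonneg_left h2 hh0, hh0]
  have hA2 : ∀ n, P.step n / (2 * ((r n - 2 : ℕ) : ℝ)) ≤ 2 * h := by
    intro n
    have h1 := hh n
    have h2 := hr' n
    rw [Nat.cast_sub (by have := hr n; omega), Nat.cast_ofNat, div_le_iff₀ (by linarith only [h2])]
    linarith only [h1, mul_le_mul_of_nonneg_left h2 hh0, hh0]
  set E := wsq T 0 η with hE
  have hEn : 0 ≤ E := wsq_nonneg hT.le
  have hEE : E ≤ E₀ := P.wsq_sub_glue_le hFm hq
  have hEsum : E = ∑ n, ∫ t in P.left n..P.right n, (f t (u t) (v t) - (q n).eval t) ^ 2 := by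
    rw [hE, wsq_zero_eq, ← P.sum_integral (by
      simpa only [sq] using memLp_two_intervalIntegrable_sq hT.le hηm hηm)]
    refine Finset.sum_congr rfl fun n _ => P.integral_congr_piece n fun t ht => ?_
    simp only [hη]
    rw [P.glue_eq q ht]
  have hwa : wsq T 0 (prim η) ≤ 4 * h ^ 2 * E := by
    have := hηo.wsq_prim_le (fun n => by have := hr n; omega) hηm hA1
    rwa [mul_pow, show (2 : ℝ) ^ 2 = 4 by norm_num] at this
  have hao : P.Orth (fun n => r n - 2) (prim η) := by
    refine Mesh.Orth.prim ?_ hηm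
    have : (fun n => r n - 2 + 1) = fun n => r n - 1 := by
      ext n; have := hr n; omega
    rwa [this]
  have hwb : wsq T 0 (prim (prim η)) ≤ 4 * h ^ 2 * wsq T 0 (prim η) := by
    have := hao.wsq_prim_le (fun n => by have := hr n; omega) ham hA2
    rwa [mul_pow, show (2 : ℝ) ^ 2 = 4 by norm_num] at this
  have hwζ : wsq T 0 (prim ζ) ≤ 4 * h ^ 2 * wsq T 0 g := by
    have h1 := hζo.wsq_prim_le (fun n => by have := hr n; omega) hζm hA1
    rw [mul_pow, show (2 : ℝ) ^ 2 = 4 by norm_num] at h1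
    have h2 : wsq T 0 ζ ≤ wsq T 0 g := P.wsq_sub_glue_le hgm hGproj
    exact h1.trans (by gcongr)
  set wa := wsq T 0 (prim η) with hwa'
  have hwan : 0 ≤ wa := wsq_nonneg hT.le
  have hwbT : wsq T 0 (prim (prim η)) ≤ 4 * T ^ 2 * wa := hwb.trans (by gcongr)
  -- the energy estimate, with one power of `h`
  have hgL : ∀ t ∈ Icc 0 T, |g t| ≤ L * (|u t - U t| + |v t - V t|) := fun t ht =>
    hLip t ht _ _ _ _
  have hwG : wsq T 0 G ≤ c₂ * wa := by
    have h1 := stability_energy hT.le hL ham hbm hGm hgm (fun t ht => by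
      have h2 := hgL t (Ioo_subset_Icc_self ht)
      rwa [he t (Ioo_subset_Icc_self ht), he1 t (Ioo_subset_Icc_self ht)] at h2)
      (P.wsq_glue_le hgm hGproj (by positivity) fun n => by
        have h3 := hstep n
        rw [le_div_iff₀ (by positivity)] at h3
        linarith)
    calc _ ≤ c₁ * (wa + wsq T 0 (prim (prim η))) := h1
      _ ≤ c₁ * (wa + 4 * T ^ 2 * wa) := by gcongr
      _ = _ := by rw [hc₂]; ring
  have hwz1 : wsq T 0 (prim G) ≤ K * (c₂ * wa) :=
    (wsq_zero_prim_le hT.le hGm).trans (by gcongr)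
  have hwz : wsq T 0 (prim (prim G)) ≤ K * (K * (c₂ * wa)) :=
    (wsq_zero_prim_le hT.le hz1m).trans (by gcongr)
  set e : ℝ → ℝ := fun t => u t - U t with hedef
  set e1 : ℝ → ℝ := fun t => v t - V t with he1def
  have hec : ContinuousOn e (Icc 0 T) := hucont.sub hUc
  have he1c : ContinuousOn e1 (Icc 0 T) := hvcont.sub hVc
  have hem := continuousOn_memLp_two hec
  have he1m := continuousOn_memLp_two he1c
  have hwe : wsq T 0 e ≤ 2 * wsq T 0 (prim (prim η)) + 2 * wsq T 0 (prim (prim G)) := by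
    refine wsq_le_add hT.le hem hbm hzm fun t ht => ?_
    simp only [hedef]
    rw [he t (Ioo_subset_Icc_self ht)]
    exact add_sq_le.trans_eq (by ring)
  have hwe1 : wsq T 0 e1 ≤ 2 * wa + 2 * wsq T 0 (prim G) := by
    refine wsq_le_add hT.le he1m ham hz1m fun t ht => ?_
    simp only [he1def]
    rw [he1 t (Ioo_subset_Icc_self ht)]
    exact add_sq_le.trans_eq (by ring)
  have hee : wsq T 0 e + wsq T 0 e1 ≤ c₃ * wa := by
    rw [hc₃]; linarith only [hwe, hwe1, hwbT, hwz1, hwz]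
  have hwg : wsq T 0 g ≤ 2 * L ^ 2 * (c₃ * wa) := by
    have h1 := wsq_le_add (l := 0) hT.le hgm hem he1m (c₁ := 2 * L ^ 2) (c₂ := 2 * L ^ 2)
      (fun t ht => by
        have h2 := hgL t (Ioo_subset_Icc_self ht)
        have h3 : g t ^ 2 ≤ (L * (|e t| + |e1 t|)) ^ 2 := by
          rw [← sq_abs (g t)]; gcongr
        have h4 : (|e t| + |e1 t|) ^ 2 ≤ 2 * (e t ^ 2 + e1 t ^ 2) := by
          rw [← sq_abs (e t), ← sq_abs (e1 t)]
          exact add_sq_le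
        have h5 := mul_le_mul_of_nonneg_left h4 (sq_nonneg L)
        rw [mul_pow] at h3
        linarith only [h3, h5])
    have h6 := mul_le_mul_of_nonneg_left hee (by positivity : 0 ≤ 2 * L ^ 2)
    linarith only [h1, h6]
  -- the linearized problem; `ρ` below is quadratic in the error, hence of order `h ^ 2` times the
  -- square of the projection error, one factor of which is bounded by `E₀`
  set R : ℝ → ℝ := fun t => g t - α t * e t - β t * e1 t with hR
  have hRc : ContinuousOn R (Icc 0 T) := (hgc.sub (hα.mul hec)).sub (hβ.mul he1c)
  have hρ : ∫ t in (0 : ℝ)..T, |R t| ≤ M * c₃ * wa := by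
    have i1 : IntervalIntegrable (fun t => e t ^ 2) volume 0 T := by
      simpa only [sq] using memLp_two_intervalIntegrable_sq hT.le hem hem
    have i2 : IntervalIntegrable (fun t => e1 t ^ 2) volume 0 T := by
      simpa only [sq] using memLp_two_intervalIntegrable_sq hT.le he1m he1m
    calc ∫ t in (0 : ℝ)..T, |R t| ≤ ∫ t in (0 : ℝ)..T, M * (e t ^ 2 + e1 t ^ 2) :=
          intervalIntegral_mono_Ioo hT.le (hII (continuousOn_memLp_two hRc)).abs
            ((i1.add i2).const_mul M)
            fun t ht => hlin t (Ioo_subset_Icc_self ht) (U t) (V t)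
      _ = M * (wsq T 0 e + wsq T 0 e1) := by
          rw [intervalIntegral.integral_const_mul, intervalIntegral.integral_add i1 i2,
            wsq_zero_eq, wsq_zero_eq]
      _ ≤ M * (c₃ * wa) := by gcongr
      _ = _ := by ring
  have hstab := stability_linearized hT.le hM (a := prim η) (G := G) (ζ := ζ) (R := R) (α := α)
    (β := β) (β' := β') hpη hGm hζm hRc hα hβ' hαM hβM hβ'M hβp hρ (fun t ht => by
      have h1 := he t (Ioo_subset_Icc_self ht)
      have h2 := he1 t (Ioo_subset_Icc_self ht)
      simp only [hR, hζ, hedef, he1def]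
      rw [← h1, ← h2]
      ring)
  have hwb4 : wsq T 0 (prim (prim η)) ≤ 16 * (h ^ 4 * E) := by
    calc _ ≤ 4 * h ^ 2 * (4 * h ^ 2 * E) := hwb.trans (by gcongr)
      _ = _ := by ring
  have hwζ4 : wsq T 0 (prim ζ) ≤ 32 * L ^ 2 * c₃ * (h ^ 4 * E) := by
    calc _ ≤ 4 * h ^ 2 * (2 * L ^ 2 * (c₃ * (4 * h ^ 2 * E))) :=
          hwζ.trans (by
            gcongr
            exact hwg.trans (by gcongr))
      _ = _ := by ring
  have hρ4 : (M * c₃ * wa) ^ 2 ≤ 16 * (M * c₃) ^ 2 * E₀ * (h ^ 4 * E) := by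
    calc (M * c₃ * wa) ^ 2 ≤ (M * c₃ * (4 * h ^ 2 * E)) ^ 2 := by gcongr
      _ = 16 * (M * c₃) ^ 2 * (h ^ 4 * E) * E := by ring
      _ ≤ 16 * (M * c₃) ^ 2 * (h ^ 4 * E) * E₀ := by gcongr
      _ = _ := by ring
  have hz14 : wsq T 0 (prim G) ≤ c₅ * (h ^ 4 * E) := by
    calc _ ≤ c₄ * (K * M ^ 2 * (3 * (16 * (h ^ 4 * E))) +
          T * (16 * (M * c₃) ^ 2 * E₀ * (h ^ 4 * E)) + 32 * L ^ 2 * c₃ * (h ^ 4 * E)) :=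
          hstab.trans (by gcongr)
      _ = _ := by rw [hc₅]; ring
  have hfinal : wsq T 0 e ≤ (32 + 2 * (K * c₅)) * (h ^ 4 * E) := by
    have h1 : wsq T 0 (prim (prim G)) ≤ K * (c₅ * (h ^ 4 * E)) :=
      (wsq_zero_prim_le hT.le hz1m).trans (by gcongr)
    linarith only [hwe, hwb4, h1]
  have hL2 : L2Norm 0 T (u - U) ^ 2 = wsq T 0 e := by
    have h1 := eLpNorm_two_sq hT.le hem
    rw [L2Norm, ← ENNReal.toReal_pow]
    have h2 : u - U = e := rfl
    rw [h2, h1, ENNReal.toReal_ofReal (by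
      rw [← wsq_zero_eq]; exact wsq_nonneg hT.le), wsq_zero_eq]
  rw [hL2, ← hEsum]
  linarith only [hfinal]

end CPG

namespace CPG

open Polynomial

/-! ### Piecewise projection with a common degree -/

/-- Every factor of `gain (r - 1) m` is at least `(r / c) ^ 2`. -/
lemma le_gain {r m : ℕ} (hr : m + 1 ≤ r) {c : ℝ} (hc : (m : ℝ) + 1 ≤ c) :
    ((r : ℝ) / c) ^ (2 * m) ≤ gain (r - 1) m := by
  have hm0 : (0 : ℝ) ≤ m := Nat.cast_nonneg m
  have hr' : (m : ℝ) + 1 ≤ r := by exact_mod_cast hr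
  have hc0 : 0 < c := by linarith
  have hn : ((r - 1 : ℕ) : ℝ) = r - 1 := by rw [Nat.cast_sub (by omega)]; simp
  calc ((r : ℝ) / c) ^ (2 * m) = ∏ _i ∈ Finset.range m, ((r : ℝ) / c * (r / c)) := by
        rw [Finset.prod_const, Finset.card_range, pow_mul, sq]
    _ ≤ gain (r - 1) m := by
        refine Finset.prod_le_prod (fun i _ => by positivity) fun i hi => ?_
        have hi' : (i : ℝ) + 1 ≤ m := by exact_mod_cast Finset.mem_range.mp hi
        have hi0 : (0 : ℝ) ≤ i := Nat.cast_nonneg i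
        rw [hn]
        have h1 : (r : ℝ) / c ≤ r - 1 - i := by
          rw [div_le_iff₀ hc0]
          have h3 : ((r : ℝ) - m) * (m + 1) ≤ (r - 1 - i) * c := by
            exact mul_le_mul (by linarith) hc (by linarith) (by linarith)
          have h4 : 0 ≤ (m : ℝ) * (r - (m + 1)) := mul_nonneg hm0 (by linarith)
          linarith
        have h2 : (r : ℝ) / c ≤ r - 1 + i + 1 :=
          (div_le_self (by linarith) (by linarith)).trans (by linarith)
        have h5 : (0 : ℝ) ≤ r / c := by positivity
        exact mul_le_mul h1 h2 h5 (h5.trans h1)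

lemma approxConst_le {k K c : ℝ} (hk : 0 < k) (hkK : k ≤ K) {r m : ℕ} (hr : m + 1 ≤ r)
    (hc : (m : ℝ) + 1 ≤ c) : approxConst k (r - 1) m ≤ (c * K / (2 * r)) ^ m := by
  have hr0 : (0 : ℝ) < r := by exact_mod_cast (by omega : 0 < r)
  have hc0 : 0 < c := by have : (0 : ℝ) ≤ m := Nat.cast_nonneg m; linarith
  have h : ((r : ℝ) / c) ^ m ≤ √(gain (r - 1) m) :=
    Real.le_sqrt_of_sq_le (by rw [← pow_mul, mul_comm m 2]; exact le_gain hr hc)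
  calc approxConst k (r - 1) m ≤ (K / 2) ^ m / ((r : ℝ) / c) ^ m := by
        have hK : 0 < K := hk.trans_le hkK
        unfold approxConst; gcongr
    _ = _ := by
        rw [← div_pow]
        congr 1
        field_simp

lemma ennreal_add_sq_le (x y : ℝ≥0∞) : (x + y) ^ 2 ≤ 4 * (x ^ 2 + y ^ 2) := by
  rcases le_total x y with h | h
  · calc (x + y) ^ 2 ≤ (y + y) ^ 2 := by gcongr
      _ = 4 * y ^ 2 := by ring
      _ ≤ _ := by gcongr; exact le_add_self
  · calc (x + y) ^ 2 ≤ (x + x) ^ 2 := by gcongr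
      _ = 4 * x ^ 2 := by ring
      _ ≤ _ := by gcongr; exact le_self_add

namespace Mesh

variable {T : ℝ} (P : Mesh T)

lemma step_le (n : Fin P.N) : P.step n ≤ T := by
  have h1 := P.left_nonneg n
  have h2 := P.right_le n
  rw [step]; linarith

lemma step_le_maxStep (n : Fin P.N) : P.step n ≤ P.maxStep :=
  le_ciSup (Finite.bddAbove_range P.step) n

lemma maxStep_pos (hT : 0 < T) : 0 < P.maxStep :=
  (P.step_pos ⟨0, P.N_pos hT⟩).trans_le (P.step_le_maxStep _)

lemma maxStep_le : P.maxStep ≤ T := Real.iSup_le P.step_le P.nonneg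

lemma sum_eLpNorm_sq {y : ℝ → ℝ} (hy : MemLp y 2 (volume.restrict (Ioo 0 T))) :
    ∑ n, eLpNorm y 2 (volume.restrict (Ioo (P.left n) (P.right n))) ^ 2 =
      eLpNorm y 2 (volume.restrict (Ioo 0 T)) ^ 2 := by
  rw [eLpNorm_two_sq P.nonneg hy, ← P.sum_integral (by
    simpa only [sq] using memLp_two_intervalIntegrable_sq P.nonneg hy hy),
    ENNReal.ofReal_sum_of_nonneg fun n _ =>
      intervalIntegral.integral_nonneg (P.left_lt_right n).le fun _ _ => sq_nonneg _]
  exact Finset.sum_congr rfl fun n _ => eLpNorm_two_sq (P.left_lt_right n).le (P.memLp_local hy n)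

lemma sum_weakSeminorm_sq {i : ℕ} {u : ℝ → ℝ} (hu : weakSeminorm 0 T i u < ⊤) :
    ∑ n, weakSeminorm (P.left n) (P.right n) i u ^ 2 = weakSeminorm 0 T i u ^ 2 := by
  obtain ⟨v, hv, hvm, e⟩ := exists_hasWeakDeriv hu
  rw [e, ← P.sum_eLpNorm_sq hvm]
  exact Finset.sum_congr rfl fun n _ => by
    rw [(hv.mono (P.left_nonneg n) (P.right_le n)).weakSeminorm_eq]

lemma weakSeminorm_lt_top {i : ℕ} {u : ℝ → ℝ} (hu : weakSeminorm 0 T i u < ⊤) (n : Fin P.N) :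
    weakSeminorm (P.left n) (P.right n) i u < ⊤ := by
  obtain ⟨v, hv, hvm, -⟩ := exists_hasWeakDeriv hu
  rw [(hv.mono (P.left_nonneg n) (P.right_le n)).weakSeminorm_eq]
  exact (P.memLp_local hvm n).2

lemma eLpNorm_sub_glue_sq {F : ℝ → ℝ} (hF : MemLp F 2 (volume.restrict (Ioo 0 T)))
    (q : Fin P.N → ℝ[X]) :
    eLpNorm (fun t => F t - P.glue q t) 2 (volume.restrict (Ioo 0 T)) ^ 2 =
      ∑ n, eLpNorm (fun t => F t - (q n).eval t) 2
        (volume.restrict (Ioo (P.left n) (P.right n))) ^ 2 := by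
  have hη : MemLp (fun t => F t - P.glue q t) 2 (volume.restrict (Ioo 0 T)) :=
    hF.sub (P.glue_memLp q 2)
  rw [← P.sum_eLpNorm_sq hη]
  refine Finset.sum_congr rfl fun n _ => ?_
  congr 1
  refine eLpNorm_congr_ae ?_
  filter_upwards [ae_restrict_mem measurableSet_Ioo] with t ht
  rw [P.glue_eq q ht]

/-- Global version of the local error estimate for the piecewise projection. -/
lemma eLpNorm_sub_glue_le_weakSeminorm {r m : ℕ} (hm : m ≤ r - 1) {u F : ℝ → ℝ}
    (hF : HasWeakDeriv 0 T 2 u F) (hFm : MemLp F 2 (volume.restrict (Ioo 0 T)))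
    {q : Fin P.N → ℝ[X]} (hq : ∀ n, IsProj (P.left n) (P.right n) (r - 1) F (q n)) {A : ℝ}
    (hA : ∀ n, approxConst (P.step n) (r - 1) m ≤ A)
    (hu : ∀ i ≤ m + 2, weakSeminorm 0 T i u < ⊤) :
    eLpNorm (fun t => F t - P.glue q t) 2 (volume.restrict (Ioo 0 T)) ≤
      ENNReal.ofReal A * weakSeminorm 0 T (m + 2) u := by
  rw [← ENNReal.pow_le_pow_left_iff two_ne_zero, P.eLpNorm_sub_glue_sq hFm, mul_pow,
    ← P.sum_weakSeminorm_sq (hu _ le_rfl), Finset.mul_sum]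
  refine Finset.sum_le_sum fun n _ => ?_
  rw [← mul_pow]
  gcongr
  refine ((hq n).eLpNorm_le_weakSeminorm (P.left_lt_right n) hm
    (hF.mono (P.left_nonneg n) (P.right_le n)) fun i hi => P.weakSeminorm_lt_top (hu i hi) n).trans
    ?_
  gcongr
  exact hA n

lemma eLpNorm_sub_glue_le_add {r m : ℕ} (hm : m + 1 ≤ r - 1) {u F w : ℝ → ℝ}
    (hF : HasWeakDeriv 0 T 2 u F) (hFm : MemLp F 2 (volume.restrict (Ioo 0 T)))
    {q : Fin P.N → ℝ[X]} (hq : ∀ n, IsProj (P.left n) (P.right n) (r - 1) F (q n)) {A B : ℝ}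
    (hA : ∀ n, approxConst (P.step n) (r - 1) m ≤ A)
    (hB : ∀ n, approxConst (P.step n) (r - 1) (m + 1) ≤ B)
    (hu : ∀ i ≤ m + 2, weakSeminorm 0 T i (u - w) < ⊤)
    (hw : ∀ i ≤ m + 3, weakSeminorm 0 T i w < ⊤) :
    eLpNorm (fun t => F t - P.glue q t) 2 (volume.restrict (Ioo 0 T)) ≤
      2 * (ENNReal.ofReal A * weakSeminorm 0 T (m + 2) (u - w) +
        ENNReal.ofReal B * weakSeminorm 0 T (m + 3) w) := by
  set a := weakSeminorm 0 T (m + 2) (u - w) with ha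
  set b := weakSeminorm 0 T (m + 3) w with hb
  have hloc : ∀ n, eLpNorm (fun t => F t - (q n).eval t) 2
      (volume.restrict (Ioo (P.left n) (P.right n))) ^ 2 ≤
      4 * (ENNReal.ofReal A ^ 2 * weakSeminorm (P.left n) (P.right n) (m + 2) (u - w) ^ 2 +
        ENNReal.ofReal B ^ 2 * weakSeminorm (P.left n) (P.right n) (m + 3) w ^ 2) := fun n => by
    rw [← mul_pow, ← mul_pow]
    refine le_trans ?_ (ennreal_add_sq_le _ _)
    gcongr
    refine ((hq n).eLpNorm_le_add (P.left_lt_right n) hm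
      (hF.mono (P.left_nonneg n) (P.right_le n)) (P.memLp_local hFm n)
      (fun i hi => P.weakSeminorm_lt_top (hu i hi) n)
      fun i hi => P.weakSeminorm_lt_top (hw i hi) n).trans ?_
    gcongr
    · exact hA n
    · exact hB n
  rw [← ENNReal.pow_le_pow_left_iff two_ne_zero, P.eLpNorm_sub_glue_sq hFm]
  calc _ ≤ _ := Finset.sum_le_sum fun n _ => hloc n
    _ = 4 * ((ENNReal.ofReal A * a) ^ 2 + (ENNReal.ofReal B * b) ^ 2) := by
        rw [← Finset.mul_sum, Finset.sum_add_distrib, ← Finset.mul_sum, ← Finset.mul_sum,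
          P.sum_weakSeminorm_sq (hu _ le_rfl), P.sum_weakSeminorm_sq (hw _ le_rfl), mul_pow,
          mul_pow]
    _ ≤ 4 * (ENNReal.ofReal A * a + ENNReal.ofReal B * b) ^ 2 := by
        rw [add_sq]
        gcongr
        exact le_self_add
    _ = _ := by rw [mul_pow]; norm_num

end Mesh

lemma weakSeminorm_le_sobolevENorm {a b s : ℝ} (hs : 0 ≤ s) {i : ℕ} (hi : i ≤ ⌊s⌋₊) (u : ℝ → ℝ) :
    weakSeminorm a b i u ≤ 4 * sobolevENorm a b s u := by
  unfold sobolevENorm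
  split_ifs with h
  · exact (weakSeminorm_le_intSobolevENorm hi u).trans (le_mul_of_one_le_left' (by norm_num))
  · have h1 := Nat.floor_le hs
    have h2 := Nat.lt_floor_add_one s
    refine (weakSeminorm_le_kFunctional hi u).trans ((kFunctional_le_interpENorm _
      (θ := s - ⌊s⌋₊) (by linarith) (by linarith) u one_pos).trans_eq ?_)
    rw [Real.one_rpow]
    norm_num

/-- The error of the piecewise projection of the second derivative, with the exponents of the
step and of the degree that belong to the regularity `s + 1` of `u`. -/
lemma Mesh.eLpNorm_sub_glue_le_sobolevNorm {T : ℝ} (hT : 0 < T) (P : Mesh T) {r : ℕ} (hr : 1 ≤ r)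
    {s : ℝ} (hs : 1 ≤ s) {u F : ℝ → ℝ} (hF : HasWeakDeriv 0 T 2 u F)
    (hFm : MemLp F 2 (volume.restrict (Ioo 0 T))) {q : Fin P.N → ℝ[X]}
    (hq : ∀ n, IsProj (P.left n) (P.right n) (r - 1) F (q n)) (hu : MemSobolev 0 T (s + 1) u) :
    eLpNorm (fun t => F t - P.glue q t) 2 (volume.restrict (Ioo 0 T)) ≤
      ENNReal.ofReal (8 * (s + 1) ^ (s - 1) * (P.maxStep ^ (min s r - 1) / (r : ℝ) ^ (s - 1))) *
        sobolevENorm 0 T (s + 1) u := by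
  set K := P.maxStep with hK
  have hK0 : 0 < K := P.maxStep_pos hT
  have hr0 : (0 : ℝ) < r := by exact_mod_cast hr
  obtain ⟨m, hm⟩ : ∃ m, ⌊s⌋₊ = m + 1 :=
    ⟨⌊s⌋₊ - 1, by have := (Nat.one_le_floor_iff s).mpr hs; omega⟩
  have hfl : ⌊s + 1⌋₊ = m + 2 := by rw [Nat.floor_add_one (by linarith), hm]
  have hf1 : ((m : ℝ) + 1) ≤ s := by
    have := Nat.floor_le (by linarith : 0 ≤ s); rw [hm] at this; exact_mod_cast this
  have hf2 : s < (m : ℝ) + 1 + 1 := by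
    have := Nat.lt_floor_add_one s; rw [hm] at this; exact_mod_cast this
  have hm0 : (0 : ℝ) ≤ m := Nat.cast_nonneg m
  have hint := hu.intSobolevENorm_lt_top (by linarith)
  rw [hfl] at hint
  have hintw := intSobolevENorm_lt_top_iff.mp hint
  rcases le_or_gt s r with hsr | hrs
  · have hmr : m + 1 ≤ r := by
      have : (m : ℝ) + 1 ≤ r := hf1.trans hsr
      exact_mod_cast this
    set X : ℝ := (s + 1) * K / (2 * r) with hX
    have hX0 : 0 < X := by positivity
    have hXle : 8 * X ^ (s - 1) ≤
        8 * (s + 1) ^ (s - 1) * (K ^ (min s r - 1) / (r : ℝ) ^ (s - 1)) := by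
      rw [min_eq_left hsr, mul_assoc]
      gcongr
      rw [← mul_div_assoc, ← Real.mul_rpow (by linarith) hK0.le,
        ← Real.div_rpow (by positivity) hr0.le]
      refine Real.rpow_le_rpow hX0.le ?_ (by linarith)
      rw [hX]
      gcongr
      linarith
    suffices H : eLpNorm (fun t => F t - P.glue q t) 2 (volume.restrict (Ioo 0 T)) ≤
        ENNReal.ofReal (8 * X ^ (s - 1)) * sobolevENorm 0 T (s + 1) u from
      H.trans (by gcongr)
    have hA : ∀ n, approxConst (P.step n) (r - 1) m ≤ X ^ m := fun n =>
      approxConst_le (P.step_pos n) (P.step_le_maxStep n) hmr (by linarith)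
    have hseq : s + 1 = (⌊s + 1⌋₊ : ℝ) ↔ s = m + 1 := by
      rw [hfl]; push_cast
      constructor <;> intro h <;> linarith
    unfold sobolevENorm
    split_ifs with hi
    · have hsm := hseq.mp hi
      rw [hfl]
      refine (P.eLpNorm_sub_glue_le_weakSeminorm (by omega) hF hFm hq hA hintw).trans ?_
      have e : X ^ (s - 1) = X ^ m := by
        rw [hsm, add_sub_cancel_right, Real.rpow_natCast]
      rw [e]
      gcongr
      · linarith [pow_pos hX0 m]
      · exact weakSeminorm_le_intSobolevENorm le_rfl u
    · have hlt' : (m : ℝ) + 1 < s := lt_of_le_of_ne hf1 fun h => hi (hseq.mpr h.symm)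
      have hmr' : m + 1 + 1 ≤ r := by
        have : (m : ℝ) + 1 < r := hlt'.trans_le hsr
        exact_mod_cast this
      have hB : ∀ n, approxConst (P.step n) (r - 1) (m + 1) ≤ X ^ (m + 1) := fun n =>
        approxConst_le (P.step_pos n) (P.step_le_maxStep n) hmr' (by push_cast; linarith)
      set θ := s + 1 - (⌊s + 1⌋₊ : ℝ) with hθ
      have hθe : θ = s - (m + 1) := by rw [hθ, hfl]; push_cast; ring
      have e : 8 * X ^ (s - 1) = 4 * (2 * X ^ m) * (2 * X ^ (m + 1) / (2 * X ^ m)) ^ θ := by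
        have h1 : 2 * X ^ (m + 1) / (2 * X ^ m) = X := by
          rw [pow_succ]; field_simp
        rw [h1, hθe, show s - 1 = m + (s - (m + 1)) by ring, Real.rpow_add hX0,
          Real.rpow_natCast]
        ring
      rw [hfl, e]
      refine le_interpENorm (m + 2) (by linarith) (by linarith) u (by positivity) (by positivity)
        fun w => ?_
      have hA0 : 0 < X ^ m := by positivity
      have hB0 : 0 < X ^ (m + 1) := by positivity
      by_cases hw1 : intSobolevENorm 0 T (m + 2) (u - w) < ⊤
      · by_cases hw2 : intSobolevENorm 0 T (m + 2 + 1) w < ⊤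
        · refine (P.eLpNorm_sub_glue_le_add (by omega) hF hFm hq hA hB
            (intSobolevENorm_lt_top_iff.mp hw1) (intSobolevENorm_lt_top_iff.mp hw2)).trans ?_
          rw [ENNReal.ofReal_mul (by norm_num), ENNReal.ofReal_mul (by norm_num), mul_add,
            ENNReal.ofReal_ofNat, mul_assoc, mul_assoc]
          gcongr
          · exact weakSeminorm_le_intSobolevENorm le_rfl _
          · exact weakSeminorm_le_intSobolevENorm le_rfl _
        · rw [not_lt_top_iff.mp hw2, ENNReal.mul_top (by simp [hX0]), add_top]; exact le_top
      · rw [not_lt_top_iff.mp hw1, ENNReal.mul_top (by simp [hX0]), top_add]; exact le_top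
  · -- the polynomial degree limits the order; `r < s` makes powers of `r` harmless
    have hrm : r ≤ m + 1 := by
      have : (r : ℝ) < m + 1 + 1 := hrs.trans hf2
      have : r < m + 1 + 1 := by exact_mod_cast this
      omega
    obtain ⟨l, rfl⟩ : ∃ l, r = l + 1 := ⟨r - 1, by omega⟩
    have hA : ∀ n, approxConst (P.step n) (l + 1 - 1) l ≤ K ^ l := fun n => by
      refine (approxConst_le (P.step_pos n) (P.step_le_maxStep n) (c := (l : ℝ) + 1) le_rfl
        le_rfl).trans ?_
      have : ((l : ℝ) + 1) * P.maxStep / (2 * ((l + 1 : ℕ) : ℝ)) = K / 2 := by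
        push_cast; field_simp; rfl
      rw [this]
      gcongr
      linarith
    refine (P.eLpNorm_sub_glue_le_weakSeminorm (m := l) (by omega) hF hFm hq hA
      fun i hi => hintw i (by omega)).trans ?_
    refine (mul_le_mul_right (weakSeminorm_le_sobolevENorm (s := s + 1) (by linarith)
      (by omega) u) _).trans ?_
    rw [← mul_assoc, show (4 : ℝ≥0∞) = ENNReal.ofReal 4 by norm_num,
      ← ENNReal.ofReal_mul (by positivity)]
    refine mul_le_mul_left (ENNReal.ofReal_le_ofReal ?_) _
    rw [min_eq_right hrs.le, show ((l + 1 : ℕ) : ℝ) - 1 = l by push_cast; ring,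
      Real.rpow_natCast]
    have h1 : ((l + 1 : ℕ) : ℝ) ^ (s - 1) ≤ (s + 1) ^ (s - 1) :=
      Real.rpow_le_rpow hr0.le (by linarith) (by linarith)
    have h2 : 0 < ((l + 1 : ℕ) : ℝ) ^ (s - 1) := by positivity
    have hKl : 0 < K ^ l := by positivity
    rw [mul_div_assoc', le_div_iff₀ h2]
    calc K ^ l * 4 * ((l + 1 : ℕ) : ℝ) ^ (s - 1) ≤ K ^ l * 4 * (s + 1) ^ (s - 1) := by gcongr
      _ ≤ K ^ l * 8 * (s + 1) ^ (s - 1) := by gcongr; norm_num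
      _ = _ := by ring

end CPG

namespace CPG

/-! ### Error bounds in Sobolev norms -/

lemma Mesh.sum_integral_eq_sq {T : ℝ} (P : Mesh T) {F : ℝ → ℝ}
    (hF : MemLp F 2 (volume.restrict (Ioo 0 T))) (q : Fin P.N → Polynomial ℝ) :
    ∑ n, ∫ t in P.left n..P.right n, (F t - (q n).eval t) ^ 2 =
      (eLpNorm (fun t => F t - P.glue q t) 2 (volume.restrict (Ioo 0 T))).toReal ^ 2 := by
  have h0 : ∀ n, 0 ≤ ∫ t in P.left n..P.right n, (F t - (q n).eval t) ^ 2 := fun n =>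
    intervalIntegral.integral_nonneg (P.left_lt_right n).le fun _ _ => sq_nonneg _
  rw [← ENNReal.toReal_pow, P.eLpNorm_sub_glue_sq hF]
  simp_rw [fun n => eLpNorm_two_sq (P.left_lt_right n).le
    (sub_poly_memLp_two (P.memLp_local hF n) (q n))]
  rw [← ENNReal.ofReal_sum_of_nonneg fun n _ => h0 n,
    ENNReal.toReal_ofReal (Finset.sum_nonneg fun n _ => h0 n)]

end CPG

theorem theorem3p2 (T : ℝ) (hT : 0 < T) (f : ℝ → ℝ → ℝ → ℝ) (L : ℝ) (hL : 0 < L)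
    (hLip : CPG.UniformLipschitz T L f)
    (hf : ContDiffOn ℝ 2 (fun p : ℝ × ℝ × ℝ => f p.1 p.2.1 p.2.2)
      (Icc 0 T ×ˢ (univ : Set (ℝ × ℝ)))) :
    ∃ δ : ℝ, 0 < δ ∧ ∀ (u₀ u₁ : ℝ) (u : ℝ → ℝ), CPG.IsExactSolution T f u₀ u₁ u →
      (∃ C : ℝ, 0 < C ∧
        ∀ (P : CPG.Mesh T) (r : Fin P.N → ℕ), (∀ n, 3 ≤ r n) → (∀ n, P.step n ≤ δ) →
        ∀ U : ℝ → ℝ, P.IsCPGSolution r f u₀ u₁ U →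
        ∀ s₀ : Fin P.N → ℝ, (∀ n, 1 ≤ s₀ n) →
          (∀ n, CPG.MemSobolev (P.left n) (P.right n) (s₀ n + 1) u) →
        ∀ s : Fin P.N → ℝ, (∀ n, 1 ≤ s n ∧ s n ≤ min (r n : ℝ) (s₀ n)) →
          CPG.L2Norm 0 T (u - U) ^ 2 ≤
            C * (⨆ n, (P.step n / r n) ^ 4) * P.approxSum r s u +
            C * (⨆ n, (P.step n / r n) ^ 3) * P.approxSum r s u ^ 2) ∧
      (∀ (Cq s : ℝ), 1 ≤ Cq → 3 / 2 ≤ s → CPG.MemSobolev 0 T (s + 1) u →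
        ∃ C : ℝ, 0 < C ∧
        ∀ (P : CPG.Mesh T) (r : ℕ), 3 ≤ r → P.QuasiUniform Cq → (∀ n, P.step n ≤ δ) →
        ∀ U : ℝ → ℝ, P.IsCPGSolution (fun _ => r) f u₀ u₁ U →
          CPG.L2Norm 0 T (u - U) ≤
            C * (P.maxStep ^ (min s (r : ℝ) + 1) / (r : ℝ) ^ (s + 1)) *
              CPG.sobolevNorm 0 T (s + 1) u) := by
  refine ⟨1 / (16 * L + 4), by positivity, ?_⟩
  rintro _ _ u ⟨v, hu, hv, rfl, rfl⟩
  obtain ⟨C, hC, hmain⟩ := CPG.exists_error_le hT hL hLip hf hu hv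
  have hFc : ContinuousOn (fun t => f t (u t) (v t)) (Icc 0 T) :=
    hf.continuousOn.comp (f := fun t => (t, u t, v t))
      (continuousOn_id.prodMk (ContinuousOn.prodMk (fun t ht => (hu t ht).continuousWithinAt)
        fun t ht => (hv t ht).continuousWithinAt)) fun t ht => ⟨ht, mem_univ _⟩
  have hFm := CPG.continuousOn_memLp_two hFc
  have hFw := CPG.hasWeakDeriv_two hT hu hv hFc
  have hproj : ∀ (P : CPG.Mesh T) (r : Fin P.N → ℕ), ∃ q : Fin P.N → Polynomial ℝ,
      ∀ n, CPG.IsProj (P.left n) (P.right n) (r n - 1) (fun t => f t (u t) (v t)) (q n) := by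
    intro P r
    choose q hq using fun n => CPG.exists_isProj (P.left_lt_right n) (r n - 1) (P.memLp_local hFm n)
    exact ⟨q, hq⟩
  refine ⟨⟨C * 32, by positivity, ?_⟩, fun Cq s _ hs hus => ?_⟩
  · intro P r hr hstep U hU s₀ _ hs₀ s hs
    obtain ⟨q, hq⟩ := hproj P r
    have hr0 : ∀ n, (3 : ℝ) ≤ r n := fun n => by exact_mod_cast hr n
    have : Nonempty (Fin P.N) := ⟨⟨0, P.N_pos hT⟩⟩
    obtain ⟨j, hj⟩ := Finite.exists_max fun n => P.step n / r n
    -- `h` is the largest quotient of step and degree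
    have hj0 : 0 ≤ P.step j / r j := div_nonneg (P.step_pos j).le (by linarith [hr0 j])
    have hjT : P.step j / r j ≤ T :=
      (div_le_self (P.step_pos j).le (by linarith [hr0 j])).trans (P.step_le j)
    have h1 := hmain P r hr hstep U hU q hq _ hj0 hjT fun n => by
      rw [← div_le_iff₀ (by linarith [hr0 n])]
      exact hj n
    have h2 : (P.step j / r j) ^ 4 ≤ ⨆ n, (P.step n / r n) ^ 4 :=
      le_ciSup (f := fun n => (P.step n / r n) ^ 4) (Finite.bddAbove_range _) j
    have h3 : ∑ n, ∫ t in P.left n..P.right n, (f t (u t) (v t) - (q n).eval t) ^ 2 ≤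
        32 * P.approxSum r s u := by
      rw [CPG.Mesh.approxSum, Finset.mul_sum]
      refine Finset.sum_le_sum fun n _ => ?_
      have hsn := le_min_iff.mp (hs n).2
      exact (hq n).integral_sq_le_sobolevNorm (P.left_lt_right n) (hs n).1 hsn.1
        (hFw.mono (P.left_nonneg n) (P.right_le n)) (P.memLp_local hFm n)
        ((hs₀ n).mono (by linarith [(hs n).1]) (by linarith [hsn.2]))
    have h4 : 0 ≤ ⨆ n, (P.step n / r n) ^ 3 := Real.iSup_nonneg fun n =>
      pow_nonneg (div_nonneg (P.step_pos n).le (by linarith [hr0 n])) 3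
    have h5 : 0 ≤ ∑ n, ∫ t in P.left n..P.right n, (f t (u t) (v t) - (q n).eval t) ^ 2 :=
      Finset.sum_nonneg fun n _ =>
        intervalIntegral.integral_nonneg (P.left_lt_right n).le fun _ _ => sq_nonneg _
    have h6 : 0 ≤ ⨆ n, (P.step n / r n) ^ 4 := (pow_nonneg hj0 4).trans h2
    -- the first term of the right-hand side suffices
    calc CPG.L2Norm 0 T (u - U) ^ 2
        ≤ C * (⨆ n, (P.step n / r n) ^ 4) * (32 * P.approxSum r s u) := h1.trans (by gcongr)
      _ = C * 32 * (⨆ n, (P.step n / r n) ^ 4) * P.approxSum r s u := by ring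
      _ ≤ _ := le_add_of_nonneg_right (by positivity)
  · have hc : 0 < 8 * (s + 1) ^ (s - 1) := by
      have : 0 < s + 1 := by linarith
      positivity
    refine ⟨√C * (8 * (s + 1) ^ (s - 1)), by positivity, fun P r hr _ hstep U hU => ?_⟩
    obtain ⟨q, hq⟩ := hproj P fun _ => r
    have hr0 : (3 : ℝ) ≤ r := by exact_mod_cast hr
    have hr1 : (0 : ℝ) < r := by linarith
    have hK0 := P.maxStep_pos hT
    have h1 := hmain P _ (fun _ => hr) hstep U hU q hq (P.maxStep / r) (by positivity)
      ((div_le_self hK0.le (by linarith)).trans P.maxStep_le) fun n => by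
        rw [div_mul_cancel₀ _ hr1.ne']
        exact P.step_le_maxStep n
    rw [P.sum_integral_eq_sq hFm] at h1
    have h2 := P.eLpNorm_sub_glue_le_sobolevNorm hT (by omega) (by linarith) hFw hFm hq hus
    have h3 := ENNReal.toReal_mono (ENNReal.mul_ne_top ENNReal.ofReal_ne_top (ne_of_lt hus)) h2
    rw [ENNReal.toReal_mul, ENNReal.toReal_ofReal (by positivity)] at h3
    set D := (eLpNorm (fun t => f t (u t) (v t) - P.glue q t) 2
      (volume.restrict (Ioo 0 T))).toReal
    have hD : 0 ≤ D := ENNReal.toReal_nonneg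
    have h4 : CPG.L2Norm 0 T (u - U) ≤ √C * (P.maxStep / r) ^ 2 * D := by
      refine le_of_sq_le_sq (h1.trans_eq ?_) (by positivity)
      rw [mul_pow, mul_pow, Real.sq_sqrt hC.le]
      ring
    calc CPG.L2Norm 0 T (u - U)
        ≤ √C * (P.maxStep / r) ^ 2 * (8 * (s + 1) ^ (s - 1) *
          (P.maxStep ^ (min s (r : ℝ) - 1) / (r : ℝ) ^ (s - 1)) *
            CPG.sobolevNorm 0 T (s + 1) u) := h4.trans (by gcongr; exact h3)
      _ = _ := by
        rw [show min s (r : ℝ) + 1 = 2 + (min s (r : ℝ) - 1) by ring,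
          show s + 1 = 2 + (s - 1) by ring, Real.rpow_add hK0, Real.rpow_add hr1,
          Real.rpow_two, Real.rpow_two]
        field_simp
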